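/- Let $E_0,E_1$ be Banach spaces with $E_1$ densely and continuously embedded in $E_0$. For $\theta\in(0,1)$ let $E_\theta=(E_0,E_1)^0_{\theta,\infty}$ be the continuous interpolation space: with $K(t,x)=\inf\{|a|_{E_0}+t|b|_{E_1}: x=a+b\}$, it is the space of those $x\in E_0$ for which $\sup_{t>0}t^{-\theta}K(t,x)<\infty$ and $t^{-\theta}K(t,x)\to0$ as $t\to0^+$, with norm $|x|_{E_\theta}=\sup_{t>0}t^{-\theta}K(t,x)$. Fix $\mu\in(0,1)$. For $J=[0,T]$, $\dot J=(0,T]$ and a Banach space $E$, let $BC_{1-\mu}(J,E)$ be the set of $v\in C(\dot J,E)$ such that $t^{1-\mu}v(t)$ is bounded on $\dot J$ and $t^{1-\mu}|v(t)|_E\to0$ as $t\to0^+$, let $BC^1_{1-\mu}(J,E)=\{v\in C^1(\dot J,E): v,\dot v\in BC_{1-\mu}(J,E)\}$, and set $$\mathbb E_{0,\mu}(J)=BC_{1-\mu}(J,E_0),\qquad \mathbb E_{1,\mu}(J)=BC^1_{1-\mu}(J,E_0)\cap BC_{1-\mu}(J,E_1),$$ $$\|v\|_{\mathbb E_{1,\mu}(J)}=\sup_{t\in\dot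 J}t^{1-\mu}\big(|\dot v(t)|_{E_0}+|v(t)|_{E_1}\big).$$ For $v\in\mathbb E_{1,\mu}(J)$, $v(0)$ denotes the limit of $v(t)$ in $E_0$ as $t\to0^+$. Let $\mathcal M_\mu(E_1,E_0)$ be the set of $B\in\mathcal L(E_1,E_0)$ such that for some $T>0$, for every $(f,x)\in\mathbb E_{0,\mu}([0,T])\times E_\mu$, there is a unique $u\in\mathbb E_{1,\mu}([0,T])$ with $\dot u+Bu=f$ on $(0,T]$ and $u(0)=x$. Let $V_\mu\subset E_\mu$ be open, and assume: **(H1)** $(A,F_1):V_\mu\to\mathcal L(E_1,E_0)\times E_0$ is locally Lipschitz continuous and $A(x)\in\mathcal M_\mu(E_1,E_0)$ for all $x\in V_\mu$. **(H2)** There is $\beta\in(\mu,1)$ such that $F_2:V_\mu\cap E_\beta\to E_0$, and there are $m\in\mathbb N$ and numbers $\beta_j\in[\mu,\beta]$, $\rho_j\ge0$ with $$\frac{\rho_j(\beta-\mu)+(\beta_j-\mu)}{1-\mu}\le1\qquad(j=1,\dots,m),$$ such that for each $x_0\in V_\mu$ and $R>0$ there is a constant $C_R=C_R(x_0)>0$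 with $$|F_2(x_1)-F_2(x_2)|_{E_0}\le C_R\sum_{j=1}^m\big(1+|x_1|_{E_\beta}^{\rho_j}+|x_2|_{E_\beta}^{\rho_j}\big)|x_1-x_2|_{E_{\beta_j}}$$ for all $x_1,x_2\in\bar B_{E_\mu}(x_0,R)\cap V_\mu\cap E_\beta$. Consider the problem $$\dot u+A(u)u=F_1(u)+F_2(u)\quad(t>0),\qquad u(0)=x. \qquad (*)$$ A solution on $[0,T]$ is a function $u\in\mathbb E_{1,\mu}([0,T])$ with values in $V_\mu$ that satisfies the equation on $(0,T]$ and $u(0)=x\in V_\mu$. Then: **(a) Local solutions.** For every $x_0\in V_\mu$ there are $\tau,\varepsilon,\sigma>0$ such that for every $x\in\bar B_{E_\mu}(x_0,\varepsilon)$ problem $(*)$ has a unique solution $u(\cdot,x)\in\mathbb E_{1,\mu}([0,\tau])$, and $$\|u(\cdot,x_1)-u(\cdot,x_2)\|_{\mathbb E_{1,\mu}([0,\tau])}\le\sigma|x_1-x_2|_{E_\mu}\qquad\text{for all }x_1,x_2\in\bar B_{E_\mu}(x_0,\varepsilon).$$ **(b) Maximal solutions.** For every $x_0\in V_\mu$ there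 are $t^+=t^+(x_0)\in(0,\infty]$ and a function $u(\cdot,x_0)$ on $J(x_0):=[0,t^+)$ that is a solution with initial value $x_0$ on $[0,T]$ for every $T\in(0,t^+)$, and such that every solution with initial value $x_0$ on an interval $[0,T]$, $T>0$, satisfies $T<t^+$ and is the restriction of $u(\cdot,x_0)$. Moreover, $$u(\cdot,x_0)\in C([0,t^+),E_\mu)\cap C((0,t^+),E_1).$$ **(c) Global solutions.** Let $x_0\in V_\mu$. If (i) $u(\cdot,x_0):J(x_0)\to E_\mu$ is uniformly continuous, and (ii) there is $\eta>0$ with $\operatorname{dist}_{E_\mu}(u(t,x_0),\partial V_\mu)>\eta$ for all $t\in J(x_0)$ (where the distance to the empty set is $\infty$), then $t^+(x_0)=\infty$, that is, $u(\cdot,x_0)$ is a global solution of $(*)$. If the embedding $E_1\hookrightarrow E_0$ is compact, then condition (i) may be replaced by (i.a) for some $\delta\in(\mu,1]$ and some $\tau\in(0,t^+(x_0))$ the orbit $\{u(t,x_0):t\in[\tau,t^+(x_0))\}$ is bounded in $E_\delta$. -/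

import Mathlib

open Set Filter Topology

noncomputable section

namespace QuasiPar

section Interp

variable {E₀ E₁ : Type*} [NormedAddCommGroup E₀] [NormedSpace ℝ E₀]
  [NormedAddCommGroup E₁] [NormedSpace ℝ E₁]

/-- Peetre's `K`-functional of the pair `(E₀, E₁)`, where `E₁` is embedded in `E₀` by `ι`:
the infimum of `‖a‖ + t ‖y‖` over all decompositions `x = a + ι y`. -/
def kFun (ι : E₁ →L[ℝ] E₀) (t : ℝ) (x : E₀) : ℝ :=
  ⨅ y : E₁, (‖x - ι y‖ + t * ‖y‖)

/-- The norm `sup_{t > 0} t ^ (-θ) K(t, x)` of the real interpolation space `(E₀, E₁)_{θ,∞}`. -/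
def interpNorm (ι : E₁ →L[ℝ] E₀) (θ : ℝ) (x : E₀) : ℝ :=
  ⨆ t : Ioi (0 : ℝ), (t : ℝ) ^ (-θ) * kFun ι t x

theorem kFun_bdd (ι : E₁ →L[ℝ] E₀) {t : ℝ} (ht : 0 < t) (x : E₀) :
    BddBelow (range fun y : E₁ => ‖x - ι y‖ + t * ‖y‖) :=
  ⟨0, by rintro _ ⟨y, rfl⟩; positivity⟩

theorem kFun_nonneg (ι : E₁ →L[ℝ] E₀) {t : ℝ} (ht : 0 < t) (x : E₀) : 0 ≤ kFun ι t x :=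
  Real.iInf_nonneg fun y => by positivity

theorem kFun_le (ι : E₁ →L[ℝ] E₀) {t : ℝ} (ht : 0 < t) (x : E₀) (y : E₁) :
    kFun ι t x ≤ ‖x - ι y‖ + t * ‖y‖ :=
  ciInf_le (kFun_bdd ι ht x) y

theorem kFun_add (ι : E₁ →L[ℝ] E₀) {t : ℝ} (ht : 0 < t) (x x' : E₀) :
    kFun ι t (x + x') ≤ kFun ι t x + kFun ι t x' := by
  refine le_ciInf_add_ciInf fun y y' => ?_
  refine (kFun_le ι ht _ (y + y')).trans ?_
  have h1 : ‖x + x' - ι (y + y')‖ ≤ ‖x - ι y‖ + ‖x' - ι y'‖ := by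
    rw [map_add, add_sub_add_comm]; exact norm_add_le _ _
  have h2 := mul_le_mul_of_nonneg_left (norm_add_le y y') ht.le
  linarith

theorem kFun_smul (ι : E₁ →L[ℝ] E₀) {t : ℝ} (ht : 0 < t) (c : ℝ) (x : E₀) :
    kFun ι t (c • x) ≤ ‖c‖ * kFun ι t x := by
  unfold kFun
  rw [Real.mul_iInf_of_nonneg (norm_nonneg c)]
  refine le_ciInf fun y => ?_
  refine (kFun_le ι ht _ (c • y)).trans (le_of_eq ?_)
  rw [map_smul, ← smul_sub, norm_smul, norm_smul]; ring

theorem kFun_zero (ι : E₁ →L[ℝ] E₀) {t : ℝ} (ht : 0 < t) : kFun ι t 0 = 0 :=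
  le_antisymm (by simpa using kFun_le ι ht 0 0) (kFun_nonneg ι ht 0)

theorem norm_le_kFun (ι : E₁ →L[ℝ] E₀) (x : E₀) :
    ‖x‖ ≤ (1 + ‖ι‖) * kFun ι 1 x := by
  unfold kFun
  rw [Real.mul_iInf_of_nonneg (by positivity)]
  refine le_ciInf fun y => ?_
  have h1 : ‖x‖ ≤ ‖x - ι y‖ + ‖ι y‖ := by simpa using norm_add_le (x - ι y) (ι y)
  have h2 := ι.le_opNorm y
  nlinarith [norm_nonneg y, norm_nonneg ι, norm_nonneg (x - ι y),
    mul_nonneg (norm_nonneg ι) (norm_nonneg (x - ι y))]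

/-- The continuous interpolation space `(E₀, E₁)⁰_{θ,∞}` as a linear subspace of `E₀`: the
elements `x` of `(E₀, E₁)_{θ,∞}` for which `t ^ (-θ) K(t, x) → 0` as `t → 0+`.
For `0 < θ < 1` this is the closure of `E₁` in `(E₀, E₁)_{θ,∞}`. -/
def interpSubmodule (ι : E₁ →L[ℝ] E₀) (θ : ℝ) : Submodule ℝ E₀ where
  carrier := {x | BddAbove (range fun t : Ioi (0 : ℝ) => (t : ℝ) ^ (-θ) * kFun ι t x) ∧
    Tendsto (fun t : ℝ => t ^ (-θ) * kFun ι t x) (𝓝[>] 0) (𝓝 0)}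
  zero_mem' := by
    refine ⟨⟨0, ?_⟩, ?_⟩
    · rintro _ ⟨t, rfl⟩
      simp [kFun_zero ι t.2]
    · refine tendsto_const_nhds.congr' ?_
      filter_upwards [self_mem_nhdsWithin] with t ht
      simp [kFun_zero ι ht]
  add_mem' := by
    rintro x y ⟨⟨C, hC⟩, hx⟩ ⟨⟨D, hD⟩, hy⟩
    have key : ∀ t : ℝ, 0 < t → t ^ (-θ) * kFun ι t (x + y) ≤
        t ^ (-θ) * kFun ι t x + t ^ (-θ) * kFun ι t y := fun t ht => by
      rw [← mul_add]
      exact mul_le_mul_of_nonneg_left (kFun_add ι ht x y) (Real.rpow_nonneg ht.le _)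
    refine ⟨⟨C + D, ?_⟩, ?_⟩
    · rintro _ ⟨t, rfl⟩
      exact (key t t.2).trans (add_le_add (hC ⟨t, rfl⟩) (hD ⟨t, rfl⟩))
    · have h := hx.add hy
      rw [add_zero] at h
      refine tendsto_of_tendsto_of_tendsto_of_le_of_le' tendsto_const_nhds h ?_ ?_
      · filter_upwards [self_mem_nhdsWithin] with t ht
        exact mul_nonneg (Real.rpow_nonneg (le_of_lt ht) _) (kFun_nonneg ι ht _)
      · filter_upwards [self_mem_nhdsWithin] with t ht using key t ht
  smul_mem' := by
    rintro c x ⟨⟨C, hC⟩, hx⟩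
    have key : ∀ t : ℝ, 0 < t → t ^ (-θ) * kFun ι t (c • x) ≤
        ‖c‖ * (t ^ (-θ) * kFun ι t x) := fun t ht => by
      rw [mul_left_comm]
      exact mul_le_mul_of_nonneg_left (kFun_smul ι ht c x) (Real.rpow_nonneg ht.le _)
    refine ⟨⟨‖c‖ * C, ?_⟩, ?_⟩
    · rintro _ ⟨t, rfl⟩
      exact (key t t.2).trans (mul_le_mul_of_nonneg_left (hC ⟨t, rfl⟩) (norm_nonneg c))
    · have h := hx.const_mul ‖c‖
      rw [mul_zero] at h
      refine tendsto_of_tendsto_of_tendsto_of_le_of_le' tendsto_const_nhds h ?_ ?_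
      · filter_upwards [self_mem_nhdsWithin] with t ht
        exact mul_nonneg (Real.rpow_nonneg (le_of_lt ht) _) (kFun_nonneg ι ht _)
      · filter_upwards [self_mem_nhdsWithin] with t ht using key t ht

/-- The continuous interpolation space `E_θ = (E₀, E₁)⁰_{θ,∞}` as a type; it carries the norm of
`(E₀, E₁)_{θ,∞}` (below), not the norm of `E₀`. -/
def Interp (ι : E₁ →L[ℝ] E₀) (θ : ℝ) : Type _ := interpSubmodule ι θ

variable (ι : E₁ →L[ℝ] E₀) (θ : ℝ)

instance : AddCommGroup (Interp ι θ) := inferInstanceAs (AddCommGroup (interpSubmodule ι θ))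

instance : Module ℝ (Interp ι θ) := inferInstanceAs (Module ℝ (interpSubmodule ι θ))

variable {ι θ}

/-- The inclusion of `E_θ` in `E₀`. -/
def Interp.val (x : Interp ι θ) : E₀ := Subtype.val x

theorem Interp.bdd (x : Interp ι θ) :
    BddAbove (range fun t : Ioi (0 : ℝ) => (t : ℝ) ^ (-θ) * kFun ι t x.val) := x.2.1

theorem Interp.ext {x y : Interp ι θ} (h : x.val = y.val) : x = y := Subtype.ext h

variable (ι θ)

instance : Norm (Interp ι θ) := ⟨fun x => interpNorm ι θ x.val⟩

theorem Interp.core : NormedSpace.Core ℝ (Interp ι θ) where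
  norm_nonneg x := Real.iSup_nonneg fun t =>
    mul_nonneg (Real.rpow_nonneg (le_of_lt t.2) _) (kFun_nonneg ι t.2 _)
  norm_smul c x := by
    have hle : ∀ (c : ℝ) (x : Interp ι θ), ‖c • x‖ ≤ ‖c‖ * ‖x‖ := fun c x => by
      refine ciSup_le fun t => ?_
      have h1 := kFun_smul ι t.2 c x.val
      have h2 : (t : ℝ) ^ (-θ) * kFun ι t x.val ≤ ‖x‖ := le_ciSup x.bdd t
      calc (t : ℝ) ^ (-θ) * kFun ι t (c • x).val
          ≤ (t : ℝ) ^ (-θ) * (‖c‖ * kFun ι t x.val) :=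
            mul_le_mul_of_nonneg_left h1 (Real.rpow_nonneg (le_of_lt t.2) _)
        _ = ‖c‖ * ((t : ℝ) ^ (-θ) * kFun ι t x.val) := by ring
        _ ≤ ‖c‖ * ‖x‖ := mul_le_mul_of_nonneg_left h2 (norm_nonneg c)
    refine le_antisymm (hle c x) ?_
    by_cases hc : c = 0
    · subst hc
      rw [norm_zero, zero_mul]
      exact Real.iSup_nonneg fun t : Ioi (0 : ℝ) =>
        mul_nonneg (Real.rpow_nonneg (le_of_lt t.2) _) (kFun_nonneg ι t.2 _)
    · have h := hle c⁻¹ (c • x)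
      rw [inv_smul_smul₀ hc, norm_inv] at h
      have hc' : 0 < ‖c‖ := norm_pos_iff.2 hc
      calc ‖c‖ * ‖x‖ ≤ ‖c‖ * (‖c‖⁻¹ * ‖c • x‖) := mul_le_mul_of_nonneg_left h hc'.le
        _ = ‖c • x‖ := by field_simp
  norm_triangle x y := by
    refine ciSup_le fun t => ?_
    have h1 := kFun_add ι t.2 x.val y.val
    have h2 : (t : ℝ) ^ (-θ) * kFun ι t x.val ≤ ‖x‖ := le_ciSup x.bdd t
    have h3 : (t : ℝ) ^ (-θ) * kFun ι t y.val ≤ ‖y‖ := le_ciSup y.bdd t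
    have h4 := mul_le_mul_of_nonneg_left h1 (Real.rpow_nonneg (le_of_lt t.2) (-θ))
    rw [mul_add] at h4
    exact h4.trans (add_le_add h2 h3)
  norm_eq_zero_iff x := by
    constructor
    · intro h
      have h2 : ((1 : ℝ)) ^ (-θ) * kFun ι 1 x.val ≤ ‖x‖ :=
        le_ciSup x.bdd ⟨(1 : ℝ), mem_Ioi.2 one_pos⟩
      rw [h, Real.one_rpow, one_mul] at h2
      have h3 := norm_le_kFun ι x.val
      have h4 : kFun ι 1 x.val = 0 := le_antisymm h2 (kFun_nonneg ι one_pos _)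
      rw [h4, mul_zero] at h3
      exact Interp.ext (norm_le_zero_iff.1 h3)
    · rintro rfl
      refine le_antisymm (ciSup_le fun t => ?_) (Real.iSup_nonneg fun t =>
        mul_nonneg (Real.rpow_nonneg (le_of_lt t.2) _) (kFun_nonneg ι t.2 _))
      have : kFun ι t (0 : Interp ι θ).val = 0 := kFun_zero ι t.2
      rw [this, mul_zero]

instance : NormedAddCommGroup (Interp ι θ) := NormedAddCommGroup.ofCore (Interp.core ι θ)

instance : NormedSpace ℝ (Interp ι θ) := NormedSpace.ofCore (Interp.core ι θ)

variable {θ}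

theorem mem_interp (hθ : θ ∈ Ioo (0 : ℝ) 1) (y : E₁) : ι y ∈ interpSubmodule ι θ := by
  have h1 : ∀ t : ℝ, 0 < t → t ^ (-θ) * kFun ι t (ι y) ≤ t ^ (1 - θ) * ‖y‖ := fun t ht => by
    have h := kFun_le ι ht (ι y) y
    rw [sub_self, norm_zero, zero_add] at h
    calc t ^ (-θ) * kFun ι t (ι y) ≤ t ^ (-θ) * (t * ‖y‖) :=
          mul_le_mul_of_nonneg_left h (Real.rpow_nonneg ht.le _)
      _ = t ^ (1 - θ) * ‖y‖ := by
          rw [← mul_assoc, ← Real.rpow_add_one ht.ne', neg_add_eq_sub]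
  refine ⟨⟨‖y‖ + ‖ι y‖, ?_⟩, ?_⟩
  · rintro _ ⟨⟨t, ht⟩, rfl⟩
    have ht' : 0 < t := ht
    rcases le_total t 1 with h | h
    · have h2 : t ^ (1 - θ) ≤ 1 := Real.rpow_le_one ht'.le h (by linarith [hθ.2])
      have h3 := h1 t ht'
      have h4 := mul_le_mul_of_nonneg_right h2 (norm_nonneg y)
      have h5 := norm_nonneg (ι y)
      dsimp only
      linarith
    · have h2 : t ^ (-θ) ≤ 1 := Real.rpow_le_one_of_one_le_of_nonpos h (by linarith [hθ.1])
      have h3 := kFun_le ι ht' (ι y) 0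
      simp only [map_zero, sub_zero, norm_zero, mul_zero, add_zero] at h3
      have h4 := mul_le_mul h2 h3 (kFun_nonneg ι ht' _) zero_le_one
      have h5 := norm_nonneg y
      dsimp only
      linarith
  · have h : Tendsto (fun t : ℝ => t ^ (1 - θ) * ‖y‖) (𝓝[>] 0) (𝓝 0) := by
      have h0 : ContinuousAt (fun t : ℝ => t ^ (1 - θ)) 0 :=
        Real.continuousAt_rpow_const 0 _ (Or.inr (by linarith [hθ.2]))
      have h2 : Tendsto (fun t : ℝ => t ^ (1 - θ)) (𝓝[>] 0) (𝓝 0) := by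
        have := h0.tendsto.mono_left (nhdsWithin_le_nhds (s := Ioi (0 : ℝ)))
        rwa [Real.zero_rpow (by linarith [hθ.2])] at this
      simpa using h2.mul_const ‖y‖
    refine tendsto_of_tendsto_of_tendsto_of_le_of_le' tendsto_const_nhds h ?_ ?_
    · filter_upwards [self_mem_nhdsWithin] with t ht
      exact mul_nonneg (Real.rpow_nonneg (le_of_lt ht) _) (kFun_nonneg ι ht _)
    · filter_upwards [self_mem_nhdsWithin] with t ht using h1 t ht

/-- The embedding of `E₁` in `E_θ`, `0 < θ < 1`. -/
def Interp.of (hθ : θ ∈ Ioo (0 : ℝ) 1) (y : E₁) : Interp ι θ := ⟨ι y, mem_interp ι hθ y⟩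

/-- The norm of `y ∈ E₁` in `E_δ`, `0 < δ ≤ 1`: for `δ < 1` that of the interpolation space, and
for `δ = 1` that of the given space `E₁`. -/
def scaleNorm (δ : ℝ) (y : E₁) : ℝ :=
  if δ = 1 then ‖y‖ else interpNorm ι δ (ι y)

end Interp

section Weighted

/-- `v ∈ BC_{1-μ}([0,T], E)`: `v` is continuous on `(0,T]`, `t ^ (1-μ) v(t)` is bounded there
and tends to `0` as `t → 0+`. Only the values of `v` on `(0,T]` matter. -/
def MemBC {E : Type*} [NormedAddCommGroup E] (μ T : ℝ) (v : ℝ → E) : Prop :=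
  ContinuousOn v (Ioc 0 T) ∧
  (∃ C : ℝ, ∀ t ∈ Ioc 0 T, t ^ (1 - μ) * ‖v t‖ ≤ C) ∧
  Tendsto (fun t : ℝ => t ^ (1 - μ) * ‖v t‖) (𝓝[>] 0) (𝓝 0)

/-- `v ∈ BC¹_{1-μ}([0,T], E)`: `v ∈ C¹((0,T], E)` and `v`, `v'` belong to `BC_{1-μ}([0,T], E)`;
the derivative at `T` is one-sided. -/
def MemBC1 {E : Type*} [NormedAddCommGroup E] [NormedSpace ℝ E] (μ T : ℝ) (v : ℝ → E) : Prop :=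
  DifferentiableOn ℝ v (Ioc 0 T) ∧ MemBC μ T v ∧ MemBC μ T (derivWithin v (Ioc 0 T))

variable {E₀ E₁ : Type*} [NormedAddCommGroup E₀] [NormedSpace ℝ E₀]
  [NormedAddCommGroup E₁] [NormedSpace ℝ E₁] (ι : E₁ →L[ℝ] E₀)

/-- The time derivative, in `E₀`, of a function `u : (0,T] → E₁`. -/
def dt (T : ℝ) (u : ℝ → E₁) (t : ℝ) : E₀ :=
  derivWithin (fun s => ι (u s)) (Ioc 0 T) t

/-- `u ∈ 𝔼_{1,μ}([0,T]) = BC¹_{1-μ}([0,T], E₀) ∩ BC_{1-μ}([0,T], E₁)`. -/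
def MemE1 (μ T : ℝ) (u : ℝ → E₁) : Prop :=
  MemBC1 μ T (fun t => ι (u t)) ∧ MemBC μ T u

/-- The norm of `𝔼_{1,μ}([0,T])`. -/
def normE1 (μ T : ℝ) (u : ℝ → E₁) : ℝ :=
  ⨆ t : Ioc 0 T, (t : ℝ) ^ (1 - μ) * (‖dt ι T u t‖ + ‖u t‖)

/-- `u(0) = x` in the sense of the trace operator: `u(t) → x` in `E₀` as `t → 0+`. -/
def HasTrace (u : ℝ → E₁) (x : E₀) : Prop :=
  Tendsto (fun t => ι (u t)) (𝓝[>] 0) (𝓝 x)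

/-- The set `𝓜_μ(E₁, E₀)` of the operators with continuous maximal regularity: for some `T > 0`
and every `(f, x) ∈ 𝔼_{0,μ}([0,T]) × E_μ` the linear problem `u' + B u = f` on `(0,T]`,
`u(0) = x`, has exactly one solution in `𝔼_{1,μ}([0,T])`. -/
def maxReg (μ : ℝ) : Set (E₁ →L[ℝ] E₀) :=
  {B | ∃ T : ℝ, 0 < T ∧ ∀ f : ℝ → E₀, MemBC μ T f → ∀ x : Interp ι μ,
    let Solves : (ℝ → E₁) → Prop := fun u =>
      MemE1 ι μ T u ∧ (∀ t ∈ Ioc 0 T, dt ι T u t + B (u t) = f t) ∧ HasTrace ι u x.val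
    ∃ u, Solves u ∧ ∀ v, Solves v → EqOn v u (Ioc 0 T)}

end Weighted

section Equation

variable {E₀ E₁ : Type*} [NormedAddCommGroup E₀] [NormedSpace ℝ E₀]
  [NormedAddCommGroup E₁] [NormedSpace ℝ E₁] (ι : E₁ →L[ℝ] E₀) {μ : ℝ}

/-- Condition (H1): `(A, F₁) ∈ C^{1-}(V, 𝓜_μ(E₁, E₀) × E₀)`. -/
def H1 (V : Set (Interp ι μ)) (A : Interp ι μ → E₁ →L[ℝ] E₀) (F₁ : Interp ι μ → E₀) : Prop :=
  LocallyLipschitzOn V (fun x => (A x, F₁ x)) ∧ ∀ x ∈ V, A x ∈ maxReg ι μ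

/-- Condition (H2). The nonlinearity `F₂` is only evaluated on `V ∩ E_β`; its values elsewhere
are irrelevant. -/
def H2 (V : Set (Interp ι μ)) (F₂ : Interp ι μ → E₀) : Prop :=
  ∃ β ∈ Ioo μ 1, ∃ (m : ℕ) (b ρ : Fin m → ℝ),
    (∀ j, b j ∈ Icc μ β ∧ 0 ≤ ρ j ∧ (ρ j * (β - μ) + (b j - μ)) / (1 - μ) ≤ 1) ∧
    ∀ x₀ ∈ V, ∀ R > 0, ∃ C > 0, ∀ x₁ ∈ Metric.closedBall x₀ R ∩ V,
      ∀ x₂ ∈ Metric.closedBall x₀ R ∩ V,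
      x₁.val ∈ interpSubmodule ι β → x₂.val ∈ interpSubmodule ι β →
        ‖F₂ x₁ - F₂ x₂‖ ≤ C * ∑ j,
          (1 + interpNorm ι β x₁.val ^ ρ j + interpNorm ι β x₂.val ^ ρ j) *
            interpNorm ι (b j) (x₁.val - x₂.val)

variable (hμ : μ ∈ Ioo (0 : ℝ) 1) (V : Set (Interp ι μ)) (A : Interp ι μ → E₁ →L[ℝ] E₀)
  (F₁ F₂ : Interp ι μ → E₀)

/-- `u ∈ 𝔼_{1,μ}([0,T])` is a (`V`-valued) solution of `u' + A(u) u = F₁(u) + F₂(u)` on `(0,T]`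
with `u(0) = x`. -/
def IsSolution (x : Interp ι μ) (T : ℝ) (u : ℝ → E₁) : Prop :=
  MemE1 ι μ T u ∧ x ∈ V ∧ HasTrace ι u x.val ∧
  ∀ t ∈ Ioc 0 T, Interp.of ι hμ (u t) ∈ V ∧
    dt ι T u t + A (Interp.of ι hμ (u t)) (u t) =
      F₁ (Interp.of ι hμ (u t)) + F₂ (Interp.of ι hμ (u t))

/-- `u` is the maximal solution with initial value `x`, on the right-open interval `[0, tp)`,
`0 < tp ≤ ∞`: it is a solution on `[0,T]` for all `0 < T < tp`, and every solution on an interval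
`[0,T]` is a restriction of `u`, with `T < tp`. -/
def IsMaximalSolution (x : Interp ι μ) (tp : EReal) (u : ℝ → E₁) : Prop :=
  0 < tp ∧
  (∀ T : ℝ, 0 < T → (T : EReal) < tp → IsSolution ι hμ V A F₁ F₂ x T u) ∧
  ∀ (T : ℝ) (v : ℝ → E₁), 0 < T → IsSolution ι hμ V A F₁ F₂ x T v →
    (T : EReal) < tp ∧ EqOn v u (Ioc 0 T)

/-- The orbit `t ↦ u(t) ∈ E_μ` of a solution `u` with initial value `x`, including `u(0) = x`. -/
def orbit (x : Interp ι μ) (u : ℝ → E₁) (t : ℝ) : Interp ι μ :=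
  if 0 < t then Interp.of ι hμ (u t) else x

/-- The distance of the orbit to the boundary of `V` in `E_μ` is bounded below by some `η > 0`
(the distance to the empty set being infinite). -/
def AwayFromBoundary (x : Interp ι μ) (tp : EReal) (u : ℝ → E₁) : Prop :=
  ∃ η : ℝ, 0 < η ∧ ∀ t : ℝ, 0 ≤ t → (t : EReal) < tp →
    ENNReal.ofReal η < Metric.infEDist (orbit ι hμ x u t) (frontier V)

end Equation

end QuasiPar

end

/-!
Near `x₀` the equation is rewritten as `u' + A(x₀) u = G(u)`, where `G` is Lipschitz in `u`,
measured by `|u|_{E_μ} + t ^ (1-μ) |u|_{E₁}`, after multiplication by `t ^ (1-μ)`, with a constant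
that is as small as desired for small times and values close to `x₀`: for the quasilinear term
this is (H1), and for `F₂` it follows from (H2) by interpolating `E_β` and `E_{β_j}` between `E_μ`
and `E₁`. Maximal regularity and the closed graph theorem give a bounded solution operator for the
linear problem, so the solutions of the nonlinear one are the fixed points of a contraction in
`G(u)`. As the time of existence is uniform near each point of `V`, a maximal solution on a finite
interval `[0, t⁺)` has no cluster point in `V` as `t → t⁺`. Uniform continuity produces a cluster
point, and so does a bound in `E_δ`, since `E_δ` embeds compactly in `E_μ` if `E₁` does in `E₀`.
-/

noncomputable section

namespace QuasiPar

section Interpolation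

variable {E₀ E₁ : Type*} [NormedAddCommGroup E₀] [NormedSpace ℝ E₀]
  [NormedAddCommGroup E₁] [NormedSpace ℝ E₁] {ι : E₁ →L[ℝ] E₀} {θ μ t : ℝ} {x : E₀}

theorem kFun_le_norm (ι : E₁ →L[ℝ] E₀) (ht : 0 < t) (x : E₀) : kFun ι t x ≤ ‖x‖ := by
  simpa using kFun_le ι ht x 0

theorem kFun_map_le (ι : E₁ →L[ℝ] E₀) (ht : 0 < t) (y : E₁) : kFun ι t (ι y) ≤ t * ‖y‖ := by
  simpa using kFun_le ι ht (ι y) y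

theorem kFun_sub_le_kFun_sub (ι : E₁ →L[ℝ] E₀) (ht : 0 < t) (x y : E₀) :
    kFun ι t (x - y) ≤ kFun ι t (y - x) := by
  simpa using kFun_smul ι ht (-1) (y - x)

theorem kFun_le_of_tendsto {α : Type*} {l : Filter α} [l.NeBot] {f : α → E₀} {C : ℝ}
    (ht : 0 < t) (hf : Tendsto f l (𝓝 x)) (h : ∀ᶠ a in l, kFun ι t (f a) ≤ C) :
    kFun ι t x ≤ C := by
  have hlim : Tendsto (fun a => C + ‖f a - x‖) l (𝓝 C) := by
    simpa using (tendsto_iff_norm_sub_tendsto_zero.1 hf).const_add C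
  refine ge_of_tendsto hlim (h.mono fun a ha => ?_)
  calc kFun ι t x = kFun ι t (f a + (x - f a)) := by rw [add_sub_cancel]
    _ ≤ kFun ι t (f a) + kFun ι t (x - f a) := kFun_add ι ht _ _
    _ ≤ C + ‖f a - x‖ := by
      rw [norm_sub_rev]
      exact add_le_add ha (kFun_le_norm ι ht _)

theorem kFun_le_rpow_interpolate {a b γ C D : ℝ} (ht : 0 < t) (hC : 0 ≤ C) (hD : 0 ≤ D)
    (hγ : γ ∈ Icc (0 : ℝ) 1) (h₀ : kFun ι t x ≤ t ^ a * C) (h₁ : kFun ι t x ≤ t ^ b * D) :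
    kFun ι t x ≤ t ^ ((1 - γ) * a + γ * b) * (C ^ (1 - γ) * D ^ γ) := by
  have hK := kFun_nonneg ι ht x
  have hγ' : 0 ≤ 1 - γ := sub_nonneg.2 hγ.2
  calc kFun ι t x = kFun ι t x ^ (1 - γ) * kFun ι t x ^ γ := by
        rw [← Real.rpow_add_of_nonneg hK hγ' hγ.1, sub_add_cancel, Real.rpow_one]
    _ ≤ (t ^ a * C) ^ (1 - γ) * (t ^ b * D) ^ γ :=
        mul_le_mul (Real.rpow_le_rpow hK h₀ hγ') (Real.rpow_le_rpow hK h₁ hγ.1)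
          (Real.rpow_nonneg hK _) (by positivity)
    _ = (t ^ (a * (1 - γ)) * t ^ (b * γ)) * (C ^ (1 - γ) * D ^ γ) := by
        rw [Real.mul_rpow (by positivity) hC, Real.mul_rpow (by positivity) hD,
          ← Real.rpow_mul ht.le, ← Real.rpow_mul ht.le]
        ring
    _ = t ^ ((1 - γ) * a + γ * b) * (C ^ (1 - γ) * D ^ γ) := by
        rw [← Real.rpow_add ht, mul_comm a, mul_comm b]

theorem rpow_neg_mul_le_iff {a b : ℝ} (ht : 0 < t) : t ^ (-θ) * a ≤ b ↔ a ≤ t ^ θ * b := by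
  rw [Real.rpow_neg ht.le, inv_mul_le_iff₀ (Real.rpow_pos_of_pos ht _)]

theorem interpNorm_nonneg (ι : E₁ →L[ℝ] E₀) (θ : ℝ) (x : E₀) : 0 ≤ interpNorm ι θ x :=
  Real.iSup_nonneg fun t => mul_nonneg (Real.rpow_nonneg (le_of_lt t.2) _) (kFun_nonneg ι t.2 _)

theorem interpNorm_le_of_kFun_le {C : ℝ} (h : ∀ t > 0, kFun ι t x ≤ t ^ θ * C) :
    interpNorm ι θ x ≤ C :=
  ciSup_le fun t => (rpow_neg_mul_le_iff t.2).2 (h t t.2)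

theorem Interp.kFun_val_le (x : Interp ι θ) (ht : 0 < t) : kFun ι t x.val ≤ t ^ θ * ‖x‖ :=
  (rpow_neg_mul_le_iff ht).1 (le_ciSup x.bdd ⟨t, ht⟩)

theorem Interp.norm_le_of_kFun_le {x : Interp ι θ} {C : ℝ}
    (h : ∀ t > 0, kFun ι t x.val ≤ t ^ θ * C) : ‖x‖ ≤ C :=
  interpNorm_le_of_kFun_le h

theorem Interp.norm_val_le (x : Interp ι θ) : ‖x.val‖ ≤ (1 + ‖ι‖) * ‖x‖ := by
  refine (norm_le_kFun ι x.val).trans (mul_le_mul_of_nonneg_left ?_ (by positivity))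
  simpa using x.kFun_val_le one_pos

theorem Interp.val_sub (x y : Interp ι θ) : (x - y).val = x.val - y.val := rfl

variable (ι θ) in
/-- The inclusion `E_θ → E₀` as a continuous linear map. -/
def Interp.valL : Interp ι θ →L[ℝ] E₀ :=
  LinearMap.mkContinuous ⟨⟨Interp.val, fun _ _ => rfl⟩, fun _ _ => rfl⟩ (1 + ‖ι‖)
    fun x => x.norm_val_le

theorem Interp.norm_of_le (hθ : θ ∈ Ioo (0 : ℝ) 1) (y : E₁) :
    ‖Interp.of ι hθ y‖ ≤ (1 + ‖ι‖) * ‖y‖ := by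
  set C := (1 + ‖ι‖) * ‖y‖
  have hC : 0 ≤ C := by positivity
  have hιy : ‖ι y‖ ≤ C := (ι.le_opNorm y).trans
    (mul_le_mul_of_nonneg_right (by linarith) (norm_nonneg y))
  have hy : ‖y‖ ≤ C := le_mul_of_one_le_left (norm_nonneg y) (by linarith [norm_nonneg ι])
  refine Interp.norm_le_of_kFun_le fun t ht => ?_
  have h₀ : kFun ι t (ι y) ≤ t ^ (0 : ℝ) * C := by
    simpa using (kFun_le_norm ι ht _).trans hιy
  have h₁ : kFun ι t (ι y) ≤ t ^ (1 : ℝ) * C := by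
    simpa using (kFun_map_le ι ht y).trans (mul_le_mul_of_nonneg_left hy ht.le)
  have h := kFun_le_rpow_interpolate ht hC hC ⟨hθ.1.le, hθ.2.le⟩ h₀ h₁
  rwa [← Real.rpow_add_of_nonneg hC (by linarith [hθ.2]) hθ.1.le, sub_add_cancel, Real.rpow_one,
    mul_zero, zero_add, mul_one] at h

variable (ι) in
/-- The embedding `E₁ → E_θ` as a continuous linear map. -/
def Interp.ofL (hθ : θ ∈ Ioo (0 : ℝ) 1) : E₁ →L[ℝ] Interp ι θ :=
  LinearMap.mkContinuous ⟨⟨Interp.of ι hθ, fun x y => Interp.ext (map_add ι x y)⟩,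
    fun c x => Interp.ext (map_smul ι c x)⟩ (1 + ‖ι‖) fun x => Interp.norm_of_le hθ x

theorem Interp.of_sub (hθ : θ ∈ Ioo (0 : ℝ) 1) (y z : E₁) :
    Interp.of ι hθ (y - z) = Interp.of ι hθ y - Interp.of ι hθ z :=
  map_sub (Interp.ofL ι hθ) y z

theorem interpNorm_le_rpow_mul_rpow (hμ : μ ∈ Ioo (0 : ℝ) 1) (hθ : θ ∈ Icc μ 1) (y : E₁) :
    interpNorm ι θ (ι y) ≤
      ‖Interp.of ι hμ y‖ ^ (1 - (θ - μ) / (1 - μ)) * ‖y‖ ^ ((θ - μ) / (1 - μ)) := by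
  have hμ' : 0 < 1 - μ := sub_pos.2 hμ.2
  have hγ : (θ - μ) / (1 - μ) ∈ Icc (0 : ℝ) 1 :=
    ⟨div_nonneg (sub_nonneg.2 hθ.1) hμ'.le, (div_le_one hμ').2 (by linarith [hθ.2])⟩
  refine interpNorm_le_of_kFun_le fun t ht => ?_
  have h := kFun_le_rpow_interpolate (b := 1) ht (norm_nonneg _) (norm_nonneg y) hγ
    ((Interp.of ι hμ y).kFun_val_le ht) ((kFun_map_le ι ht y).trans_eq (by rw [Real.rpow_one]))
  rwa [show (1 - (θ - μ) / (1 - μ)) * μ + (θ - μ) / (1 - μ) * 1 = θ by field_simp; ring] at h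

theorem mem_interpSubmodule_of_approx
    (h : ∀ ε > 0, ∃ y : Interp ι θ, ∀ t > 0, kFun ι t (x - y.val) ≤ t ^ θ * ε) :
    x ∈ interpSubmodule ι θ := by
  have happrox : ∀ ε > 0, ∃ y : Interp ι θ, ∀ t > 0,
      t ^ (-θ) * kFun ι t x ≤ t ^ (-θ) * kFun ι t y.val + ε := fun ε hε => by
    obtain ⟨y, hy⟩ := h ε hε
    refine ⟨y, fun t ht => ?_⟩
    calc t ^ (-θ) * kFun ι t x
        ≤ t ^ (-θ) * (kFun ι t y.val + kFun ι t (x - y.val)) := by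
          refine mul_le_mul_of_nonneg_left ?_ (by positivity)
          simpa using kFun_add ι ht y.val (x - y.val)
      _ ≤ t ^ (-θ) * kFun ι t y.val + ε := by
          rw [mul_add]
          exact add_le_add_right ((rpow_neg_mul_le_iff ht).2 (hy t ht)) _
  constructor
  · obtain ⟨y, hy⟩ := happrox 1 one_pos
    obtain ⟨C, hC⟩ := y.bdd
    refine ⟨C + 1, forall_mem_range.2 fun t => ?_⟩
    exact (hy t t.2).trans (add_le_add_left (hC (mem_range_self t)) 1)
  · refine tendsto_order.2 ⟨fun a ha => ?_, fun ε hε => ?_⟩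
    · filter_upwards [self_mem_nhdsWithin] with t ht
      exact ha.trans_le (mul_nonneg (Real.rpow_nonneg (le_of_lt ht) _) (kFun_nonneg ι ht _))
    · obtain ⟨y, hy⟩ := happrox (ε / 2) (half_pos hε)
      have hlim : Tendsto (fun t => t ^ (-θ) * kFun ι t y.val) (𝓝[>] 0) (𝓝 0) := y.2.2
      filter_upwards [self_mem_nhdsWithin, hlim.eventually_lt_const (half_pos hε)] with t ht hlt
      linarith [hy t ht]

theorem Interp.kFun_sub_le_of_tendsto_val {s : ℕ → Interp ι θ} {n : ℕ} {ε : ℝ} (ht : 0 < t)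
    (hs : Tendsto (fun m => (s m).val) atTop (𝓝 x)) (h : ∀ᶠ m in atTop, ‖s n - s m‖ ≤ ε) :
    kFun ι t ((s n).val - x) ≤ t ^ θ * ε := by
  refine kFun_le_of_tendsto ht (hs.const_sub (s n).val) ?_
  filter_upwards [h] with m hm
  rw [← Interp.val_sub]
  exact ((s n - s m).kFun_val_le ht).trans (mul_le_mul_of_nonneg_left hm (by positivity))

instance [CompleteSpace E₀] : CompleteSpace (Interp ι θ) := by
  refine Metric.complete_of_cauchySeq_tendsto fun s hs => ?_
  obtain ⟨z, hz⟩ := cauchySeq_tendsto_of_complete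
    ((Interp.valL ι θ).uniformContinuous.comp_cauchySeq hs)
  have hclose : ∀ ε > 0, ∃ N, ∀ n ≥ N, ∀ t > 0, kFun ι t ((s n).val - z) ≤ t ^ θ * ε := by
    intro ε hε
    obtain ⟨N, hN⟩ := Metric.cauchySeq_iff.1 hs ε hε
    refine ⟨N, fun n hn t ht => Interp.kFun_sub_le_of_tendsto_val ht hz ?_⟩
    filter_upwards [eventually_ge_atTop N] with m hm
    rw [← dist_eq_norm]
    exact (hN n hn m hm).le
  have hmem : z ∈ interpSubmodule ι θ := by
    refine mem_interpSubmodule_of_approx fun ε hε => ?_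
    obtain ⟨N, hN⟩ := hclose ε hε
    exact ⟨s N, fun t ht => (kFun_sub_le_kFun_sub ι ht _ _).trans (hN N le_rfl t ht)⟩
  obtain ⟨z, rfl⟩ : ∃ Z : Interp ι θ, Z.val = z := ⟨⟨z, hmem⟩, rfl⟩
  refine ⟨z, Metric.tendsto_atTop.2 fun ε hε => ?_⟩
  obtain ⟨N, hN⟩ := hclose (ε / 2) (half_pos hε)
  refine ⟨N, fun n hn => ?_⟩
  rw [dist_eq_norm]
  have hle : ‖s n - z‖ ≤ ε / 2 := Interp.norm_le_of_kFun_le fun t ht => by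
    rw [Interp.val_sub]
    exact hN n hn t ht
  exact hle.trans_lt (half_lt_self hε)

end Interpolation

section WeightedFunctions

variable {E : Type*} {μ a T τ : ℝ} {v w : ℝ → E}

/-- The concatenation of `v` on `(-∞, T]` with the translate of `w` by `a`. -/
def glue (a T : ℝ) (v w : ℝ → E) (t : ℝ) : E := if t ≤ T then v t else w (t - a)

theorem glue_of_le {t : ℝ} (v w : ℝ → E) (h : t ≤ T) : glue a T v w t = v t := if_pos h

theorem glue_of_lt {t : ℝ} (h : EqOn w (fun s => v (a + s)) (Ioc 0 (T - a))) (hat : a < t) :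
    glue a T v w t = w (t - a) := by
  rcases le_or_gt t T with ht | ht
  · rw [glue_of_le _ _ ht, h ⟨sub_pos.2 hat, by linarith⟩]
    simp only [add_sub_cancel]
  · exact if_neg ht.not_ge

variable [NormedAddCommGroup E]

theorem exists_forall_mem_Ioc_of_eventually {p : ℝ → Prop} (h : ∀ᶠ t in 𝓝[>] 0, p t) :
    ∃ d > 0, ∀ t ∈ Ioc 0 d, p t :=
  mem_nhdsGT_iff_exists_Ioc_subset.1 h

theorem tendsto_rpow_nhdsGT_zero {p : ℝ} (hp : 0 < p) :
    Tendsto (fun t : ℝ => t ^ p) (𝓝[>] 0) (𝓝 0) := by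
  simpa [Real.zero_rpow hp.ne'] using
    (Real.continuousAt_rpow_const 0 p (Or.inr hp.le)).tendsto.mono_left nhdsWithin_le_nhds

theorem continuousOn_rpow_Ioc (p T : ℝ) : ContinuousOn (fun t : ℝ => t ^ p) (Ioc 0 T) :=
  fun t ht => (Real.continuousAt_rpow_const t p (Or.inl ht.1.ne')).continuousWithinAt

theorem Ioc_mem_nhdsWithin_Ioc {t : ℝ} (h : a < t) : Ioc a T ∈ 𝓝[Ioc 0 T] t := by
  filter_upwards [self_mem_nhdsWithin, mem_nhdsWithin_of_mem_nhds (Ioi_mem_nhds h)]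
    with s hs has using ⟨has, hs.2⟩

theorem continuousOn_rpow_smul_Icc [NormedSpace ℝ E] (hμ : μ < 1)
    (hv : ContinuousOn v (Ioc 0 T))
    (h₀ : Tendsto (fun t : ℝ => t ^ (1 - μ) * ‖v t‖) (𝓝[>] 0) (𝓝 0)) :
    ContinuousOn (fun t : ℝ => t ^ (1 - μ) • v t) (Icc 0 T) := by
  have hpos : ContinuousOn (fun t : ℝ => t ^ (1 - μ) • v t) (Ioc 0 T) :=
    (continuousOn_rpow_Ioc _ _).smul hv
  intro t ht
  rcases eq_or_lt_of_le ht.1 with rfl | h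
  · have hlim : Tendsto (fun t : ℝ => t ^ (1 - μ) • v t) (𝓝[>] 0) (𝓝 0) := by
      refine tendsto_zero_iff_norm_tendsto_zero.2 (h₀.congr' ?_)
      filter_upwards [self_mem_nhdsWithin] with s (hs : 0 < s)
      rw [norm_smul, Real.norm_of_nonneg (by positivity)]
    have hzero : ContinuousWithinAt (fun t : ℝ => t ^ (1 - μ) • v t) (Ioi 0) 0 := by
      simpa [ContinuousWithinAt, Real.zero_rpow (sub_pos.2 hμ).ne'] using hlim
    exact (continuousWithinAt_insert_self.2 hzero).mono fun s hs => by simpa using hs.1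
  · exact (hpos t ⟨h, ht.2⟩).mono_of_mem_nhdsWithin <| by
      filter_upwards [self_mem_nhdsWithin, mem_nhdsWithin_of_mem_nhds (Ioi_mem_nhds h)]
        with s hs hs' using ⟨hs', hs.2⟩

theorem memBC_of_eventually_le [NormedSpace ℝ E] {g : ℝ → ℝ} (hμ : μ < 1)
    (hv : ContinuousOn v (Ioc 0 T)) (hle : ∀ᶠ t in 𝓝[>] 0, t ^ (1 - μ) * ‖v t‖ ≤ g t)
    (hg : Tendsto g (𝓝[>] 0) (𝓝 0)) : MemBC μ T v := by
  have h₀ : Tendsto (fun t : ℝ => t ^ (1 - μ) * ‖v t‖) (𝓝[>] 0) (𝓝 0) := by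
    refine squeeze_zero' ?_ hle hg
    filter_upwards [self_mem_nhdsWithin] with t (ht : 0 < t)
    positivity
  obtain ⟨C, hC⟩ :=
    isCompact_Icc.exists_bound_of_continuousOn (continuousOn_rpow_smul_Icc hμ hv h₀)
  refine ⟨hv, ⟨C, fun t ht => ?_⟩, h₀⟩
  have hpos := ht.1
  simpa only [norm_smul, Real.norm_of_nonneg (Real.rpow_nonneg hpos.le _)]
    using hC t ⟨hpos.le, ht.2⟩

theorem memBC_of_continuousOn_Icc [NormedSpace ℝ E] (hμ : μ < 1) (hT : 0 < T)
    (hv : ContinuousOn v (Icc 0 T)) : MemBC μ T v := by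
  obtain ⟨C, hC⟩ := isCompact_Icc.exists_bound_of_continuousOn hv
  have hlim := (tendsto_rpow_nhdsGT_zero (sub_pos.2 hμ)).mul_const C
  rw [zero_mul] at hlim
  refine memBC_of_eventually_le hμ (hv.mono Ioc_subset_Icc_self) ?_ hlim
  filter_upwards [Ioc_mem_nhdsGT hT] with t ht
  exact mul_le_mul_of_nonneg_left (hC t ⟨ht.1.le, ht.2⟩) (Real.rpow_nonneg ht.1.le _)

namespace MemBC

theorem congr (hv : MemBC μ T v) (hT : 0 < T) (h : EqOn w v (Ioc 0 T)) : MemBC μ T w := by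
  obtain ⟨hcont, ⟨C, hC⟩, hlim⟩ := hv
  refine ⟨hcont.congr h, ⟨C, fun t ht => by rw [h ht]; exact hC t ht⟩, hlim.congr' ?_⟩
  filter_upwards [Ioc_mem_nhdsGT hT] with t ht
  rw [h ht]

theorem mono (hv : MemBC μ T v) (h : τ ≤ T) : MemBC μ τ v :=
  ⟨hv.1.mono (Ioc_subset_Ioc_right h), hv.2.1.imp fun _ hC t ht => hC t ⟨ht.1, ht.2.trans h⟩,
    hv.2.2⟩

theorem neg (hv : MemBC μ T v) : MemBC μ T (fun t => -v t) := by
  refine ⟨hv.1.neg, ?_⟩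
  simpa only [norm_neg] using hv.2

section Real

variable [NormedSpace ℝ E]

theorem add (hμ : μ < 1) (hv : MemBC μ T v) (hw : MemBC μ T w) :
    MemBC μ T (fun t => v t + w t) := by
  have hlim := hv.2.2.add hw.2.2
  rw [add_zero] at hlim
  refine memBC_of_eventually_le hμ (hv.1.add hw.1) ?_ hlim
  filter_upwards [self_mem_nhdsWithin] with t (ht : 0 < t)
  rw [← mul_add]
  exact mul_le_mul_of_nonneg_left (norm_add_le _ _) (by positivity)

theorem sub (hμ : μ < 1) (hv : MemBC μ T v) (hw : MemBC μ T w) :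
    MemBC μ T (fun t => v t - w t) := by
  simpa only [sub_eq_add_neg] using hv.add hμ hw.neg

theorem clm_comp {F : Type*} [NormedAddCommGroup F] [NormedSpace ℝ F] (hμ : μ < 1)
    (hv : MemBC μ T v) (L : E →L[ℝ] F) : MemBC μ T (fun t => L (v t)) := by
  have hlim := hv.2.2.const_mul ‖L‖
  rw [mul_zero] at hlim
  refine memBC_of_eventually_le hμ (L.continuous.comp_continuousOn hv.1) ?_ hlim
  filter_upwards [self_mem_nhdsWithin] with t (ht : 0 < t)
  rw [mul_left_comm]
  exact mul_le_mul_of_nonneg_left (L.le_opNorm _) (by positivity)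

theorem shift (hμ : μ < 1) (hv : MemBC μ T v) (ha : 0 < a) (haT : a < T) :
    MemBC μ (T - a) (fun t => v (a + t)) :=
  memBC_of_continuousOn_Icc hμ (sub_pos.2 haT) <|
    hv.1.comp (by fun_prop) fun t ht => ⟨by linarith [ht.1], by linarith [ht.2]⟩

end Real

end MemBC

theorem MemBC.glue [NormedSpace ℝ E] (hμ : μ < 1) (hv : MemBC μ T v) (hw : MemBC μ τ w)
    (ha : 0 < a) (haT : a < T) (h : EqOn w (fun s => v (a + s)) (Ioc 0 (T - a))) :
    MemBC μ (a + τ) (glue a T v w) := by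
  refine memBC_of_eventually_le hμ (fun t ht => ?_) ?_ hv.2.2
  · rcases lt_or_ge t T with htT | htT
    · have hvt : ContinuousAt v t :=
        (hv.1 t ⟨ht.1, htT.le⟩).continuousAt (Ioc_mem_nhds ht.1 htT)
      refine (hvt.congr ?_).continuousWithinAt
      filter_upwards [Iio_mem_nhds htT] with s hs
      exact (glue_of_le _ _ (le_of_lt hs)).symm
    · have hat : a < t := haT.trans_le htT
      have hwt : ContinuousWithinAt (fun s => w (s - a)) (Ioc a (a + τ)) t :=
        ContinuousWithinAt.comp (g := w) (f := fun s => s - a) (t := Ioc 0 τ)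
          (hw.1 (t - a) ⟨by linarith, by linarith [ht.2]⟩) (by fun_prop)
          fun s hs => ⟨by linarith [hs.1], by linarith [hs.2]⟩
      exact (hwt.congr (fun s hs => glue_of_lt h hs.1) (glue_of_lt h hat)).mono_of_mem_nhdsWithin
        (Ioc_mem_nhdsWithin_Ioc hat)
  · filter_upwards [Ioc_mem_nhdsGT (ha.trans haT)] with t ht
    rw [glue_of_le _ _ ht.2]

end WeightedFunctions

section Primitive

variable {E : Type*} [NormedAddCommGroup E] {μ a b t T C : ℝ} {v w : ℝ → E}

theorem norm_le_of_weight {y : E} (ht : 0 < t) (h : t ^ (1 - μ) * ‖y‖ ≤ C) :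
    ‖y‖ ≤ C * t ^ (μ - 1) := by
  rw [← neg_sub, Real.rpow_neg ht.le, ← div_eq_mul_inv,
    le_div_iff₀ (Real.rpow_pos_of_pos ht _), mul_comm]
  exact h

theorem intervalIntegrable_const_mul_rpow (hμ : 0 < μ) (C T : ℝ) :
    IntervalIntegrable (fun t : ℝ => C * t ^ (μ - 1)) MeasureTheory.volume 0 T :=
  (intervalIntegral.intervalIntegrable_rpow' (by linarith)).const_mul C

theorem MemBC.intervalIntegrable (hμ : 0 < μ) (hv : MemBC μ T v) (ha : a ∈ Icc 0 T)
    (hb : b ∈ Icc 0 T) : IntervalIntegrable v MeasureTheory.volume a b := by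
  have hT : 0 ≤ T := ha.1.trans ha.2
  obtain ⟨C, hC⟩ := hv.2.1
  have hmajorant := intervalIntegrable_const_mul_rpow hμ C T
  suffices IntervalIntegrable v MeasureTheory.volume 0 T from
    this.mono_set (by rw [uIcc_of_le hT]; exact uIcc_subset_Icc ha hb)
  rw [intervalIntegrable_iff_integrableOn_Ioc_of_le hT] at hmajorant ⊢
  refine hmajorant.mono' (hv.1.aestronglyMeasurable measurableSet_Ioc) ?_
  rw [MeasureTheory.ae_restrict_iff' measurableSet_Ioc]
  exact Eventually.of_forall fun t ht => norm_le_of_weight ht.1 (hC t ht)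

variable [NormedSpace ℝ E]

theorem norm_integral_le_of_weight (hμ : 0 < μ) (ht : 0 ≤ t)
    (h : ∀ s ∈ Ioc 0 t, s ^ (1 - μ) * ‖v s‖ ≤ C) :
    ‖∫ s in (0 : ℝ)..t, v s‖ ≤ C / μ * t ^ μ := by
  calc ‖∫ s in (0 : ℝ)..t, v s‖ ≤ ∫ s in (0 : ℝ)..t, C * s ^ (μ - 1) :=
        intervalIntegral.norm_integral_le_of_norm_le ht
          (Eventually.of_forall fun s hs => norm_le_of_weight hs.1 (h s hs))
          (intervalIntegrable_const_mul_rpow hμ C t)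
    _ = C / μ * t ^ μ := by
        rw [intervalIntegral.integral_const_mul, integral_rpow (Or.inl (by linarith)),
          sub_add_cancel, Real.zero_rpow hμ.ne', sub_zero]
        ring

theorem integral_congr_Ioc (hab : a ≤ b) (h : EqOn v w (Ioc a b)) :
    ∫ s in a..b, v s = ∫ s in a..b, w s :=
  intervalIntegral.integral_congr_ae <| Eventually.of_forall fun s hs => by
    rw [uIoc_of_le hab] at hs
    exact h hs

theorem MemBC.hasDerivWithinAt_integral [CompleteSpace E] (hμ : 0 < μ) (hv : MemBC μ T v)
    (ht : t ∈ Ioc 0 T) :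
    HasDerivWithinAt (fun r => ∫ s in (0 : ℝ)..r, v s) (v t) (Ioc 0 T) t := by
  have htT : t ∈ Icc (t / 2) T := ⟨by linarith [ht.1], ht.2⟩
  have : Fact (t ∈ Icc (t / 2) T) := ⟨htT⟩
  have hcont : ContinuousOn v (Icc (t / 2) T) :=
    hv.1.mono fun s hs => ⟨by linarith [hs.1, ht.1], hs.2⟩
  have hderiv : HasDerivWithinAt (fun r => ∫ s in (0 : ℝ)..r, v s) (v t) (Icc (t / 2) T) t :=
    intervalIntegral.integral_hasDerivWithinAt_right
      (hv.intervalIntegrable hμ ⟨le_rfl, ht.1.le.trans ht.2⟩ ⟨ht.1.le, ht.2⟩)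
      (hcont.stronglyMeasurableAtFilter_nhdsWithin measurableSet_Icc t) (hcont t htT)
  exact hderiv.mono_of_mem_nhdsWithin
    (mem_of_superset (Ioc_mem_nhdsWithin_Ioc (half_lt_self ht.1)) Ioc_subset_Icc_self)

end Primitive

section IntegralEquation

variable {E₀ E₁ : Type*} [NormedAddCommGroup E₀] [NormedSpace ℝ E₀]
  [NormedAddCommGroup E₁] [NormedSpace ℝ E₁] {ι : E₁ →L[ℝ] E₀} {μ a t C T τ : ℝ}
  {x y : E₀} {u w : ℝ → E₁} {f g : ℝ → E₀}

variable (ι μ) in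
/-- The integrated form of `u' = f` on `(0,T]`, `u(0) = x`, for `u` and `f` in the weighted
spaces. For `u ∈ 𝔼_{1,μ}([0,T])` it says that `u` has the trace `x` and the derivative `f`. -/
structure IntEq (T : ℝ) (x : E₀) (u : ℝ → E₁) (f : ℝ → E₀) : Prop where
  memBC : MemBC μ T u
  memBC_deriv : MemBC μ T f
  eq : ∀ t ∈ Ioc 0 T, ι (u t) = x + ∫ s in (0 : ℝ)..t, f s

namespace IntEq

theorem mono (h : IntEq ι μ T x u f) (hτ : τ ≤ T) : IntEq ι μ τ x u f :=
  ⟨h.memBC.mono hτ, h.memBC_deriv.mono hτ, fun t ht => h.eq t ⟨ht.1, ht.2.trans hτ⟩⟩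

theorem congr (h : IntEq ι μ T x u f) (hT : 0 < T) (hw : EqOn w u (Ioc 0 T))
    (hg : EqOn g f (Ioc 0 T)) : IntEq ι μ T x w g := by
  refine ⟨h.memBC.congr hT hw, h.memBC_deriv.congr hT hg, fun t ht => ?_⟩
  rw [hw ht, h.eq t ht, integral_congr_Ioc ht.1.le (hg.mono (Ioc_subset_Ioc_right ht.2))]

theorem neg (h : IntEq ι μ T x u f) : IntEq ι μ T (-x) (fun t => -u t) (fun t => -f t) :=
  ⟨h.memBC.neg, h.memBC_deriv.neg, fun t ht => by
    rw [map_neg, h.eq t ht, intervalIntegral.integral_neg, neg_add]⟩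

theorem integral_add_integral (hμ : 0 < μ) (h : IntEq ι μ T x u f) (ha : 0 < a) (hat : a ≤ t)
    (htT : t ≤ T) :
    (∫ s in (0 : ℝ)..a, f s) + ∫ s in a..t, f s = ∫ s in (0 : ℝ)..t, f s :=
  have hat' : a ∈ Icc 0 T := ⟨ha.le, hat.trans htT⟩
  intervalIntegral.integral_add_adjacent_intervals
    (h.memBC_deriv.intervalIntegrable hμ ⟨le_rfl, hat'.1.trans hat'.2⟩ hat')
    (h.memBC_deriv.intervalIntegrable hμ hat' ⟨ha.le.trans hat, htT⟩)

theorem norm_map_sub_le (hμ : 0 < μ) (h : IntEq ι μ T x u f) (ht : t ∈ Ioc 0 T)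
    (hf : ∀ s ∈ Ioc 0 t, s ^ (1 - μ) * ‖f s‖ ≤ C) : ‖ι (u t) - x‖ ≤ C / μ * t ^ μ := by
  rw [h.eq t ht, add_sub_cancel_left]
  exact norm_integral_le_of_weight hμ ht.1.le hf

variable (hμ : μ ∈ Ioo (0 : ℝ) 1)
include hμ

theorem add (h : IntEq ι μ T x u f) (h' : IntEq ι μ T y w g) :
    IntEq ι μ T (x + y) (fun t => u t + w t) (fun t => f t + g t) := by
  refine ⟨h.memBC.add hμ.2 h'.memBC, h.memBC_deriv.add hμ.2 h'.memBC_deriv, fun t ht => ?_⟩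
  have h0 : (0 : ℝ) ∈ Icc 0 T := ⟨le_rfl, ht.1.le.trans ht.2⟩
  have ht' : t ∈ Icc 0 T := ⟨ht.1.le, ht.2⟩
  rw [map_add, h.eq t ht, h'.eq t ht, intervalIntegral.integral_add
    (h.memBC_deriv.intervalIntegrable hμ.1 h0 ht') (h'.memBC_deriv.intervalIntegrable hμ.1 h0 ht'),
    add_add_add_comm]

theorem sub (h : IntEq ι μ T x u f) (h' : IntEq ι μ T y w g) :
    IntEq ι μ T (x - y) (fun t => u t - w t) (fun t => f t - g t) := by
  simpa only [sub_eq_add_neg] using h.add hμ h'.neg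

theorem shift (h : IntEq ι μ T x u f) (ha : 0 < a) (haT : a < T) :
    IntEq ι μ (T - a) (ι (u a)) (fun t => u (a + t)) (fun t => f (a + t)) := by
  refine ⟨h.memBC.shift hμ.2 ha haT, h.memBC_deriv.shift hμ.2 ha haT, fun t ht => ?_⟩
  have hle : a + t ≤ T := by linarith [ht.2]
  rw [h.eq a ⟨ha, haT.le⟩, h.eq _ ⟨add_pos ha ht.1, hle⟩,
    intervalIntegral.integral_comp_add_left, add_zero, add_assoc,
    h.integral_add_integral hμ.1 ha (by linarith [ht.1]) hle]

theorem glue (h : IntEq ι μ T x u f) (h' : IntEq ι μ τ (ι (u a)) w g) (ha : 0 < a) (haT : a < T)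
    (hw : EqOn w (fun s => u (a + s)) (Ioc 0 (T - a)))
    (hg : EqOn g (fun s => f (a + s)) (Ioc 0 (T - a))) :
    IntEq ι μ (a + τ) x (glue a T u w) (glue a T f g) := by
  have hmem := h.memBC_deriv.glue hμ.2 h'.memBC_deriv ha haT hg
  have hbefore : ∀ r ∈ Ioc 0 T, ∫ s in (0 : ℝ)..r, QuasiPar.glue a T f g s =
      ∫ s in (0 : ℝ)..r, f s := fun r hr =>
    integral_congr_Ioc hr.1.le fun s hs => glue_of_le _ _ (hs.2.trans hr.2)
  have hafter : ∀ t, a < t → ∫ s in a..t, QuasiPar.glue a T f g s = ∫ s in 0..(t - a), g s :=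
    fun t hat => by
      rw [integral_congr_Ioc hat.le fun s hs => glue_of_lt hg hs.1,
        intervalIntegral.integral_comp_sub_right, sub_self]
  refine ⟨h.memBC.glue hμ.2 h'.memBC ha haT hw, hmem, fun t ht => ?_⟩
  rcases le_or_gt t T with htT | htT
  · rw [glue_of_le _ _ htT, h.eq t ⟨ht.1, htT⟩, hbefore t ⟨ht.1, htT⟩]
  · have hat : a < t := haT.trans htT
    have h0 : (0 : ℝ) ∈ Icc 0 (a + τ) := ⟨le_rfl, ht.1.le.trans ht.2⟩
    have ha' : a ∈ Icc 0 (a + τ) := ⟨ha.le, hat.le.trans ht.2⟩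
    rw [glue_of_lt hw hat, h'.eq (t - a) ⟨sub_pos.2 hat, by linarith [ht.2]⟩, h.eq a ⟨ha, haT.le⟩,
      ← hbefore a ⟨ha, haT.le⟩, ← hafter t hat, add_assoc,
      intervalIntegral.integral_add_adjacent_intervals (hmem.intervalIntegrable hμ.1 h0 ha')
        (hmem.intervalIntegrable hμ.1 ha' ⟨ht.1.le, ht.2⟩)]

theorem kFun_map_sub_le (h : IntEq ι μ T x u f) (ht : t ∈ Ioc 0 T) {s : ℝ} (hs : s ∈ Ioc 0 t)
    (hu : ∀ r ∈ Ioc 0 t, r ^ (1 - μ) * ‖u r‖ ≤ C)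
    (hf : ∀ r ∈ Ioc 0 t, r ^ (1 - μ) * ‖f r‖ ≤ C) :
    kFun ι s (ι (u t) - x) ≤ s ^ μ * ((2 + 1 / μ) * C) := by
  have hst : Ioc 0 s ⊆ Ioc 0 t := Ioc_subset_Ioc_right hs.2
  have hC : 0 ≤ C := le_trans (mul_nonneg (Real.rpow_nonneg ht.1.le _) (norm_nonneg _))
    (hu t ⟨ht.1, le_rfl⟩)
  have hut : ‖u t‖ ≤ C * s ^ (μ - 1) := (norm_le_of_weight ht.1 (hu t ⟨ht.1, le_rfl⟩)).trans
    (mul_le_mul_of_nonneg_left (Real.rpow_le_rpow_of_nonpos hs.1 hs.2 (by linarith [hμ.2])) hC)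
  have hus : ‖u s‖ ≤ C * s ^ (μ - 1) := norm_le_of_weight hs.1 (hu s hs)
  calc kFun ι s (ι (u t) - x) = kFun ι s (ι (u t - u s) + (ι (u s) - x)) := by
        rw [map_sub, sub_add_sub_cancel]
    _ ≤ s * ‖u t - u s‖ + ‖ι (u s) - x‖ := (kFun_add ι hs.1 _ _).trans
        (add_le_add (kFun_map_le ι hs.1 _) (kFun_le_norm ι hs.1 _))
    _ ≤ s * (C * s ^ (μ - 1) + C * s ^ (μ - 1)) + C / μ * s ^ μ :=
        add_le_add
          (mul_le_mul_of_nonneg_left ((norm_sub_le _ _).trans (add_le_add hut hus)) hs.1.le)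
          (h.norm_map_sub_le hμ.1 ⟨hs.1, hs.2.trans ht.2⟩ fun r hr => hf r (hst hr))
    _ = 2 * C * (s ^ (μ - 1) * s) + C / μ * s ^ μ := by ring
    _ = s ^ μ * ((2 + 1 / μ) * C) := by
        rw [← Real.rpow_add_one hs.1.ne', sub_add_cancel]
        ring

/-- This is the estimate behind the trace theorem `𝔼_{1,μ}([0,T]) ↪ C([0,T], E_μ)`. -/
theorem norm_of_sub_le {X : Interp ι μ} (h : IntEq ι μ T X.val u f) (ht : t ∈ Ioc 0 T)
    (hu : ∀ s ∈ Ioc 0 t, s ^ (1 - μ) * ‖u s‖ ≤ C)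
    (hf : ∀ s ∈ Ioc 0 t, s ^ (1 - μ) * ‖f s‖ ≤ C) :
    ‖Interp.of ι hμ (u t) - X‖ ≤ (2 + 1 / μ) * C := by
  have hC : 0 ≤ C := le_trans (mul_nonneg (Real.rpow_nonneg ht.1.le _) (norm_nonneg _))
    (hu t ⟨ht.1, le_rfl⟩)
  refine Interp.norm_le_of_kFun_le fun s hs => ?_
  rcases le_or_gt s t with hst | hts
  · exact h.kFun_map_sub_le hμ ht ⟨hs, hst⟩ hu hf
  calc kFun ι s (ι (u t) - X.val) ≤ ‖ι (u t) - X.val‖ := kFun_le_norm ι hs _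
    _ ≤ C / μ * t ^ μ := h.norm_map_sub_le hμ.1 ht hf
    _ ≤ C / μ * s ^ μ := mul_le_mul_of_nonneg_left (Real.rpow_le_rpow ht.1.le hts.le hμ.1.le)
        (div_nonneg hC hμ.1.le)
    _ = s ^ μ * (1 / μ * C) := by ring
    _ ≤ s ^ μ * ((2 + 1 / μ) * C) := by gcongr; linarith

theorem tendsto_of (hT : 0 < T) {X : Interp ι μ} (h : IntEq ι μ T X.val u f) :
    Tendsto (fun t => Interp.of ι hμ (u t)) (𝓝[>] 0) (𝓝 X) := by
  have hc : 0 < 2 + 1 / μ := by have := hμ.1; positivity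
  refine Metric.nhds_basis_closedBall.tendsto_right_iff.2 fun ε hε => ?_
  have hδ : 0 < ε / (2 + 1 / μ) := div_pos hε hc
  obtain ⟨d, hd, hsmall⟩ := exists_forall_mem_Ioc_of_eventually
    ((h.memBC.2.2.eventually_le_const hδ).and (h.memBC_deriv.2.2.eventually_le_const hδ))
  filter_upwards [Ioc_mem_nhdsGT hT, Ioc_mem_nhdsGT hd] with t htT htd
  have hsub : Ioc 0 t ⊆ Ioc 0 d := Ioc_subset_Ioc_right htd.2
  rw [mem_closedBall_iff_norm]
  calc ‖Interp.of ι hμ (u t) - X‖ ≤ (2 + 1 / μ) * (ε / (2 + 1 / μ)) :=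
        h.norm_of_sub_le hμ htT (fun s hs => (hsmall s (hsub hs)).1)
          fun s hs => (hsmall s (hsub hs)).2
    _ = ε := mul_div_cancel₀ _ hc.ne'

theorem hasTrace (hT : 0 < T) (h : IntEq ι μ T x u f) : HasTrace ι u x := by
  obtain ⟨C, hC⟩ := h.memBC_deriv.2.1
  have hlim := (tendsto_rpow_nhdsGT_zero hμ.1).const_mul (C / μ)
  rw [mul_zero] at hlim
  refine tendsto_iff_norm_sub_tendsto_zero.2
    (squeeze_zero' (Eventually.of_forall fun _ => norm_nonneg _) ?_ hlim)
  filter_upwards [Ioc_mem_nhdsGT hT] with t ht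
  exact h.norm_map_sub_le hμ.1 ht fun s hs => hC s ⟨hs.1, hs.2.trans ht.2⟩

theorem of_memE1 [CompleteSpace E₀] (hT : 0 < T) (hu : MemE1 ι μ T u) (hx : HasTrace ι u x)
    (hf : ∀ t ∈ Ioc 0 T, dt ι T u t = f t) : IntEq ι μ T x u f := by
  have hmem : MemBC μ T f := hu.1.2.2.congr hT fun t ht => (hf t ht).symm
  refine ⟨hu.2, hmem, fun t ht => ?_⟩
  have hcont : ContinuousWithinAt (fun s => ι (u s)) (Iio t) t :=
    (hu.1.1.continuousOn t ht).mono_of_mem_nhdsWithin <| by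
      filter_upwards [self_mem_nhdsWithin, mem_nhdsWithin_of_mem_nhds (Ioi_mem_nhds ht.1)]
        with s hs hs' using ⟨hs', (le_of_lt hs).trans ht.2⟩
  have hderiv : ∀ s ∈ Ioo 0 t, HasDerivAt (fun s => ι (u s)) (f s) s := fun s hs => by
    have hs' : s ∈ Ioc 0 T := ⟨hs.1, hs.2.le.trans ht.2⟩
    rw [← hf s hs']
    exact (hu.1.1 s hs').hasDerivWithinAt.hasDerivAt (Ioc_mem_nhds hs.1 (hs.2.trans_le ht.2))
  rw [intervalIntegral.integral_eq_sub_of_hasDerivAt_of_tendsto ht.1 hderiv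
    (hmem.intervalIntegrable hμ.1 ⟨le_rfl, hT.le⟩ ⟨ht.1.le, ht.2⟩) hx hcont, add_sub_cancel]

theorem dt_eq [CompleteSpace E₀] (h : IntEq ι μ T x u f) (ht : t ∈ Ioc 0 T) :
    dt ι T u t = f t :=
  HasDerivWithinAt.derivWithin
    (((h.memBC_deriv.hasDerivWithinAt_integral hμ.1 ht).const_add x).congr h.eq (h.eq t ht))
    (uniqueDiffOn_Ioc 0 T t ht)

theorem memE1 [CompleteSpace E₀] (hT : 0 < T) (h : IntEq ι μ T x u f) : MemE1 ι μ T u :=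
  ⟨⟨fun t ht => (((h.memBC_deriv.hasDerivWithinAt_integral hμ.1 ht).const_add x).congr h.eq
      (h.eq t ht)).differentiableWithinAt,
    h.memBC.clm_comp hμ.2 ι, h.memBC_deriv.congr hT fun _ ht => h.dt_eq hμ ht⟩, h.memBC⟩

end IntEq

end IntegralEquation

section WeightedSpace

open scoped BoundedContinuousFunction

variable {E : Type*} [NormedAddCommGroup E] [NormedSpace ℝ E] {μ T τ t C : ℝ}

/-- The bounded continuous functions on `ℝ` that vanish on `(-∞, 0]` and are constant on
`[T, ∞)`. Multiplication by `t ^ (1-μ)` identifies `BC_{1-μ}([0,T], E)` with this Banach space. -/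
def weightedSpace (T : ℝ) (E : Type*) [NormedAddCommGroup E] [NormedSpace ℝ E] :
    Submodule ℝ (ℝ →ᵇ E) where
  carrier := {g | (∀ t ≤ 0, g t = 0) ∧ ∀ t ≥ T, g t = g T}
  zero_mem' := ⟨fun _ _ => rfl, fun _ _ => rfl⟩
  add_mem' := fun {f g} hf hg =>
    ⟨fun t ht => by simp [hf.1 t ht, hg.1 t ht], fun t ht => by simp [hf.2 t ht, hg.2 t ht]⟩
  smul_mem' := fun c g hg =>
    ⟨fun t ht => by simp [hg.1 t ht], fun t ht => by simp [hg.2 t ht]⟩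

theorem isClosed_weightedSpace : IsClosed (weightedSpace T E : Set (ℝ →ᵇ E)) := by
  have heval : ∀ t, Continuous fun g : ℝ →ᵇ E => g t := fun t =>
    (BoundedContinuousFunction.evalCLM ℝ t).continuous
  have hinter : (weightedSpace T E : Set (ℝ →ᵇ E)) =
      (⋂ t : Iic (0 : ℝ), {g | g t = 0}) ∩ ⋂ t : Ici T, {g | g t = g T} := by
    ext g
    simp [weightedSpace]
  rw [hinter]
  exact (isClosed_iInter fun t : Iic (0 : ℝ) => isClosed_eq (heval t) continuous_const).inter
    (isClosed_iInter fun t : Ici T => isClosed_eq (heval t) (heval T))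

instance [CompleteSpace E] : CompleteSpace (weightedSpace T E) :=
  isClosed_weightedSpace.completeSpace_coe

theorem norm_apply_le_of_weightedSpace (g : weightedSpace T E) (t : ℝ) : ‖g.1 t‖ ≤ ‖g‖ :=
  g.1.norm_coe_le_norm t

/-- The function `t ↦ t ^ (μ-1) g(t)` represented by an element `g` of the weighted space. -/
def unweight (μ : ℝ) (g : weightedSpace T E) (t : ℝ) : E := t ^ (μ - 1) • g.1 t

theorem unweight_add (g h : weightedSpace T E) (t : ℝ) :
    unweight μ (g + h) t = unweight μ g t + unweight μ h t :=
  smul_add _ _ _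

theorem unweight_smul (c : ℝ) (g : weightedSpace T E) (t : ℝ) :
    unweight μ (c • g) t = c • unweight μ g t :=
  smul_comm _ _ _

theorem unweight_sub (g h : weightedSpace T E) (t : ℝ) :
    unweight μ (g - h) t = unweight μ g t - unweight μ h t :=
  smul_sub _ _ _

theorem weight_mul_norm_unweight (g : weightedSpace T E) (ht : 0 < t) :
    t ^ (1 - μ) * ‖unweight μ g t‖ = ‖g.1 t‖ := by
  rw [unweight, norm_smul, Real.norm_of_nonneg (Real.rpow_nonneg ht.le _), ← mul_assoc,
    ← Real.rpow_add ht, sub_add_sub_cancel, sub_self, Real.rpow_zero, one_mul]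

theorem weight_mul_norm_unweight_le (g : weightedSpace T E) (ht : 0 < t) :
    t ^ (1 - μ) * ‖unweight μ g t‖ ≤ ‖g‖ :=
  (weight_mul_norm_unweight g ht).trans_le (norm_apply_le_of_weightedSpace g t)

theorem memBC_unweight (hμ : μ < 1) (g : weightedSpace T E) (τ : ℝ) :
    MemBC μ τ (unweight μ g) := by
  have hlim : Tendsto (fun t => ‖g.1 t‖) (𝓝[>] 0) (𝓝 0) := by
    simpa [g.2.1 0 le_rfl] using (g.1.continuous.norm.tendsto 0).mono_left nhdsWithin_le_nhds
  refine memBC_of_eventually_le hμ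
    ((continuousOn_rpow_Ioc _ _).smul g.1.continuous.continuousOn) ?_ hlim
  filter_upwards [self_mem_nhdsWithin] with t ht using (weight_mul_norm_unweight g ht).le

theorem unweight_injOn (hT : 0 < T) {g h : weightedSpace T E}
    (hgh : EqOn (unweight μ g) (unweight μ h) (Ioc 0 T)) : g = h := by
  have hIoc : ∀ t ∈ Ioc 0 T, g.1 t = h.1 t := fun t ht =>
    smul_right_injective E (Real.rpow_pos_of_pos ht.1 (μ - 1)).ne' (hgh ht)
  refine Subtype.ext (BoundedContinuousFunction.ext fun t => ?_)
  rcases le_or_gt t 0 with ht | ht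
  · rw [g.2.1 t ht, h.2.1 t ht]
  rcases le_or_gt t T with htT | htT
  · exact hIoc t ⟨ht, htT⟩
  · rw [g.2.2 t htT.le, h.2.2 t htT.le, hIoc T ⟨hT, le_rfl⟩]

section ToWeighted

variable {v w : ℝ → E} (hμ : μ < 1) (hτ : 0 ≤ τ) (hτT : τ ≤ T)

/-- The element of the weighted space that represents a function on `(0,τ]`, `τ ≤ T`; its
weighted values are extended by the value at `τ` after the time `τ`. -/
def toWeighted (hv : MemBC μ τ v) : weightedSpace T E :=
  ⟨(BoundedContinuousFunction.mkOfCompact ⟨(Icc 0 τ).domRestrict fun t => t ^ (1 - μ) • v t,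
      (continuousOn_rpow_smul_Icc hμ hv.1 hv.2.2).domRestrict⟩).compContinuous
      ⟨projIcc 0 τ hτ, continuous_projIcc⟩,
    fun t ht => by
      change (projIcc 0 τ hτ t : ℝ) ^ (1 - μ) • v (projIcc 0 τ hτ t) = 0
      rw [projIcc_of_le_left hτ ht, Real.zero_rpow (sub_pos.2 hμ).ne', zero_smul],
    fun t ht => by
      simp [projIcc_of_right_le hτ (hτT.trans ht), projIcc_of_right_le hτ hτT]⟩

theorem toWeighted_apply (hv : MemBC μ τ v) (t : ℝ) :
    (toWeighted hμ hτ hτT hv).1 t =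
      (projIcc 0 τ hτ t : ℝ) ^ (1 - μ) • v (projIcc 0 τ hτ t) := rfl

theorem unweight_toWeighted (hv : MemBC μ τ v) :
    EqOn (unweight μ (toWeighted hμ hτ hτT hv)) v (Ioc 0 τ) := fun t ht => by
  rw [unweight, toWeighted_apply, projIcc_of_mem hτ ⟨ht.1.le, ht.2⟩, smul_smul,
    ← Real.rpow_add ht.1, sub_add_sub_cancel, sub_self, Real.rpow_zero, one_smul]

theorem toWeighted_sub (hv : MemBC μ τ v) (hw : MemBC μ τ w) :
    toWeighted hμ hτ hτT hv - toWeighted hμ hτ hτT hw =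
      toWeighted hμ hτ hτT (hv.sub hμ hw) := by
  refine Subtype.ext (BoundedContinuousFunction.ext fun t => ?_)
  rw [toWeighted_apply, smul_sub]
  rfl

theorem norm_toWeighted_le (hv : MemBC μ τ v) (hC : 0 ≤ C)
    (h : ∀ t ∈ Ioc 0 τ, t ^ (1 - μ) * ‖v t‖ ≤ C) : ‖toWeighted hμ hτ hτT hv‖ ≤ C := by
  refine (BoundedContinuousFunction.norm_le hC).2 fun t => ?_
  change ‖(toWeighted hμ hτ hτT hv).1 t‖ ≤ C
  obtain ⟨hs₀, hsτ⟩ := (projIcc 0 τ hτ t).2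
  rw [toWeighted_apply, norm_smul, Real.norm_of_nonneg (Real.rpow_nonneg hs₀ _)]
  rcases hs₀.eq_or_lt with hs | hs
  · rwa [← hs, Real.zero_rpow (sub_pos.2 hμ).ne', zero_mul]
  · exact h _ ⟨hs, hsτ⟩

end ToWeighted

/-- The primitive at time `t` of the function represented by `g`, as a bounded operator. -/
def primitiveCLM (hμ : μ ∈ Ioo (0 : ℝ) 1) (T : ℝ) (ht : 0 ≤ t) : weightedSpace T E →L[ℝ] E :=
  LinearMap.mkContinuous
    { toFun := fun g => ∫ s in (0 : ℝ)..t, unweight μ g s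
      map_add' := fun g h => by
        have hint : ∀ g : weightedSpace T E,
            IntervalIntegrable (unweight μ g) MeasureTheory.volume 0 t := fun g =>
          (memBC_unweight hμ.2 g t).intervalIntegrable hμ.1 ⟨le_rfl, ht⟩ ⟨ht, le_rfl⟩
        simp only [unweight_add]
        exact intervalIntegral.integral_add (hint g) (hint h)
      map_smul' := fun c g => by
        simp only [unweight_smul, RingHom.id_apply]
        exact intervalIntegral.integral_smul _ _ }
    (1 / μ * t ^ μ) fun g =>
      (norm_integral_le_of_weight hμ.1 ht fun _ hs =>
        weight_mul_norm_unweight_le g hs.1).trans_eq (by ring)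

end WeightedSpace

theorem exists_clm_of_isClosed_of_existsUnique {X Y : Type*} [NormedAddCommGroup X]
    [NormedSpace ℝ X] [CompleteSpace X] [NormedAddCommGroup Y] [NormedSpace ℝ Y] [CompleteSpace Y]
    {Z : Submodule ℝ (X × Y)} (hZ : IsClosed (Z : Set (X × Y)))
    (h : ∀ x, ∃! y, (x, y) ∈ Z) : ∃ S : X →L[ℝ] Y, ∀ x, (x, S x) ∈ Z := by
  have hbij : Function.Bijective (Prod.fst ∘ Z.subtype) := by
    refine ⟨?_, fun x => ⟨⟨_, (h x).exists.choose_spec⟩, rfl⟩⟩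
    rintro ⟨⟨x, y⟩, hy⟩ ⟨⟨x', y'⟩, hy'⟩ (rfl : x = x')
    rw [Subtype.mk.injEq, (h x).unique hy hy']
  obtain ⟨S, rfl⟩ := Submodule.exists_eq_graph hbij
  exact ⟨ContinuousLinearMap.ofIsClosedGraph hZ, fun x => rfl⟩

section LinearUniqueness

variable {E₀ E₁ : Type*} [NormedAddCommGroup E₀] [NormedSpace ℝ E₀]
  [NormedAddCommGroup E₁] [NormedSpace ℝ E₁]
  {ι B : E₁ →L[ℝ] E₀} {μ s t T τ : ℝ} {v V : ℝ → E₁}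

theorem integral_delay {h : ℝ → E₀} (hh : ContinuousOn h (Icc 0 τ)) (h₀ : h 0 = 0) (hs : 0 ≤ s)
    (ht : t ∈ Icc 0 (τ + s)) :
    ∫ r in (0 : ℝ)..t, h (max (r - s) 0) = ∫ r in (0 : ℝ)..max (t - s) 0, h r := by
  have hzero : ∀ b, 0 ≤ b → b ≤ s → ∫ r in (0 : ℝ)..b, h (max (r - s) 0) = 0 := fun b hb hbs => by
    rw [integral_congr_Ioc (w := fun _ => 0) hb fun r hr => ?_, intervalIntegral.integral_zero]
    simp only [max_eq_right (sub_nonpos.2 (hr.2.trans hbs)), h₀]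
  rcases le_or_gt t s with hts | hst
  · rw [max_eq_right (sub_nonpos.2 hts), intervalIntegral.integral_same, hzero t ht.1 hts]
  have hcont : ContinuousOn (fun r => h (max (r - s) 0)) (Icc 0 (τ + s)) :=
    hh.comp (by fun_prop) fun r hr =>
      ⟨le_max_right _ _, max_le (by linarith [hr.2]) (by linarith [hst, ht.2])⟩
  have hint : ∀ a b, a ∈ Icc 0 (τ + s) → b ∈ Icc 0 (τ + s) →
      IntervalIntegrable (fun r => h (max (r - s) 0)) MeasureTheory.volume a b :=
    fun a b ha hb => (hcont.mono (uIcc_subset_Icc ha hb)).intervalIntegrable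
  have hsmem : s ∈ Icc 0 (τ + s) := ⟨hs, hst.le.trans ht.2⟩
  rw [← intervalIntegral.integral_add_adjacent_intervals
      (hint 0 s ⟨le_rfl, ht.1.trans ht.2⟩ hsmem) (hint s t hsmem ht), hzero s hs le_rfl, zero_add,
    integral_congr_Ioc (w := fun r => h (r - s)) hst.le fun r hr => ?_,
    intervalIntegral.integral_comp_sub_right, sub_self, max_eq_left (sub_nonneg.2 hst.le)]
  simp only [max_eq_left (sub_nonneg.2 hr.1.le)]

theorem IntEq.delay (hμ : μ < 1) (hτ : 0 < τ) (hV : ContinuousOn V (Icc 0 τ)) (hV₀ : V 0 = 0)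
    (h : ∀ t ∈ Icc 0 τ, ι (V t) = ∫ r in (0 : ℝ)..t, -B (V r)) (hs : 0 ≤ s) :
    IntEq ι μ (τ + s) 0 (fun t => V (max (t - s) 0)) (fun t => -B (V (max (t - s) 0))) := by
  have hmaps : MapsTo (fun t => max (t - s) 0) (Icc 0 (τ + s)) (Icc 0 τ) := fun t ht =>
    ⟨le_max_right _ _, max_le (by linarith [ht.2]) hτ.le⟩
  have hBV : ContinuousOn (fun t => -B (V t)) (Icc 0 τ) := (B.continuous.comp_continuousOn hV).neg
  refine ⟨memBC_of_continuousOn_Icc hμ (by linarith) (hV.comp (by fun_prop) hmaps),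
    memBC_of_continuousOn_Icc hμ (by linarith) (hBV.comp (by fun_prop) hmaps), fun t ht => ?_⟩
  have ht' : t ∈ Icc 0 (τ + s) := ⟨ht.1.le, ht.2⟩
  rw [zero_add, integral_delay hBV (by simp [hV₀]) hs ht', h _ (hmaps ht')]

theorem MemBC.continuousOn_integral (hμ : 0 < μ) (hτ : 0 ≤ τ) (hv : MemBC μ τ v) :
    ContinuousOn (fun t => ∫ r in (0 : ℝ)..t, v r) (Icc 0 τ) := by
  simpa only [uIcc_of_le hτ] using intervalIntegral.continuousOn_primitive_interval'
    (hv.intervalIntegrable hμ ⟨le_rfl, hτ⟩ ⟨hτ, le_rfl⟩) left_mem_uIcc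

theorem MemBC.eq_zero_of_integral_eq_zero [CompleteSpace E₁] (hμ : 0 < μ) (hv : MemBC μ τ v)
    (h : ∀ t ∈ Ioc 0 τ, ∫ r in (0 : ℝ)..t, v r = 0) : ∀ t ∈ Ioc 0 τ, v t = 0 := fun t ht =>
  (uniqueDiffOn_Ioc 0 τ t ht).eq_deriv _ (hv.hasDerivWithinAt_integral hμ ht)
    ((hasDerivWithinAt_const t _ (0 : E₁)).congr h (h t ht))

variable [CompleteSpace E₀] [CompleteSpace E₁] (hμ : μ ∈ Ioo (0 : ℝ) 1)
include hμ

theorem IntEq.map_integral_of_homogeneous (hv : IntEq ι μ τ 0 v (fun t => -B (v t)))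
    (ht : t ∈ Icc 0 τ) :
    ι (∫ r in (0 : ℝ)..t, v r) = ∫ r in (0 : ℝ)..t, -B (∫ q in (0 : ℝ)..r, v q) := by
  have hint : ∀ r ∈ Icc 0 τ, IntervalIntegrable v MeasureTheory.volume 0 r := fun r hr =>
    hv.memBC.intervalIntegrable hμ.1 ⟨le_rfl, hr.1.trans hr.2⟩ hr
  rw [← ContinuousLinearMap.intervalIntegral_comp_comm ι (hint t ht)]
  refine integral_congr_Ioc ht.1 fun r hr => ?_
  have hr' : r ∈ Ioc 0 τ := ⟨hr.1, hr.2.trans ht.2⟩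
  simp only [hv.eq r hr', zero_add, intervalIntegral.integral_neg,
    ContinuousLinearMap.intervalIntegral_comp_comm B (hint r ⟨hr'.1.le, hr'.2⟩)]

/- The primitive of a solution on the shorter interval, delayed by `T - τ`, solves the homogeneous
problem on `[0,T]`: being continuous with value `0` at its start, it extends by `0` to the left. -/
theorem IntEq.eq_zero_of_le
    (hT : ∀ w : ℝ → E₁, IntEq ι μ T 0 w (fun t => -B (w t)) → ∀ t ∈ Ioc 0 T, w t = 0)
    (hτ : 0 < τ) (hτT : τ ≤ T) (hv : IntEq ι μ τ 0 v (fun t => -B (v t))) :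
    ∀ t ∈ Ioc 0 τ, v t = 0 := by
  have hdelay := IntEq.delay hμ.2 hτ (hv.memBC.continuousOn_integral hμ.1 hτ.le)
    intervalIntegral.integral_same (fun t ht => hv.map_integral_of_homogeneous hμ ht)
    (sub_nonneg.2 hτT)
  rw [add_sub_cancel] at hdelay
  refine hv.memBC.eq_zero_of_integral_eq_zero hμ.1 fun t ht => ?_
  have hzero := hT _ hdelay (t + (T - τ)) ⟨by linarith [ht.1], by linarith [ht.2]⟩
  rwa [add_sub_cancel_right, max_eq_left ht.1.le] at hzero

end LinearUniqueness

section LinearExistence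

variable {E₀ E₁ : Type*} [NormedAddCommGroup E₀] [NormedSpace ℝ E₀]
  [NormedAddCommGroup E₁] [NormedSpace ℝ E₁] {ι B : E₁ →L[ℝ] E₀} {μ t T : ℝ}

theorem mem_maxReg_iff [CompleteSpace E₀] (hμ : μ ∈ Ioo (0 : ℝ) 1) :
    B ∈ maxReg ι μ ↔ ∃ T : ℝ, 0 < T ∧ ∀ f : ℝ → E₀, MemBC μ T f → ∀ x : Interp ι μ,
      ∃ u, IntEq ι μ T x.val u (fun t => f t - B (u t)) ∧
        ∀ v, IntEq ι μ T x.val v (fun t => f t - B (v t)) → EqOn v u (Ioc 0 T) := by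
  have solves_iff : ∀ T : ℝ, 0 < T → ∀ (f : ℝ → E₀) (x : Interp ι μ) (u : ℝ → E₁),
      (MemE1 ι μ T u ∧ (∀ t ∈ Ioc 0 T, dt ι T u t + B (u t) = f t) ∧ HasTrace ι u x.val) ↔
      IntEq ι μ T x.val u (fun t => f t - B (u t)) := fun T hT f x u =>
    ⟨fun h => IntEq.of_memE1 hμ hT h.1 h.2.2 fun t ht => eq_sub_of_add_eq (h.2.1 t ht),
      fun h => ⟨h.memE1 hμ hT, fun t ht => by rw [h.dt_eq hμ ht, sub_add_cancel],
        h.hasTrace hμ hT⟩⟩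
  refine exists_congr fun T => and_congr_right fun hT => forall_congr' fun f =>
    forall_congr' fun _ => forall_congr' fun x => ?_
  simp only [solves_iff T hT f x]

variable (hμ : μ ∈ Ioo (0 : ℝ) 1)

/-- The defect at time `t` of the integrated form of `u' + B u = f`, `u(0) = x`, as a function of
the data and the solution `((f, x), u)`, with `f` and `u` represented in the weighted spaces. -/
def linearDefect (ι B : E₁ →L[ℝ] E₀) (T : ℝ) (ht : 0 ≤ t) :
    (weightedSpace T E₀ × Interp ι μ) × weightedSpace T E₁ →L[ℝ] E₀ :=
  (ι ∘L (t ^ (μ - 1) • BoundedContinuousFunction.evalCLM ℝ t) ∘L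
      Submodule.subtypeL (weightedSpace T E₁)) ∘L .snd ℝ _ _ -
    (Interp.valL ι μ ∘L .snd ℝ _ _ + primitiveCLM hμ T ht ∘L .fst ℝ _ _) ∘L .fst ℝ _ _ +
    (B ∘L primitiveCLM hμ T ht) ∘L .snd ℝ _ _

/-- The linear relation between data and solutions of `u' + B u = f`, `u(0) = x` on `[0,T]`. -/
def linearGraph (ι B : E₁ →L[ℝ] E₀) (T : ℝ) :
    Submodule ℝ ((weightedSpace T E₀ × Interp ι μ) × weightedSpace T E₁) :=
  ⨅ t : Ioc 0 T, LinearMap.ker (linearDefect hμ ι B T t.2.1.le).toLinearMap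

theorem isClosed_linearGraph : IsClosed (linearGraph hμ ι B T :
    Set ((weightedSpace T E₀ × Interp ι μ) × weightedSpace T E₁)) := by
  simp only [linearGraph, Submodule.coe_iInf]
  exact isClosed_iInter fun t => (linearDefect hμ ι B T t.2.1.le).isClosed_ker

theorem linearDefect_apply [CompleteSpace E₀] [CompleteSpace E₁] (ht : 0 ≤ t)
    (z : (weightedSpace T E₀ × Interp ι μ) × weightedSpace T E₁) :
    linearDefect hμ ι B T ht z = ι (unweight μ z.2 t) -
      (z.1.2.val + ∫ s in (0 : ℝ)..t, (unweight μ z.1.1 s - B (unweight μ z.2 s))) := by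
  have hu := memBC_unweight hμ.2 z.2 t
  have h0 : (0 : ℝ) ∈ Icc 0 t := ⟨le_rfl, ht⟩
  have ht' : t ∈ Icc 0 t := ⟨ht, le_rfl⟩
  rw [intervalIntegral.integral_sub
      ((memBC_unweight hμ.2 z.1.1 t).intervalIntegrable hμ.1 h0 ht')
      ((hu.clm_comp hμ.2 B).intervalIntegrable hμ.1 h0 ht'),
    ContinuousLinearMap.intervalIntegral_comp_comm B (hu.intervalIntegrable hμ.1 h0 ht'),
    ← add_sub_assoc, ← sub_add]
  rfl

theorem mem_linearGraph_iff [CompleteSpace E₀] [CompleteSpace E₁] {g : weightedSpace T E₀}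
    {x : Interp ι μ} {u : weightedSpace T E₁} :
    ((g, x), u) ∈ linearGraph hμ ι B T ↔
      IntEq ι μ T x.val (unweight μ u) (fun t => unweight μ g t - B (unweight μ u t)) := by
  have hu := memBC_unweight hμ.2 u T
  have hf := (memBC_unweight hμ.2 g T).sub hμ.2 (hu.clm_comp hμ.2 B)
  simp only [linearGraph, Submodule.mem_iInf, LinearMap.mem_ker, ContinuousLinearMap.coe_coe,
    linearDefect_apply, sub_eq_zero]
  exact ⟨fun h => ⟨hu, hf, fun t ht => h ⟨t, ht⟩⟩, fun h t => h.eq t t.2⟩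

/-- A bounded solution operator `(f, x) ↦ u` of the linear problem `u' + B u = f`, `u(0) = x` on
`[0,T]`, in terms of the representatives in the weighted spaces, together with the uniqueness of
solutions on the intervals `[0,τ]`, `τ ≤ T`. -/
structure SolutionOperator (ι B : E₁ →L[ℝ] E₀) (μ : ℝ) where
  T : ℝ
  pos : 0 < T
  S : weightedSpace T E₀ × Interp ι μ →L[ℝ] weightedSpace T E₁
  intEq : ∀ g x, IntEq ι μ T x.val (unweight μ (S (g, x)))
    (fun t => unweight μ g t - B (unweight μ (S (g, x)) t))
  unique : ∀ τ, 0 < τ → τ ≤ T → ∀ v : ℝ → E₁, IntEq ι μ τ 0 v (fun t => -B (v t)) →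
    ∀ t ∈ Ioc 0 τ, v t = 0

theorem eqOn_zero_of_existsUnique (hμ : μ < 1) (hT : 0 < T)
    (hsol : ∀ f : ℝ → E₀, MemBC μ T f → ∀ x : Interp ι μ,
      ∃ u, IntEq ι μ T x.val u (fun t => f t - B (u t)) ∧
        ∀ v, IntEq ι μ T x.val v (fun t => f t - B (v t)) → EqOn v u (Ioc 0 T))
    {w : ℝ → E₁} (hw : IntEq ι μ T 0 w (fun t => -B (w t))) : ∀ t ∈ Ioc 0 T, w t = 0 := by
  have h₀ : IntEq ι μ T 0 (fun _ => (0 : E₁)) (fun _ => 0 - B 0) := by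
    refine ⟨memBC_of_continuousOn_Icc hμ hT continuousOn_const,
      memBC_of_continuousOn_Icc hμ hT continuousOn_const, fun t _ => ?_⟩
    simp only [map_zero, sub_zero, intervalIntegral.integral_zero, add_zero]
  have hw' : IntEq ι μ T 0 w (fun t => 0 - B (w t)) := by simpa only [zero_sub] using hw
  obtain ⟨u, -, huniq⟩ := hsol (fun _ => 0)
    (memBC_of_continuousOn_Icc hμ hT continuousOn_const) 0
  exact fun t ht => (huniq w hw' ht).trans (huniq _ h₀ ht).symm

include hμ in
theorem existsUnique_mem_linearGraph [CompleteSpace E₀] [CompleteSpace E₁] (hT : 0 < T)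
    (hsol : ∀ f : ℝ → E₀, MemBC μ T f → ∀ x : Interp ι μ,
      ∃ u, IntEq ι μ T x.val u (fun t => f t - B (u t)) ∧
        ∀ v, IntEq ι μ T x.val v (fun t => f t - B (v t)) → EqOn v u (Ioc 0 T))
    (p : weightedSpace T E₀ × Interp ι μ) : ∃! q, (p, q) ∈ linearGraph hμ ι B T := by
  obtain ⟨g, x⟩ := p
  obtain ⟨u, hu, huniq⟩ := hsol (unweight μ g) (memBC_unweight hμ.2 _ _) x
  have hrep := unweight_toWeighted hμ.2 hT.le le_rfl hu.memBC
  refine ⟨toWeighted hμ.2 hT.le le_rfl hu.memBC, (mem_linearGraph_iff hμ).2 <|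
    hu.congr hT hrep fun t ht => by simp only [hrep ht], fun q hq => ?_⟩
  exact unweight_injOn hT ((huniq _ ((mem_linearGraph_iff hμ).1 hq)).trans hrep.symm)

include hμ in
theorem nonempty_solutionOperator [CompleteSpace E₀] [CompleteSpace E₁] (hB : B ∈ maxReg ι μ) :
    Nonempty (SolutionOperator ι B μ) := by
  obtain ⟨T, hT, hsol⟩ := (mem_maxReg_iff hμ).1 hB
  obtain ⟨S, hS⟩ := exists_clm_of_isClosed_of_existsUnique (Z := linearGraph hμ ι B T)
    (isClosed_linearGraph hμ) (existsUnique_mem_linearGraph hμ hT hsol)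
  exact ⟨{
    T := T
    pos := hT
    S := S
    intEq := fun g x => (mem_linearGraph_iff hμ).1 (hS (g, x))
    unique := fun τ hτ hτT v hv =>
      hv.eq_zero_of_le hμ (fun w hw => eqOn_zero_of_existsUnique hμ.2 hT hsol hw) hτ hτT }⟩

namespace SolutionOperator

variable (D : SolutionOperator ι B μ)

/-- The solution of `u' + B u = f`, `u(0) = x`, where `g` represents `f`. -/
def sol (g : weightedSpace D.T E₀) (x : Interp ι μ) : ℝ → E₁ := unweight μ (D.S (g, x))

theorem sol_sub (g h : weightedSpace D.T E₀) (x y : Interp ι μ) (t : ℝ) :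
    D.sol (g - h) (x - y) t = D.sol g x t - D.sol h y t := by
  rw [sol, sol, sol, ← unweight_sub, ← map_sub]
  rfl

/-- A bound, in terms of the data, for the weighted norms in `E₁` of the solutions and in `E₀` of
their derivatives. -/
def maxRegBound : ℝ := 1 + (1 + ‖B‖) * ‖D.S‖

theorem maxRegBound_pos : 0 < D.maxRegBound := by
  unfold maxRegBound
  positivity

theorem weight_mul_norm_sol_le (g : weightedSpace D.T E₀) (x : Interp ι μ) (ht : 0 < t) :
    t ^ (1 - μ) * ‖D.sol g x t‖ ≤ ‖D.S‖ * (‖g‖ + ‖x‖) := by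
  refine (weight_mul_norm_unweight_le _ ht).trans ((D.S.le_opNorm _).trans ?_)
  gcongr
  exact max_le_add_of_nonneg (norm_nonneg g) (norm_nonneg x)

theorem weight_mul_norm_sol_le_maxRegBound (g : weightedSpace D.T E₀) (x : Interp ι μ)
    (ht : 0 < t) : t ^ (1 - μ) * ‖D.sol g x t‖ ≤ D.maxRegBound * (‖g‖ + ‖x‖) := by
  refine (D.weight_mul_norm_sol_le g x ht).trans (mul_le_mul_of_nonneg_right ?_ (by positivity))
  unfold maxRegBound
  linarith [mul_nonneg (norm_nonneg B) (norm_nonneg D.S)]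

theorem weight_mul_norm_deriv_le_maxRegBound (g : weightedSpace D.T E₀) (x : Interp ι μ)
    (ht : 0 < t) :
    t ^ (1 - μ) * ‖unweight μ g t - B (D.sol g x t)‖ ≤ D.maxRegBound * (‖g‖ + ‖x‖) := by
  have hB : t ^ (1 - μ) * ‖B (D.sol g x t)‖ ≤ ‖B‖ * (‖D.S‖ * (‖g‖ + ‖x‖)) :=
    calc t ^ (1 - μ) * ‖B (D.sol g x t)‖ ≤ t ^ (1 - μ) * (‖B‖ * ‖D.sol g x t‖) := by
          gcongr
          exact B.le_opNorm _
      _ = ‖B‖ * (t ^ (1 - μ) * ‖D.sol g x t‖) := mul_left_comm _ _ _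
      _ ≤ ‖B‖ * (‖D.S‖ * (‖g‖ + ‖x‖)) :=
          mul_le_mul_of_nonneg_left (D.weight_mul_norm_sol_le g x ht) (norm_nonneg B)
  calc t ^ (1 - μ) * ‖unweight μ g t - B (D.sol g x t)‖
      ≤ t ^ (1 - μ) * (‖unweight μ g t‖ + ‖B (D.sol g x t)‖) := by
        gcongr
        exact norm_sub_le _ _
    _ = t ^ (1 - μ) * ‖unweight μ g t‖ + t ^ (1 - μ) * ‖B (D.sol g x t)‖ := mul_add _ _ _
    _ ≤ ‖g‖ + ‖B‖ * (‖D.S‖ * (‖g‖ + ‖x‖)) := add_le_add (weight_mul_norm_unweight_le g ht) hB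
    _ ≤ D.maxRegBound * (‖g‖ + ‖x‖) := by
        have hS : 0 ≤ ‖D.S‖ * (‖g‖ + ‖x‖) := by positivity
        unfold maxRegBound
        linarith [norm_nonneg x]

/-- A common bound, in terms of the data, for the weighted norms in `E₁` of the solutions and in
`E₀` of their derivatives, and for the norms in `E_μ` of the solutions. -/
def bound : ℝ := 1 + (2 + 1 / μ) * D.maxRegBound

theorem one_le_bound (hμ : 0 < μ) : 1 ≤ D.bound := by
  have := D.maxRegBound_pos
  exact le_add_of_nonneg_right (by positivity)

theorem maxRegBound_le_bound (hμ : 0 < μ) : D.maxRegBound ≤ D.bound := by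
  have := D.maxRegBound_pos
  have : 0 ≤ 1 / μ * D.maxRegBound := by positivity
  unfold bound
  linarith

theorem weight_sol_le (hμ : 0 < μ) (g : weightedSpace D.T E₀) (x : Interp ι μ) (ht : 0 < t) :
    t ^ (1 - μ) * ‖D.sol g x t‖ ≤ D.bound * (‖g‖ + ‖x‖) :=
  (D.weight_mul_norm_sol_le_maxRegBound g x ht).trans <|
    mul_le_mul_of_nonneg_right (D.maxRegBound_le_bound hμ) (by positivity)

theorem weight_deriv_le (hμ : 0 < μ) (g : weightedSpace D.T E₀) (x : Interp ι μ) (ht : 0 < t) :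
    t ^ (1 - μ) * ‖unweight μ g t - B (D.sol g x t)‖ ≤ D.bound * (‖g‖ + ‖x‖) :=
  (D.weight_mul_norm_deriv_le_maxRegBound g x ht).trans <|
    mul_le_mul_of_nonneg_right (D.maxRegBound_le_bound hμ) (by positivity)

theorem norm_of_sol_le (g : weightedSpace D.T E₀) (x : Interp ι μ) (ht : t ∈ Ioc 0 D.T) :
    ‖Interp.of ι hμ (D.sol g x t)‖ ≤ D.bound * (‖g‖ + ‖x‖) := by
  have hsub := (D.intEq g x).norm_of_sub_le hμ ht
    (fun s hs => D.weight_mul_norm_sol_le_maxRegBound g x hs.1)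
    fun s hs => D.weight_mul_norm_deriv_le_maxRegBound g x hs.1
  calc ‖Interp.of ι hμ (D.sol g x t)‖ ≤ ‖x‖ + ‖Interp.of ι hμ (D.sol g x t) - x‖ :=
        norm_le_insert' _ _
    _ ≤ (‖g‖ + ‖x‖) + (2 + 1 / μ) * (D.maxRegBound * (‖g‖ + ‖x‖)) :=
        add_le_add (le_add_of_nonneg_left (norm_nonneg g)) hsub
    _ = D.bound * (‖g‖ + ‖x‖) := by
        unfold bound
        ring

end SolutionOperator

end LinearExistence

section Nonlinearity

variable {E₀ E₁ : Type*} [NormedAddCommGroup E₀] [NormedSpace ℝ E₀]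
  [NormedAddCommGroup E₁] [NormedSpace ℝ E₁] {ι : E₁ →L[ℝ] E₀} {μ d w : ℝ}

/-- The `y ∈ E₁` at distance at most `d` from `X` in `E_μ` with `w ‖y‖ ≤ d`. For `w = t ^ (1-μ)`
these are the values at time `t` allowed to a solution whose initial value is close to `X`. -/
def weightedBall (hμ : μ ∈ Ioo (0 : ℝ) 1) (X : Interp ι μ) (d w : ℝ) : Set E₁ :=
  {y | ‖Interp.of ι hμ y - X‖ ≤ d ∧ w * ‖y‖ ≤ d}

theorem weightedBall_mono {hμ : μ ∈ Ioo (0 : ℝ) 1} {X : Interp ι μ} {d' w' : ℝ} (hd : d ≤ d')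
    (hw : w' ≤ w) : weightedBall hμ X d w ⊆ weightedBall hμ X d' w' := fun _ hy =>
  ⟨hy.1.trans hd, (mul_le_mul_of_nonneg_right hw (norm_nonneg _)).trans (hy.2.trans hd)⟩

theorem rpow_mul_interpNorm_eq_le (hμ : μ ∈ Ioo (0 : ℝ) 1) {θ : ℝ} (hθ : θ ∈ Icc μ 1) (hw : 0 ≤ w)
    (y : E₁) :
    w ^ ((θ - μ) / (1 - μ)) * interpNorm ι θ (ι y) ≤
      ‖Interp.of ι hμ y‖ ^ (1 - (θ - μ) / (1 - μ)) * (w * ‖y‖) ^ ((θ - μ) / (1 - μ)) := by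
  rw [Real.mul_rpow hw (norm_nonneg y), mul_left_comm]
  exact mul_le_mul_of_nonneg_left (interpNorm_le_rpow_mul_rpow hμ hθ y) (Real.rpow_nonneg hw _)

theorem rpow_mul_interpNorm_le (hμ : μ ∈ Ioo (0 : ℝ) 1) {θ : ℝ} (hθ : θ ∈ Icc μ 1) (hw : 0 ≤ w)
    (y : E₁) :
    w ^ ((θ - μ) / (1 - μ)) * interpNorm ι θ (ι y) ≤ ‖Interp.of ι hμ y‖ + w * ‖y‖ := by
  have hμ' : 0 < 1 - μ := sub_pos.2 hμ.2
  have hγ : 0 ≤ (θ - μ) / (1 - μ) := div_nonneg (sub_nonneg.2 hθ.1) hμ'.le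
  have hγ' : (θ - μ) / (1 - μ) ≤ 1 := (div_le_one hμ').2 (by linarith [hθ.2])
  have hwy : 0 ≤ w * ‖y‖ := by positivity
  calc w ^ ((θ - μ) / (1 - μ)) * interpNorm ι θ (ι y)
      ≤ ‖Interp.of ι hμ y‖ ^ (1 - (θ - μ) / (1 - μ)) * (w * ‖y‖) ^ ((θ - μ) / (1 - μ)) :=
        rpow_mul_interpNorm_eq_le hμ hθ hw y
    _ ≤ (1 - (θ - μ) / (1 - μ)) * ‖Interp.of ι hμ y‖ + (θ - μ) / (1 - μ) * (w * ‖y‖) :=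
        Real.geom_mean_le_arith_mean2_weighted (sub_nonneg.2 hγ') hγ (norm_nonneg _) hwy
          (sub_add_cancel _ _)
    _ ≤ ‖Interp.of ι hμ y‖ + w * ‖y‖ := by
        exact add_le_add (mul_le_of_le_one_left (norm_nonneg _) (sub_le_self _ hγ))
          (mul_le_of_le_one_left hwy hγ')

theorem rpow_mul_interpNorm_le_of_mem_weightedBall {hμ : μ ∈ Ioo (0 : ℝ) 1} {θ : ℝ}
    (hθ : θ ∈ Icc μ 1) (hw : 0 ≤ w) {X : Interp ι μ} (hd : d ≤ 1) {y : E₁}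
    (hy : y ∈ weightedBall hμ X d w) :
    w ^ ((θ - μ) / (1 - μ)) * interpNorm ι θ (ι y) ≤
      (‖X‖ + 1) ^ (1 - (θ - μ) / (1 - μ)) * d ^ ((θ - μ) / (1 - μ)) := by
  have hμ' : 0 < 1 - μ := sub_pos.2 hμ.2
  have hγ : 0 ≤ (θ - μ) / (1 - μ) := div_nonneg (sub_nonneg.2 hθ.1) hμ'.le
  have hγ' : 0 ≤ 1 - (θ - μ) / (1 - μ) :=
    sub_nonneg.2 ((div_le_one hμ').2 (by linarith [hθ.2]))
  have hyX : ‖Interp.of ι hμ y‖ ≤ ‖X‖ + 1 := by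
    linarith [norm_le_insert' (Interp.of ι hμ y) X, hy.1]
  refine (rpow_mul_interpNorm_eq_le hμ hθ hw y).trans ?_
  exact mul_le_mul (Real.rpow_le_rpow (norm_nonneg _) hyX hγ')
    (Real.rpow_le_rpow (by positivity) hy.2 hγ) (by positivity) (by positivity)

theorem rpow_mul_rpow_le_of_rpow_mul_le {α γ ρ N M : ℝ} (hw : w ∈ Ioc 0 d) (hd : d ≤ 1)
    (hN : 0 ≤ N) (hM : 0 ≤ M) (hρ : 0 ≤ ρ) (hγα : γ ≤ α) (hραγ : ρ * α + γ ≤ 1)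
    (h : w ^ α * N ≤ M * d ^ α) : w ^ (1 - γ) * N ^ ρ ≤ M ^ ρ * d ^ (1 - α) := by
  have hd₀ : 0 < d := hw.1.trans_le hw.2
  have hw₀ := hw.1.le
  have split : ∀ s : ℝ, 0 < s → s ^ (1 - γ) = s ^ (1 - (ρ * α + γ)) * (s ^ α) ^ ρ := fun s hs => by
    rw [← Real.rpow_mul hs.le, ← Real.rpow_add hs]
    congr 1
    ring
  calc w ^ (1 - γ) * N ^ ρ = w ^ (1 - (ρ * α + γ)) * (w ^ α * N) ^ ρ := by
        rw [split w hw.1, Real.mul_rpow (by positivity) hN, mul_assoc]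
    _ ≤ d ^ (1 - (ρ * α + γ)) * (M * d ^ α) ^ ρ :=
        mul_le_mul (Real.rpow_le_rpow hw₀ hw.2 (sub_nonneg.2 hραγ))
          (Real.rpow_le_rpow (by positivity) h hρ) (by positivity) (by positivity)
    _ = M ^ ρ * d ^ (1 - γ) := by
        rw [split d hd₀, Real.mul_rpow hM (by positivity), mul_left_comm]
    _ ≤ M ^ ρ * d ^ (1 - α) := mul_le_mul_of_nonneg_left
        (Real.rpow_le_rpow_of_exponent_ge hd₀ hd (by linarith)) (by positivity)

theorem mul_one_add_mul_le {γ a₁ a₂ c D s δ : ℝ} (hw : 0 < w) (h₀ : w ^ (1 - γ) ≤ δ)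
    (h₁ : w ^ (1 - γ) * a₁ ≤ c * δ) (h₂ : w ^ (1 - γ) * a₂ ≤ c * δ) (ha₁ : 0 ≤ a₁) (ha₂ : 0 ≤ a₂)
    (hs : 0 ≤ s) (hD : w ^ γ * D ≤ s) :
    w * ((1 + a₁ + a₂) * D) ≤ (1 + 2 * c) * δ * s := by
  have hsplit : w ^ (1 - γ) * w ^ γ = w := by rw [← Real.rpow_add hw, sub_add_cancel, Real.rpow_one]
  calc w * ((1 + a₁ + a₂) * D) = w ^ (1 - γ) * (1 + a₁ + a₂) * (w ^ γ * D) := by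
        rw [mul_mul_mul_comm, hsplit]
    _ ≤ w ^ (1 - γ) * (1 + a₁ + a₂) * s := mul_le_mul_of_nonneg_left hD (by positivity)
    _ ≤ (1 + 2 * c) * δ * s := mul_le_mul_of_nonneg_right (by linarith) hs

/- With `α = (β-μ)/(1-μ)` and `γ = (b-μ)/(1-μ)`, the condition on the exponents is `ρ α + γ ≤ 1`:
splitting the weight as `w = w ^ (1-γ) w ^ γ`, the first factor absorbs the powers of the norms in
`E_β`, with a gain of `d ^ (1-α)`, and the second one the norm of the difference. -/
theorem weight_mul_growth_le {hμ : μ ∈ Ioo (0 : ℝ) 1} {β b ρ : ℝ} (hβ : β ≤ 1) (hb : b ∈ Icc μ β)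
    (hρ : 0 ≤ ρ) (hρb : (ρ * (β - μ) + (b - μ)) / (1 - μ) ≤ 1) (hw : w ∈ Ioc 0 d) (hd : d ≤ 1)
    {X : Interp ι μ} {y₁ y₂ : E₁} (hy₁ : y₁ ∈ weightedBall hμ X d w)
    (hy₂ : y₂ ∈ weightedBall hμ X d w) :
    w * ((1 + interpNorm ι β (ι y₁) ^ ρ + interpNorm ι β (ι y₂) ^ ρ) *
        interpNorm ι b (ι y₁ - ι y₂)) ≤
      (1 + 2 * ((‖X‖ + 1) ^ (1 - (β - μ) / (1 - μ))) ^ ρ) * d ^ (1 - (β - μ) / (1 - μ)) *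
        (‖Interp.of ι hμ y₁ - Interp.of ι hμ y₂‖ + w * ‖y₁ - y₂‖) := by
  have hμ' : 0 < 1 - μ := sub_pos.2 hμ.2
  have hβμ : β ∈ Icc μ 1 := ⟨hb.1.trans hb.2, hβ⟩
  have hα : 0 ≤ (β - μ) / (1 - μ) := div_nonneg (sub_nonneg.2 hβμ.1) hμ'.le
  have hγα : (b - μ) / (1 - μ) ≤ (β - μ) / (1 - μ) :=
    div_le_div_of_nonneg_right (sub_le_sub_right hb.2 μ) hμ'.le
  rw [add_div, mul_div_assoc] at hρb
  have hgrowth : ∀ y ∈ weightedBall hμ X d w,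
      w ^ (1 - (b - μ) / (1 - μ)) * interpNorm ι β (ι y) ^ ρ ≤
        ((‖X‖ + 1) ^ (1 - (β - μ) / (1 - μ))) ^ ρ * d ^ (1 - (β - μ) / (1 - μ)) := fun y hy =>
    rpow_mul_rpow_le_of_rpow_mul_le hw hd (interpNorm_nonneg _ _ _) (by positivity) hρ hγα hρb
      (rpow_mul_interpNorm_le_of_mem_weightedBall hβμ hw.1.le hd hy)
  have hweight : w ^ (1 - (b - μ) / (1 - μ)) ≤ d ^ (1 - (β - μ) / (1 - μ)) :=
    (Real.rpow_le_rpow hw.1.le hw.2 (by linarith [mul_nonneg hρ hα])).trans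
      (Real.rpow_le_rpow_of_exponent_ge (hw.1.trans_le hw.2) hd (by linarith))
  refine mul_one_add_mul_le hw.1 hweight (hgrowth y₁ hy₁) (hgrowth y₂ hy₂)
    (Real.rpow_nonneg (interpNorm_nonneg _ _ _) _) (Real.rpow_nonneg (interpNorm_nonneg _ _ _) _)
    (add_nonneg (norm_nonneg _) (mul_nonneg hw.1.le (norm_nonneg _))) ?_
  rw [← map_sub, ← Interp.of_sub]
  exact rpow_mul_interpNorm_le hμ ⟨hb.1, hb.2.trans hβ⟩ hw.1.le _

theorem H2.exists_weighted_bound {V : Set (Interp ι μ)} {F₂ : Interp ι μ → E₀} (hF : H2 ι V F₂)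
    (hμ : μ ∈ Ioo (0 : ℝ) 1) {X : Interp ι μ} (hX : X ∈ V) :
    ∃ p > (0 : ℝ), ∃ C : ℝ, ∀ d ≤ 1, Metric.closedBall X d ⊆ V → ∀ w ∈ Ioc 0 d,
      ∀ y₁ ∈ weightedBall hμ X d w, ∀ y₂ ∈ weightedBall hμ X d w,
      w * ‖F₂ (Interp.of ι hμ y₁) - F₂ (Interp.of ι hμ y₂)‖ ≤
        C * d ^ p * (‖Interp.of ι hμ y₁ - Interp.of ι hμ y₂‖ + w * ‖y₁ - y₂‖) := by
  obtain ⟨β, hβ, m, b, ρ, hbρ, hF⟩ := hF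
  obtain ⟨C, hC, hF⟩ := hF X hX 1 one_pos
  set α := (β - μ) / (1 - μ)
  set M := (‖X‖ + 1) ^ (1 - α)
  refine ⟨1 - α, sub_pos.2 ((div_lt_one (sub_pos.2 hμ.2)).2 (by linarith [hβ.2])),
    C * ∑ j, (1 + 2 * M ^ ρ j), fun d hd hdV w hw y₁ hy₁ y₂ hy₂ => ?_⟩
  set s := ‖Interp.of ι hμ y₁ - Interp.of ι hμ y₂‖ + w * ‖y₁ - y₂‖
  have hmem : ∀ y ∈ weightedBall hμ X d w, Interp.of ι hμ y ∈ Metric.closedBall X 1 ∩ V :=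
    fun y hy => ⟨mem_closedBall_iff_norm.2 (hy.1.trans hd), hdV (mem_closedBall_iff_norm.2 hy.1)⟩
  have hβ₀ : β ∈ Ioo (0 : ℝ) 1 := ⟨hμ.1.trans hβ.1, hβ.2⟩
  calc w * ‖F₂ (Interp.of ι hμ y₁) - F₂ (Interp.of ι hμ y₂)‖
      ≤ w * (C * ∑ j, (1 + interpNorm ι β (ι y₁) ^ ρ j + interpNorm ι β (ι y₂) ^ ρ j) *
          interpNorm ι (b j) (ι y₁ - ι y₂)) :=
        mul_le_mul_of_nonneg_left (hF _ (hmem y₁ hy₁) _ (hmem y₂ hy₂)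
          (mem_interp ι hβ₀ y₁) (mem_interp ι hβ₀ y₂)) hw.1.le
    _ ≤ C * ∑ j, (1 + 2 * M ^ ρ j) * d ^ (1 - α) * s := by
        rw [mul_left_comm, Finset.mul_sum]
        refine mul_le_mul_of_nonneg_left (Finset.sum_le_sum fun j _ => ?_) hC.le
        exact weight_mul_growth_le hβ.2.le (hbρ j).1 (hbρ j).2.1 (hbρ j).2.2 hw hd hy₁ hy₂
    _ = C * (∑ j, (1 + 2 * M ^ ρ j)) * d ^ (1 - α) * s := by
        simp only [← Finset.sum_mul, mul_assoc]

/-- The property of the right-hand side `N` of an autonomous equation `u' = N(u)` on which its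
solution rests: near every point of `V`, `N + B` has an arbitrarily small Lipschitz constant in
weighted norms for some operator `B` with maximal regularity. -/
def Admissible (hμ : μ ∈ Ioo (0 : ℝ) 1) (V : Set (Interp ι μ)) (N : E₁ → E₀) : Prop :=
  ∀ X ∈ V, ∃ B ∈ maxReg ι μ, ∀ κ > 0, ∃ d > 0, Metric.closedBall X d ⊆ V ∧
    ∀ w ∈ Ioc 0 d, ∀ y₁ ∈ weightedBall hμ X d w, ∀ y₂ ∈ weightedBall hμ X d w,
      w * ‖(N y₁ + B y₁) - (N y₂ + B y₂)‖ ≤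
        κ * (‖Interp.of ι hμ y₁ - Interp.of ι hμ y₂‖ + w * ‖y₁ - y₂‖)

/-- The right-hand side `F₁(u) + F₂(u) - A(u) u` of the quasilinear equation. -/
def rhs (hμ : μ ∈ Ioo (0 : ℝ) 1) (A : Interp ι μ → E₁ →L[ℝ] E₀) (F₁ F₂ : Interp ι μ → E₀)
    (y : E₁) : E₀ :=
  F₁ (Interp.of ι hμ y) + F₂ (Interp.of ι hμ y) - A (Interp.of ι hμ y) y

variable {V : Set (Interp ι μ)} {A : Interp ι μ → E₁ →L[ℝ] E₀} {F₁ F₂ : Interp ι μ → E₀}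

theorem H1.exists_lipschitz_closedBall (h : H1 ι V A F₁) (hV : IsOpen V) {X : Interp ι μ}
    (hX : X ∈ V) : ∃ L ≥ (0 : ℝ), ∃ r > 0, Metric.closedBall X r ⊆ V ∧
      ∀ x ∈ Metric.closedBall X r, ∀ y ∈ Metric.closedBall X r,
        ‖A x - A y‖ ≤ L * ‖x - y‖ ∧ ‖F₁ x - F₁ y‖ ≤ L * ‖x - y‖ := by
  obtain ⟨L, t, ht, hL⟩ := h.1 hX
  rw [hV.nhdsWithin_eq hX] at ht
  obtain ⟨r, hr, hrt⟩ := Metric.nhds_basis_closedBall.mem_iff.1 (inter_mem ht (hV.mem_nhds hX))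
  refine ⟨L, L.2, r, hr, fun x hx => (hrt hx).2, fun x hx y hy => ?_⟩
  have hdist := hL.dist_le_mul x (hrt hx).1 y (hrt hy).1
  rw [Prod.dist_eq, dist_eq_norm x y] at hdist
  simpa only [dist_eq_norm] using max_le_iff.1 hdist

theorem weight_mul_norm_quasilinear_sub_le {B A₁ A₂ : E₁ →L[ℝ] E₀} {y₁ y₂ : E₁} {L a : ℝ}
    (hw : 0 ≤ w) (hL : 0 ≤ L) (hA : ‖A₁ - A₂‖ ≤ L * a) (hB : ‖B - A₂‖ ≤ L * d) (ha : 0 ≤ a)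
    (hy₁ : w * ‖y₁‖ ≤ d) :
    w * ‖(B y₁ - A₁ y₁) - (B y₂ - A₂ y₂)‖ ≤ L * d * (a + w * ‖y₁ - y₂‖) := by
  have hdecomp : (B y₁ - A₁ y₁) - (B y₂ - A₂ y₂) = (B - A₂) (y₁ - y₂) - (A₁ - A₂) y₁ := by
    simp only [sub_apply, map_sub]
    abel
  calc w * ‖(B y₁ - A₁ y₁) - (B y₂ - A₂ y₂)‖
      ≤ w * (L * d * ‖y₁ - y₂‖ + L * a * ‖y₁‖) := by
        rw [hdecomp]
        exact mul_le_mul_of_nonneg_left ((norm_sub_le _ _).trans (add_le_add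
          ((B - A₂).le_of_opNorm_le hB _) ((A₁ - A₂).le_of_opNorm_le hA _))) hw
    _ = L * d * (w * ‖y₁ - y₂‖) + L * a * (w * ‖y₁‖) := by ring
    _ ≤ L * d * (w * ‖y₁ - y₂‖) + L * a * d := by gcongr
    _ = L * d * (a + w * ‖y₁ - y₂‖) := by ring

theorem H1.exists_weighted_bound (h : H1 ι V A F₁) (hV : IsOpen V) (hμ : μ ∈ Ioo (0 : ℝ) 1)
    {X : Interp ι μ} (hX : X ∈ V) :
    ∃ L : ℝ, ∃ r > 0, Metric.closedBall X r ⊆ V ∧ ∀ d ≤ r, ∀ w ∈ Ioc 0 d,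
      ∀ y₁ ∈ weightedBall hμ X d w, ∀ y₂ ∈ weightedBall hμ X d w,
      w * ‖(F₁ (Interp.of ι hμ y₁) + (A X y₁ - A (Interp.of ι hμ y₁) y₁)) -
          (F₁ (Interp.of ι hμ y₂) + (A X y₂ - A (Interp.of ι hμ y₂) y₂))‖ ≤
        L * d * (‖Interp.of ι hμ y₁ - Interp.of ι hμ y₂‖ + w * ‖y₁ - y₂‖) := by
  obtain ⟨L, hL, r, hr, hrV, hlip⟩ := h.exists_lipschitz_closedBall hV hX
  refine ⟨2 * L, r, hr, hrV, fun d hdr w hw y₁ hy₁ y₂ hy₂ => ?_⟩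
  set x₁ := Interp.of ι hμ y₁
  set x₂ := Interp.of ι hμ y₂
  have hx₁ : x₁ ∈ Metric.closedBall X r := mem_closedBall_iff_norm.2 (hy₁.1.trans hdr)
  have hx₂ : x₂ ∈ Metric.closedBall X r := mem_closedBall_iff_norm.2 (hy₂.1.trans hdr)
  have hA : ‖A X - A x₂‖ ≤ L * d := ((hlip X (Metric.mem_closedBall_self hr.le) x₂ hx₂).1.trans <|
    mul_le_mul_of_nonneg_left (by rw [norm_sub_rev]; exact hy₂.1) hL)
  have hF : w * ‖F₁ x₁ - F₁ x₂‖ ≤ L * d * (‖x₁ - x₂‖ + w * ‖y₁ - y₂‖) :=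
    calc w * ‖F₁ x₁ - F₁ x₂‖ ≤ d * (L * ‖x₁ - x₂‖) :=
          mul_le_mul hw.2 (hlip x₁ hx₁ x₂ hx₂).2 (norm_nonneg _) (hw.1.le.trans hw.2)
      _ = L * d * ‖x₁ - x₂‖ := by ring
      _ ≤ L * d * (‖x₁ - x₂‖ + w * ‖y₁ - y₂‖) := mul_le_mul_of_nonneg_left
          (le_add_of_nonneg_right (mul_nonneg hw.1.le (norm_nonneg _)))
          (mul_nonneg hL (hw.1.le.trans hw.2))
  have hquasi := weight_mul_norm_quasilinear_sub_le (y₂ := y₂) hw.1.le hL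
    (hlip x₁ hx₁ x₂ hx₂).1 hA (norm_nonneg _) hy₁.2
  rw [add_sub_add_comm]
  calc w * ‖(F₁ x₁ - F₁ x₂) + ((A X y₁ - A x₁ y₁) - (A X y₂ - A x₂ y₂))‖
      ≤ w * ‖F₁ x₁ - F₁ x₂‖ + w * ‖(A X y₁ - A x₁ y₁) - (A X y₂ - A x₂ y₂)‖ := by
        rw [← mul_add]
        exact mul_le_mul_of_nonneg_left (norm_add_le _ _) hw.1.le
    _ ≤ L * d * (‖x₁ - x₂‖ + w * ‖y₁ - y₂‖) + L * d * (‖x₁ - x₂‖ + w * ‖y₁ - y₂‖) :=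
        add_le_add hF hquasi
    _ = 2 * L * d * (‖x₁ - x₂‖ + w * ‖y₁ - y₂‖) := by ring

theorem admissible_rhs (hμ : μ ∈ Ioo (0 : ℝ) 1) (hV : IsOpen V) (h1 : H1 ι V A F₁)
    (h2 : H2 ι V F₂) : Admissible hμ V (rhs hμ A F₁ F₂) := by
  intro X hX
  refine ⟨A X, h1.2 X hX, fun κ hκ => ?_⟩
  obtain ⟨L, r, hr, hrV, hL⟩ := h1.exists_weighted_bound hV hμ hX
  obtain ⟨p, hp, C, hC⟩ := h2.exists_weighted_bound hμ hX
  have hlim : Tendsto (fun d : ℝ => L * d + C * d ^ p) (𝓝[>] 0) (𝓝 0) := by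
    simpa using ((tendsto_id.mono_left nhdsWithin_le_nhds).const_mul L).add
      ((tendsto_rpow_nhdsGT_zero hp).const_mul C)
  obtain ⟨d, hdκ, hd, hdr⟩ := ((hlim.eventually_le_const hκ).and
    (Ioc_mem_nhdsGT (lt_min hr one_pos))).exists
  have hdV : Metric.closedBall X d ⊆ V :=
    (Metric.closedBall_subset_closedBall (hdr.trans (min_le_left _ _))).trans hrV
  refine ⟨d, hd, hdV, fun w hw y₁ hy₁ y₂ hy₂ => ?_⟩
  set s := ‖Interp.of ι hμ y₁ - Interp.of ι hμ y₂‖ + w * ‖y₁ - y₂‖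
  have hs : 0 ≤ s := add_nonneg (norm_nonneg _) (mul_nonneg hw.1.le (norm_nonneg _))
  have hdecomp : ∀ y, rhs hμ A F₁ F₂ y + A X y = (F₁ (Interp.of ι hμ y) +
      (A X y - A (Interp.of ι hμ y) y)) + F₂ (Interp.of ι hμ y) := fun y => by
    unfold rhs
    abel
  rw [hdecomp, hdecomp, add_sub_add_comm]
  calc _ ≤ _ := mul_le_mul_of_nonneg_left (norm_add_le _ _) hw.1.le
    _ ≤ L * d * s + C * d ^ p * s := by
        rw [mul_add]
        exact add_le_add (hL d (hdr.trans (min_le_left _ _)) w hw y₁ hy₁ y₂ hy₂)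
          (hC d (hdr.trans (min_le_right _ _)) hdV w hw y₁ hy₁ y₂ hy₂)
    _ = (L * d + C * d ^ p) * s := by rw [add_mul]
    _ ≤ κ * s := mul_le_mul_of_nonneg_right hdκ hs

variable {hμ : μ ∈ Ioo (0 : ℝ) 1} {N : E₁ → E₀}

theorem Admissible.continuousAt (hN : Admissible hμ V N) {y : E₁} (hy : Interp.of ι hμ y ∈ V) :
    ContinuousAt N y := by
  obtain ⟨B, -, hB⟩ := hN _ hy
  obtain ⟨d, hd, -, hlip⟩ := hB 1 one_pos
  set w := min d (d / (‖y‖ + 1))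
  have hy₁ : 0 < ‖y‖ + 1 := by positivity
  have hw₀ : 0 < w := by positivity
  have hwy : ∀ z : E₁, ‖z‖ ≤ ‖y‖ + 1 → w * ‖z‖ ≤ d := fun z hz =>
    (mul_le_mul (min_le_right _ _) hz (norm_nonneg _) (by positivity)).trans_eq
      (div_mul_cancel₀ _ hy₁.ne')
  have hof : Tendsto (fun z => ‖Interp.of ι hμ z - Interp.of ι hμ y‖) (𝓝 y) (𝓝 0) :=
    tendsto_iff_norm_sub_tendsto_zero.1 ((Interp.ofL ι hμ).continuous.tendsto y)
  have hsub : Tendsto (fun z => ‖z - y‖) (𝓝 y) (𝓝 0) :=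
    tendsto_iff_norm_sub_tendsto_zero.1 tendsto_id
  have hlim : Tendsto (fun z => w⁻¹ * (‖Interp.of ι hμ z - Interp.of ι hμ y‖ + w * ‖z - y‖))
      (𝓝 y) (𝓝 0) := by
    simpa using (hof.add (hsub.const_mul w)).const_mul w⁻¹
  have hNB : ContinuousAt (fun z => N z + B z) y := by
    refine tendsto_iff_norm_sub_tendsto_zero.2
      (squeeze_zero' (Eventually.of_forall fun _ => norm_nonneg _) ?_ hlim)
    filter_upwards [hof.eventually_le_const hd, hsub.eventually_le_const one_pos] with z hz hz₁
    rw [le_inv_mul_iff₀ hw₀, ← one_mul (‖Interp.of ι hμ z - _‖ + _)]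
    exact hlip w ⟨hw₀, min_le_left _ _⟩ z ⟨hz, hwy z (by linarith [norm_le_insert' z y])⟩ y
      ⟨by simpa using hd.le, hwy y (by linarith)⟩
  exact (hNB.sub B.continuous.continuousAt).congr (Eventually.of_forall fun z => by simp)

theorem norm_of_sub_add_weight_le {X : Interp ι μ} {y z : E₁} (hw : 0 ≤ w)
    (hy : y ∈ weightedBall hμ X d w) (hz : z ∈ weightedBall hμ X d w) :
    ‖Interp.of ι hμ y - Interp.of ι hμ z‖ + w * ‖y - z‖ ≤ 4 * d := by
  have hof := norm_sub_le_norm_sub_add_norm_sub (Interp.of ι hμ y) X (Interp.of ι hμ z)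
  rw [norm_sub_rev X] at hof
  have hsub : w * ‖y - z‖ ≤ w * ‖y‖ + w * ‖z‖ := by
    rw [← mul_add]
    exact mul_le_mul_of_nonneg_left (norm_sub_le _ _) hw
  linarith [hy.1, hy.2, hz.1, hz.2]

theorem weight_mul_norm_le_of_mem_weightedBall {X : Interp ι μ} {G : E₁ → E₀} {κ : ℝ} {y z : E₁}
    (hκ : 0 ≤ κ) (hw : 0 ≤ w) (hy : y ∈ weightedBall hμ X d w) (hz : z ∈ weightedBall hμ X d w)
    (h : w * ‖G y - G z‖ ≤ κ * (‖Interp.of ι hμ y - Interp.of ι hμ z‖ + w * ‖y - z‖)) :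
    w * ‖G y‖ ≤ w * ‖G z‖ + κ * (4 * d) :=
  calc w * ‖G y‖ ≤ w * (‖G z‖ + ‖G y - G z‖) :=
        mul_le_mul_of_nonneg_left (norm_le_insert' _ _) hw
    _ = w * ‖G z‖ + w * ‖G y - G z‖ := mul_add _ _ _
    _ ≤ w * ‖G z‖ + κ * (4 * d) := add_le_add le_rfl
        (h.trans (mul_le_mul_of_nonneg_left (norm_of_sub_add_weight_le hw hy hz) hκ))

theorem MemBC.eventually_mem_weightedBall {T : ℝ} {u : ℝ → E₁} {X : Interp ι μ}
    (hu : MemBC μ T u) (hlim : Tendsto (fun t => Interp.of ι hμ (u t)) (𝓝[>] 0) (𝓝 X))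
    (hd : 0 < d) : ∀ᶠ t in 𝓝[>] (0 : ℝ), u t ∈ weightedBall hμ X d (t ^ (1 - μ)) :=
  ((tendsto_iff_norm_sub_tendsto_zero.1 hlim).eventually_le_const hd).and
    (hu.2.2.eventually_le_const hd)

theorem eventually_rpow_mem_Ioc (hμ : μ < 1) (hd : 0 < d) :
    ∀ᶠ t in 𝓝[>] (0 : ℝ), t ^ (1 - μ) ∈ Ioc 0 d := by
  filter_upwards [self_mem_nhdsWithin,
    (tendsto_rpow_nhdsGT_zero (sub_pos.2 hμ)).eventually_le_const hd] with t ht htd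
  exact ⟨Real.rpow_pos_of_pos ht _, htd⟩

/- For fixed small `t₀`, the weighted norm of `(N + B)(u(t))` is bounded by that of the fixed vector
`(N + B)(u(t₀))`, which tends to `0`, and a multiple of the radius of a ball containing both. -/
theorem Admissible.memBC (hN : Admissible hμ V N) {T : ℝ} (hT : 0 < T) {u : ℝ → E₁}
    {X : Interp ι μ} (hX : X ∈ V) (hu : MemBC μ T u)
    (hlim : Tendsto (fun t => Interp.of ι hμ (u t)) (𝓝[>] 0) (𝓝 X))
    (huV : ∀ t ∈ Ioc 0 T, Interp.of ι hμ (u t) ∈ V) : MemBC μ T (fun t => N (u t)) := by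
  have hcont : ContinuousOn (fun t => N (u t)) (Ioc 0 T) := fun t ht =>
    ContinuousAt.comp_continuousWithinAt (hN.continuousAt (huV t ht)) (hu.1 t ht)
  obtain ⟨B, -, hB⟩ := hN X hX
  obtain ⟨d₁, hd₁, -, hlip⟩ := hB 1 one_pos
  have hzero : Tendsto (fun t => t ^ (1 - μ) * ‖N (u t) + B (u t)‖) (𝓝[>] 0) (𝓝 0) := by
    rw [Metric.tendsto_nhds]
    intro ε hε
    set d := min d₁ (ε / 8)
    have hd : 0 < d := by positivity
    have hball := hu.eventually_mem_weightedBall hlim hd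
    have hweight := eventually_rpow_mem_Ioc hμ.2 hd
    obtain ⟨t₀, ht₀, ht₀pos⟩ := (hball.and self_mem_nhdsWithin).exists
    have hfix : Tendsto (fun t => t ^ (1 - μ) * ‖N (u t₀) + B (u t₀)‖) (𝓝[>] 0) (𝓝 0) := by
      simpa using (tendsto_rpow_nhdsGT_zero (sub_pos.2 hμ.2)).mul_const ‖N (u t₀) + B (u t₀)‖
    filter_upwards [hball, hweight, hfix.eventually_lt_const (half_pos hε),
      Ioc_mem_nhdsGT ht₀pos] with t hy hw hsmall ht
    have hz : u t₀ ∈ weightedBall hμ X d (t ^ (1 - μ)) := weightedBall_mono le_rfl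
      (Real.rpow_le_rpow ht.1.le ht.2 (sub_pos.2 hμ.2).le) ht₀
    have hsub := weightedBall_mono (hμ := hμ) (X := X) (min_le_left d₁ (ε / 8))
      (le_refl (t ^ (1 - μ)))
    have hle := weight_mul_norm_le_of_mem_weightedBall (G := fun y => N y + B y) zero_le_one
      hw.1.le hy hz (hlip _ ⟨hw.1, hw.2.trans (min_le_left _ _)⟩ _ (hsub hy) _ (hsub hz))
    rw [Real.dist_eq, sub_zero, abs_of_nonneg (mul_nonneg hw.1.le (norm_nonneg _))]
    linarith [min_le_right d₁ (ε / 8)]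
  have hsum := memBC_of_eventually_le hμ.2 (hcont.add (B.continuous.comp_continuousOn hu.1))
    (Eventually.of_forall fun _ => le_rfl) hzero
  exact (hsum.sub hμ.2 (hu.clm_comp hμ.2 B)).congr hT fun t _ => by simp

end Nonlinearity

section Solutions

variable {E₀ E₁ : Type*} [NormedAddCommGroup E₀] [NormedSpace ℝ E₀]
  [NormedAddCommGroup E₁] [NormedSpace ℝ E₁] {ι B : E₁ →L[ℝ] E₀} {μ : ℝ}
  {hμ : μ ∈ Ioo (0 : ℝ) 1} {V : Set (Interp ι μ)} {N : E₁ → E₀} {X x y : Interp ι μ}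
  {a d r κ t T τ : ℝ} {u v : ℝ → E₁}

/-- A solution of `u' = N(u)`, `u(0) = X` on `[0,T]` with values in `V`, the equation being taken
in its integrated form. -/
structure Sol (hμ : μ ∈ Ioo (0 : ℝ) 1) (V : Set (Interp ι μ)) (N : E₁ → E₀) (X : Interp ι μ)
    (T : ℝ) (u : ℝ → E₁) : Prop where
  intEq : IntEq ι μ T X.val u (fun t => N (u t))
  mem : ∀ t ∈ Ioc 0 T, Interp.of ι hμ (u t) ∈ V

namespace Sol

theorem mono (h : Sol hμ V N X T u) (hτ : τ ≤ T) : Sol hμ V N X τ u :=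
  ⟨h.intEq.mono hτ, fun t ht => h.mem t ⟨ht.1, ht.2.trans hτ⟩⟩

theorem congr (h : Sol hμ V N X T u) (hT : 0 < T) (hv : EqOn v u (Ioc 0 T)) :
    Sol hμ V N X T v where
  intEq := h.intEq.congr hT hv fun t ht => by simp only [hv ht]
  mem t ht := by
    rw [hv ht]
    exact h.mem t ht

theorem shift (h : Sol hμ V N X T u) (ha : 0 < a) (haT : a < T) :
    Sol hμ V N (Interp.of ι hμ (u a)) (T - a) (fun t => u (a + t)) :=
  ⟨h.intEq.shift hμ ha haT, fun t ht => h.mem (a + t) ⟨by linarith [ht.1], by linarith [ht.2]⟩⟩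

theorem glue (h : Sol hμ V N X T u) (ha : 0 < a) (haT : a < T)
    (h' : Sol hμ V N (Interp.of ι hμ (u a)) τ v)
    (hv : EqOn v (fun s => u (a + s)) (Ioc 0 (T - a))) :
    Sol hμ V N X (a + τ) (glue a T u v) where
  intEq := by
    have hN : (fun t => N (QuasiPar.glue a T u v t)) =
        QuasiPar.glue a T (fun t => N (u t)) (fun t => N (v t)) :=
      funext fun _ => apply_ite N _ _ _
    rw [hN]
    exact h.intEq.glue hμ h'.intEq ha haT hv fun t ht => by simp only [hv ht]
  mem t ht := by
    rcases le_or_gt t T with htT | htT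
    · rw [glue_of_le _ _ htT]
      exact h.mem t ⟨ht.1, htT⟩
    · rw [glue_of_lt hv (haT.trans htT)]
      exact h'.mem _ ⟨by linarith, by linarith [ht.2]⟩

theorem memBC_add (h : Sol hμ V N X T u) (B : E₁ →L[ℝ] E₀) :
    MemBC μ T (fun t => N (u t) + B (u t)) :=
  h.intEq.memBC_deriv.add hμ.2 (h.intEq.memBC.clm_comp hμ.2 B)

theorem eqOn_sol (h : Sol hμ V N X τ u) (D : SolutionOperator ι B μ) (hτ : 0 < τ) (hτT : τ ≤ D.T) :
    EqOn u (D.sol (toWeighted hμ.2 hτ.le hτT (h.memBC_add B)) X) (Ioc 0 τ) := by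
  set g := toWeighted hμ.2 hτ.le hτT (h.memBC_add B)
  have hsub := h.intEq.sub hμ ((D.intEq g X).mono hτT)
  rw [sub_self] at hsub
  refine fun t ht => sub_eq_zero.1 (D.unique τ hτ hτT (fun t => u t - D.sol g X t)
    (hsub.congr hτ (fun _ _ => rfl) fun s hs => ?_) t ht)
  simp only [g, unweight_toWeighted hμ.2 hτ.le hτT (h.memBC_add B) hs, map_sub]
  rw [sub_sub_eq_add_sub, add_comm (N (u s)), sub_add_eq_sub_sub, add_sub_cancel_right, neg_sub]
  rfl

end Sol

theorem SolutionOperator.norm_of_sol_sub_add_weight_le (hμ : μ ∈ Ioo (0 : ℝ) 1)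
    (D : SolutionOperator ι B μ) (g h : weightedSpace D.T E₀) (x y : Interp ι μ)
    (ht : t ∈ Ioc 0 D.T) :
    ‖Interp.of ι hμ (D.sol g x t) - Interp.of ι hμ (D.sol h y t)‖ +
        t ^ (1 - μ) * ‖D.sol g x t - D.sol h y t‖ ≤
      2 * D.bound * (‖g - h‖ + ‖x - y‖) := by
  rw [← Interp.of_sub, ← D.sol_sub, mul_assoc, two_mul]
  exact add_le_add (D.norm_of_sol_le hμ _ _ ht) (D.weight_sol_le hμ.1 _ _ ht.1)

theorem Sol.norm_toWeighted_sub_le (D : SolutionOperator ι B μ) (hκ : 0 ≤ κ)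
    (hκD : κ * (4 * D.bound) ≤ 1) (hτ : 0 < τ) (hτT : τ ≤ D.T)
    (hu : Sol hμ V N x τ u) (hv : Sol hμ V N y τ v)
    (hlip : ∀ t ∈ Ioc 0 τ, t ^ (1 - μ) * ‖(N (u t) + B (u t)) - (N (v t) + B (v t))‖ ≤
      κ * (‖Interp.of ι hμ (u t) - Interp.of ι hμ (v t)‖ + t ^ (1 - μ) * ‖u t - v t‖)) :
    ‖toWeighted hμ.2 hτ.le hτT (hu.memBC_add B) - toWeighted hμ.2 hτ.le hτT (hv.memBC_add B)‖ ≤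
      ‖x - y‖ := by
  set g := toWeighted hμ.2 hτ.le hτT (hu.memBC_add B) with hg
  set h := toWeighted hμ.2 hτ.le hτT (hv.memBC_add B) with hh
  have hself : ‖g - h‖ ≤ (‖g - h‖ + ‖x - y‖) / 2 := by
    conv_lhs => rw [hg, hh, toWeighted_sub]
    refine norm_toWeighted_le hμ.2 hτ.le hτT _ (by positivity) fun t ht => (hlip t ht).trans ?_
    rw [hu.eqOn_sol D hτ hτT ht, hv.eqOn_sol D hτ hτT ht]
    calc _ ≤ κ * (2 * D.bound * (‖g - h‖ + ‖x - y‖)) := mul_le_mul_of_nonneg_left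
          (D.norm_of_sol_sub_add_weight_le hμ g h x y ⟨ht.1, ht.2.trans hτT⟩) hκ
      _ = κ * (4 * D.bound) * ((‖g - h‖ + ‖x - y‖) / 2) := by ring
      _ ≤ (‖g - h‖ + ‖x - y‖) / 2 := mul_le_of_le_one_left (by positivity) hκD
  linarith

theorem Sol.weight_mul_norm_sub_le (D : SolutionOperator ι B μ) (hκ : 0 ≤ κ)
    (hκD : κ * (4 * D.bound) ≤ 1) (hτT : τ ≤ D.T)
    (hu : Sol hμ V N x τ u) (hv : Sol hμ V N y τ v)
    (hlip : ∀ t ∈ Ioc 0 τ, t ^ (1 - μ) * ‖(N (u t) + B (u t)) - (N (v t) + B (v t))‖ ≤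
      κ * (‖Interp.of ι hμ (u t) - Interp.of ι hμ (v t)‖ + t ^ (1 - μ) * ‖u t - v t‖))
    (ht : t ∈ Ioc 0 τ) :
    t ^ (1 - μ) * (‖N (u t) - N (v t)‖ + ‖u t - v t‖) ≤ 4 * D.bound * ‖x - y‖ := by
  have hτ : 0 < τ := ht.1.trans_le ht.2
  have hgh := hu.norm_toWeighted_sub_le D hκ hκD hτ hτT hv hlip
  set g := toWeighted hμ.2 hτ.le hτT (hu.memBC_add B)
  set h := toWeighted hμ.2 hτ.le hτT (hv.memBC_add B)
  have hsol : D.sol (g - h) (x - y) t = u t - v t := by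
    rw [D.sol_sub, ← hu.eqOn_sol D hτ hτT ht, ← hv.eqOn_sol D hτ hτT ht]
  have hderiv : unweight μ (g - h) t - B (u t - v t) = N (u t) - N (v t) := by
    rw [unweight_sub, unweight_toWeighted hμ.2 hτ.le hτT (hu.memBC_add B) ht,
      unweight_toWeighted hμ.2 hτ.le hτT (hv.memBC_add B) ht, map_sub, add_sub_add_comm,
      add_sub_cancel_right]
  have hnorm := D.weight_sol_le hμ.1 (g - h) (x - y) ht.1
  have hnorm_deriv := D.weight_deriv_le hμ.1 (g - h) (x - y) ht.1
  rw [hsol] at hnorm hnorm_deriv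
  rw [hderiv] at hnorm_deriv
  have hdata : D.bound * (‖g - h‖ + ‖x - y‖) ≤ D.bound * (2 * ‖x - y‖) :=
    mul_le_mul_of_nonneg_left (by linarith) (zero_le_one.trans (D.one_le_bound hμ.1))
  rw [mul_add]
  linarith

/- Evaluating `N + B` along the linear solution with data `g`, `x` is a contraction in `g`, and a
fixed point `g = N(u) + B u` makes `u' + B u = g` the equation `u' = N(u)`. -/
theorem SolutionOperator.exists_sol [CompleteSpace E₀] (D : SolutionOperator ι B μ)
    (hN : Admissible hμ V N) (hx : x ∈ V) (hτ : 0 < τ) (hτT : τ ≤ D.T) (hr : 0 ≤ r)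
    (hmem : ∀ g, ‖g‖ ≤ r → ∀ t ∈ Ioc 0 τ, Interp.of ι hμ (D.sol g x t) ∈ V)
    (hle : ∀ g, ‖g‖ ≤ r → ∀ t ∈ Ioc 0 τ,
      t ^ (1 - μ) * ‖N (D.sol g x t) + B (D.sol g x t)‖ ≤ r)
    (hlip : ∀ g, ‖g‖ ≤ r → ∀ h, ‖h‖ ≤ r → ∀ t ∈ Ioc 0 τ,
      t ^ (1 - μ) * ‖(N (D.sol g x t) + B (D.sol g x t)) - (N (D.sol h x t) + B (D.sol h x t))‖ ≤
        ‖g - h‖ / 2) :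
    ∃ g, ‖g‖ ≤ r ∧ Sol hμ V N x τ (D.sol g x) := by
  have hBC : ∀ g, ‖g‖ ≤ r → MemBC μ τ (fun t => N (D.sol g x t) + B (D.sol g x t)) :=
    fun g hg =>
      have hg' := (D.intEq g x).mono hτT
      (hN.memBC hτ hx hg'.memBC (hg'.tendsto_of hμ hτ) (hmem g hg)).add hμ.2
        (hg'.memBC.clm_comp hμ.2 B)
  let S := Metric.closedBall (0 : weightedSpace D.T E₀) r
  have hS : ∀ g : S, ‖g.1‖ ≤ r := fun g => mem_closedBall_zero_iff.1 g.2
  let Ψ : S → S := fun g => ⟨toWeighted hμ.2 hτ.le hτT (hBC g (hS g)),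
    mem_closedBall_zero_iff.2 (norm_toWeighted_le hμ.2 hτ.le hτT _ hr (hle g (hS g)))⟩
  have hΨ : ContractingWith (1 / 2) Ψ := by
    refine ⟨by norm_num, LipschitzWith.of_dist_le_mul fun g h => ?_⟩
    change dist (Ψ g).1 (Ψ h).1 ≤ _ * dist g.1 h.1
    rw [dist_eq_norm, dist_eq_norm, toWeighted_sub]
    refine norm_toWeighted_le hμ.2 hτ.le hτT _ (by positivity) fun t ht =>
      (hlip g (hS g) h (hS h) t ht).trans_eq ?_
    simp only [NNReal.coe_div, NNReal.coe_one, NNReal.coe_ofNat]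
    ring
  have : CompleteSpace S := Metric.isClosed_closedBall.completeSpace_coe
  have : Nonempty S := ⟨⟨0, Metric.mem_closedBall_self hr⟩⟩
  set g := hΨ.fixedPoint Ψ
  have hfix : toWeighted hμ.2 hτ.le hτT (hBC g (hS g)) = g :=
    congrArg Subtype.val hΨ.fixedPoint_isFixedPt
  refine ⟨g, hS g, ((D.intEq g x).mono hτT).congr hτ (fun _ _ => rfl) fun t ht => ?_, hmem g (hS g)⟩
  have hg := unweight_toWeighted hμ.2 hτ.le hτT (hBC g (hS g)) ht
  rw [hfix] at hg
  exact eq_sub_of_add_eq hg.symm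

theorem SolutionOperator.sol_mem_weightedBall (D : SolutionOperator ι B μ)
    (hr : 4 * D.bound * r ≤ d) (ht : t ∈ Ioc 0 D.T)
    (h₀ : D.sol 0 X t ∈ weightedBall hμ X (d / 2) (t ^ (1 - μ))) {g : weightedSpace D.T E₀}
    (hg : ‖g‖ ≤ r) (hx : ‖x - X‖ ≤ r) : D.sol g x t ∈ weightedBall hμ X d (t ^ (1 - μ)) := by
  have hw : 0 ≤ t ^ (1 - μ) := Real.rpow_nonneg ht.1.le _
  have hbound : D.bound * (‖g‖ + ‖x - X‖) ≤ d / 2 := by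
    have : D.bound * (‖g‖ + ‖x - X‖) ≤ D.bound * (r + r) :=
      mul_le_mul_of_nonneg_left (add_le_add hg hx) (zero_le_one.trans (D.one_le_bound hμ.1))
    linarith
  have hsub : D.sol g x t - D.sol 0 X t = D.sol g (x - X) t := by rw [← D.sol_sub, sub_zero]
  have hnorm := D.weight_sol_le hμ.1 g (x - X) ht.1
  have hnorm_of := D.norm_of_sol_le hμ g (x - X) ht
  rw [← hsub] at hnorm hnorm_of
  rw [Interp.of_sub] at hnorm_of
  constructor
  · linarith [h₀.1, norm_sub_le_norm_sub_add_norm_sub (Interp.of ι hμ (D.sol g x t))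
      (Interp.of ι hμ (D.sol 0 X t)) X]
  · have := mul_le_mul_of_nonneg_left (norm_le_insert' (D.sol g x t) (D.sol 0 X t)) hw
    linarith [h₀.2]

/- `y₀` is the value at a fixed time of the linear solution with data `0`, `X`; it serves to bound
the nonlinearity. -/
theorem SolutionOperator.exists_forall_mem_weightedBall (hμ : μ ∈ Ioo (0 : ℝ) 1)
    (D : SolutionOperator ι B μ) (N : E₁ → E₀) (X : Interp ι μ) (hd : 0 < d) (hr : 0 < r) :
    ∃ y₀ : E₁, ∃ τ > 0, ∀ t ∈ Ioc 0 τ, t ∈ Ioc 0 D.T ∧ t ^ (1 - μ) ∈ Ioc 0 d ∧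
      D.sol 0 X t ∈ weightedBall hμ X (d / 2) (t ^ (1 - μ)) ∧
      y₀ ∈ weightedBall hμ X d (t ^ (1 - μ)) ∧ t ^ (1 - μ) * ‖N y₀ + B y₀‖ ≤ r / 2 := by
  have hball := (D.intEq 0 X).memBC.eventually_mem_weightedBall
    ((D.intEq 0 X).tendsto_of hμ D.pos) (half_pos hd)
  obtain ⟨t₀, ht₀, ht₀pos⟩ := (hball.and self_mem_nhdsWithin).exists
  have hsmall : Tendsto (fun t => t ^ (1 - μ) * ‖N (D.sol 0 X t₀) + B (D.sol 0 X t₀)‖)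
      (𝓝[>] 0) (𝓝 0) := by
    simpa only [zero_mul] using (tendsto_rpow_nhdsGT_zero (sub_pos.2 hμ.2)).mul_const _
  refine ⟨D.sol 0 X t₀, exists_forall_mem_Ioc_of_eventually ?_⟩
  filter_upwards [Ioc_mem_nhdsGT D.pos, eventually_rpow_mem_Ioc hμ.2 hd, hball,
    Ioc_mem_nhdsGT ht₀pos, hsmall.eventually_le_const (half_pos hr)] with t htD hw hbt ht hs
  exact ⟨htD, hw, hbt, weightedBall_mono (half_le_self hd.le)
    (Real.rpow_le_rpow ht.1.le ht.2 (sub_pos.2 hμ.2).le) ht₀, hs⟩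

namespace Admissible

variable (hN : Admissible hμ V N)
include hN

theorem exists_sol_mem_weightedBall [CompleteSpace E₀] (D : SolutionOperator ι B μ)
    (hκ : 0 < κ) (hκD : κ * (32 * D.bound) ≤ 1) (hd : 0 < d) (hdV : Metric.closedBall X d ⊆ V)
    (hlip : ∀ w ∈ Ioc 0 d, ∀ y₁ ∈ weightedBall hμ X d w, ∀ y₂ ∈ weightedBall hμ X d w,
      w * ‖(N y₁ + B y₁) - (N y₂ + B y₂)‖ ≤
        κ * (‖Interp.of ι hμ y₁ - Interp.of ι hμ y₂‖ + w * ‖y₁ - y₂‖)) :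
    ∃ τ > 0, τ ≤ D.T ∧ ∃ ε > 0, ∀ x, ‖x - X‖ ≤ ε → x ∈ V ∧ ∃ u, Sol hμ V N x τ u ∧
      ∀ t ∈ Ioc 0 τ, t ^ (1 - μ) ∈ Ioc 0 d ∧ u t ∈ weightedBall hμ X d (t ^ (1 - μ)) := by
  have hM := D.one_le_bound hμ.1
  set r := d / (4 * D.bound)
  have hr : 0 < r := by positivity
  have hrd : 4 * D.bound * r = d := mul_div_cancel₀ d (by positivity)
  obtain ⟨y₀, τ, hτ, hτall⟩ := D.exists_forall_mem_weightedBall hμ N X hd hr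
  have hτT : τ ≤ D.T := (hτall τ ⟨hτ, le_rfl⟩).1.2
  have hball : ∀ x, ‖x - X‖ ≤ r → ∀ g, ‖g‖ ≤ r → ∀ t ∈ Ioc 0 τ,
      D.sol g x t ∈ weightedBall hμ X d (t ^ (1 - μ)) := fun x hx g hg t ht =>
    D.sol_mem_weightedBall hrd.le (hτall t ht).1 (hτall t ht).2.2.1 hg hx
  have hmem : ∀ x, ‖x - X‖ ≤ d → x ∈ V := fun x hx => hdV (mem_closedBall_iff_norm.2 hx)
  refine ⟨τ, hτ, hτT, r, hr, fun x hx => ?_⟩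
  have hxV : x ∈ V := hmem x (hx.trans (by nlinarith))
  have hle : ∀ g, ‖g‖ ≤ r → ∀ t ∈ Ioc 0 τ,
      t ^ (1 - μ) * ‖N (D.sol g x t) + B (D.sol g x t)‖ ≤ r := fun g hg t ht => by
    obtain ⟨-, hw, -, hy₀, hNy₀⟩ := hτall t ht
    have hgt := hball x hx g hg t ht
    have := weight_mul_norm_le_of_mem_weightedBall (G := fun y => N y + B y) hκ.le hw.1.le
      hgt hy₀ (hlip _ hw _ hgt _ hy₀)
    nlinarith
  have hcontr : ∀ g, ‖g‖ ≤ r → ∀ h, ‖h‖ ≤ r → ∀ t ∈ Ioc 0 τ, t ^ (1 - μ) *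
      ‖(N (D.sol g x t) + B (D.sol g x t)) - (N (D.sol h x t) + B (D.sol h x t))‖ ≤
        ‖g - h‖ / 2 := fun g hg h hh t ht => by
    obtain ⟨htD, hw, -⟩ := hτall t ht
    refine (hlip _ hw _ (hball x hx g hg t ht) _ (hball x hx h hh t ht)).trans
      ((mul_le_mul_of_nonneg_left (D.norm_of_sol_sub_add_weight_le hμ g h x x htD) hκ.le).trans ?_)
    rw [sub_self, norm_zero, add_zero]
    nlinarith [norm_nonneg (g - h)]
  obtain ⟨g, hg, hsol⟩ := D.exists_sol hN hxV hτ hτT hr.le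
    (fun g hg t ht => hmem _ (hball x hx g hg t ht).1) hle hcontr
  exact ⟨hxV, _, hsol, fun t ht => ⟨(hτall t ht).2.1, hball x hx g hg t ht⟩⟩

variable [CompleteSpace E₀] [CompleteSpace E₁]

theorem exists_sol (hX : X ∈ V) :
    ∃ τ > 0, ∃ ε > 0, ∃ σ > 0, ∃ u : Interp ι μ → ℝ → E₁,
      (∀ x, ‖x - X‖ ≤ ε → x ∈ V ∧ Sol hμ V N x τ (u x)) ∧
      ∀ x₁, ‖x₁ - X‖ ≤ ε → ∀ x₂, ‖x₂ - X‖ ≤ ε → ∀ t ∈ Ioc 0 τ,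
        t ^ (1 - μ) * (‖N (u x₁ t) - N (u x₂ t)‖ + ‖u x₁ t - u x₂ t‖) ≤ σ * ‖x₁ - x₂‖ := by
  obtain ⟨B, hB, hlip⟩ := hN X hX
  obtain ⟨D⟩ := nonempty_solutionOperator hμ hB
  have hM := D.one_le_bound hμ.1
  have hκ : 0 < 1 / (32 * D.bound) := by positivity
  have hκD : 1 / (32 * D.bound) * (32 * D.bound) = 1 := one_div_mul_cancel (by positivity)
  obtain ⟨d, hd, hdV, hlip⟩ := hlip (1 / (32 * D.bound)) hκ
  obtain ⟨τ, hτ, hτT, ε, hε, hsol⟩ :=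
    hN.exists_sol_mem_weightedBall D hκ hκD.le hd hdV hlip
  choose! hV u hu hball using hsol
  refine ⟨τ, hτ, ε, hε, 4 * D.bound, by positivity, u, fun x hx => ⟨hV x hx, hu x hx⟩,
    fun x₁ h₁ x₂ h₂ t ht => (hu x₁ h₁).weight_mul_norm_sub_le D hκ.le ?_ hτT (hu x₂ h₂)
      (fun s hs => hlip _ (hball x₁ h₁ s hs).1 _ (hball x₁ h₁ s hs).2 _ (hball x₂ h₂ s hs).2) ht⟩
  exact (mul_le_mul_of_nonneg_left (by linarith) hκ.le).trans_eq hκD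

theorem exists_eqOn (hX : X ∈ V) (hT : 0 < T) (hu : Sol hμ V N X T u) (hv : Sol hμ V N X T v) :
    ∃ τ > 0, EqOn u v (Ioc 0 τ) := by
  obtain ⟨B, hB, hlip⟩ := hN X hX
  obtain ⟨D⟩ := nonempty_solutionOperator hμ hB
  have hM := D.one_le_bound hμ.1
  have hκ : 0 < 1 / (4 * D.bound) := by positivity
  obtain ⟨d, hd, -, hlip⟩ := hlip (1 / (4 * D.bound)) hκ
  have hball : ∀ w, Sol hμ V N X T w → ∀ᶠ t in 𝓝[>] (0 : ℝ),
      w t ∈ weightedBall hμ X d (t ^ (1 - μ)) := fun w hw =>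
    hw.intEq.memBC.eventually_mem_weightedBall (hw.intEq.tendsto_of hμ hT) hd
  obtain ⟨τ, hτ, hall⟩ := exists_forall_mem_Ioc_of_eventually
    (Eventually.and (Ioc_mem_nhdsGT (lt_min hT D.pos))
      ((eventually_rpow_mem_Ioc hμ.2 hd).and ((hball u hu).and (hball v hv))))
  have hτmin : τ ≤ min T D.T := (hall τ ⟨hτ, le_rfl⟩).1.2
  refine ⟨τ, hτ, fun t ht => ?_⟩
  have hle := (hu.mono (hτmin.trans (min_le_left _ _))).weight_mul_norm_sub_le D hκ.le
    (one_div_mul_cancel (by positivity)).le (hτmin.trans (min_le_right _ _))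
    (hv.mono (hτmin.trans (min_le_left _ _)))
    (fun s hs => hlip _ (hall s hs).2.1 _ (hall s hs).2.2.1 _ (hall s hs).2.2.2) ht
  rw [sub_self, norm_zero, mul_zero] at hle
  have hsum := nonpos_of_mul_nonpos_right hle (Real.rpow_pos_of_pos ht.1 _)
  exact sub_eq_zero.1 (norm_le_zero_iff.1 (by linarith [norm_nonneg (N (u t) - N (v t))]))

theorem eqOn (hX : X ∈ V) (hu : Sol hμ V N X T u) (hv : Sol hμ V N X T v) :
    EqOn u v (Ioc 0 T) := by
  intro t ht
  obtain ⟨τ, hτ, hτuv⟩ := hN.exists_eqOn hX (ht.1.trans_le ht.2) hu hv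
  rcases le_or_gt t τ with htτ | htτ
  · exact hτuv ⟨ht.1, htτ⟩
  have hsub : Icc τ T ⊆ Ioc 0 T := fun s hs => ⟨hτ.trans_le hs.1, hs.2⟩
  have hclosed : IsClosed ({s | u s = v s} ∩ Icc τ T) := by
    have := ((hu.intEq.memBC.1.mono hsub).sub
      (hv.intEq.memBC.1.mono hsub)).preimage_isClosed_of_isClosed isClosed_Icc
        (isClosed_singleton (x := (0 : E₁)))
    rw [inter_comm] at this
    convert this using 2
    ext s
    exact sub_eq_zero.symm
  refine hclosed.Icc_subset_of_forall_exists_gt (hτuv ⟨hτ, le_rfl⟩)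
    (fun s ⟨hsuv, hτs, hsT⟩ y hy => ?_) ⟨htτ.le, ht.2⟩
  have hs : 0 < s := hτ.trans_le hτs
  have hvs := hv.shift hs hsT
  rw [← show u s = v s from hsuv] at hvs
  obtain ⟨e, he, heq⟩ := hN.exists_eqOn (hu.mem s ⟨hs, hsT.le⟩) (sub_pos.2 hsT)
    (hu.shift hs hsT) hvs
  have hpos : 0 < min e (y - s) := lt_min he (sub_pos.2 hy)
  exact ⟨s + min e (y - s), heq ⟨hpos, min_le_left _ _⟩, lt_add_of_pos_right s hpos,
    by linarith [min_le_right e (y - s)]⟩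

end Admissible

end Solutions

section Maximal

variable {E₀ E₁ : Type*} [NormedAddCommGroup E₀] [NormedSpace ℝ E₀]
  [NormedAddCommGroup E₁] [NormedSpace ℝ E₁] {ι : E₁ →L[ℝ] E₀} {μ : ℝ}
  {hμ : μ ∈ Ioo (0 : ℝ) 1} {V : Set (Interp ι μ)} {N : E₁ → E₀} {X Y : Interp ι μ} {a b t T τ : ℝ}
  {tp : EReal} {u v : ℝ → E₁}

/-- `u` is the maximal solution of `u' = N(u)`, `u(0) = X`, the equation being taken in its
integrated form, and `[0, tp)` is its interval of existence. -/
structure IsMaxSol (hμ : μ ∈ Ioo (0 : ℝ) 1) (V : Set (Interp ι μ)) (N : E₁ → E₀) (X : Interp ι μ)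
    (tp : EReal) (u : ℝ → E₁) : Prop where
  pos : 0 < tp
  sol : ∀ T : ℝ, 0 < T → (T : EReal) < tp → Sol hμ V N X T u
  maximal : ∀ (T : ℝ) (v : ℝ → E₁), 0 < T → Sol hμ V N X T v →
    (T : EReal) < tp ∧ EqOn v u (Ioc 0 T)

namespace Admissible

variable [CompleteSpace E₀] [CompleteSpace E₁] (hN : Admissible hμ V N)
include hN

theorem exists_extend (hu : Sol hμ V N X T u) (ha : 0 < a) (haT : a < T)
    (hv : Sol hμ V N (Interp.of ι hμ (u a)) τ v) : ∃ w, Sol hμ V N X (a + τ) w := by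
  rcases le_total (a + τ) T with h | h
  · exact ⟨u, hu.mono h⟩
  · exact ⟨_, hu.glue ha haT hv <| hN.eqOn (hu.mem a ⟨ha, haT.le⟩)
      (hv.mono (sub_le_iff_le_add'.2 h)) (hu.shift ha haT)⟩

theorem exists_uniform_extend (hY : Y ∈ V) :
    ∃ τ > 0, ∃ ε > 0, ∀ (X : Interp ι μ) (T : ℝ) (u : ℝ → E₁), Sol hμ V N X T u →
      ∀ a, 0 < a → a < T → Interp.of ι hμ (u a) ∈ Metric.closedBall Y ε →
        ∃ w, Sol hμ V N X (a + τ) w := by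
  obtain ⟨τ, hτ, ε, hε, -, -, w, hw, -⟩ := hN.exists_sol hY
  exact ⟨τ, hτ, ε, hε, fun X T u hu a ha haT h =>
    hN.exists_extend hu ha haT (hw _ (mem_closedBall_iff_norm.1 h)).2⟩

theorem exists_gt (hT : 0 < T) (hu : Sol hμ V N X T u) : ∃ T' > T, ∃ w, Sol hμ V N X T' w := by
  have hTm : T ∈ Ioc 0 T := ⟨hT, le_rfl⟩
  obtain ⟨τ, hτ, ε, hε, hext⟩ := hN.exists_uniform_extend (hu.mem T hTm)
  have hlim : Tendsto (fun t => Interp.of ι hμ (u t)) (𝓝[<] T) (𝓝 (Interp.of ι hμ (u T))) := by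
    rw [← nhdsWithin_Ioo_eq_nhdsLT hT]
    exact ((Interp.ofL ι hμ).continuous.tendsto _).comp
      ((hu.intEq.memBC.1 T hTm).mono Ioo_subset_Ioc_self)
  obtain ⟨a, haT, ha⟩ := (Eventually.and
    (Ioo_mem_nhdsLT (max_lt hT (sub_lt_self T hτ)))
    (hlim.eventually (Metric.closedBall_mem_nhds _ hε))).exists
  obtain ⟨ha0, haτ⟩ := max_lt_iff.1 haT.1
  exact ⟨a + τ, sub_lt_iff_lt_add.1 haτ, hext X T u hu a ha0 haT.2 ha⟩

theorem exists_isMaxSol (hX : X ∈ V) : ∃ tp u, IsMaxSol hμ V N X tp u := by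
  classical
  let S : Set ℝ := {T | 0 < T ∧ ∃ v, Sol hμ V N X T v}
  let u : ℝ → E₁ := fun t => if h : ∃ v, Sol hμ V N X t v then h.choose t else 0
  have hu : ∀ T v, Sol hμ V N X T v → EqOn v u (Ioc 0 T) := fun T v hv t ht => by
    have h : ∃ v, Sol hμ V N X t v := ⟨v, hv.mono ht.2⟩
    simp only [u, dif_pos h]
    exact hN.eqOn hX (hv.mono ht.2) h.choose_spec ⟨ht.1, le_rfl⟩
  refine ⟨sSup ((↑) '' S : Set EReal), u, ?_, fun T hT hTt => ?_,
    fun T v hT hv => ⟨?_, hu T v hv⟩⟩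
  · obtain ⟨τ, hτ, ε, hε, -, -, w, hw, -⟩ := hN.exists_sol hX
    have hXε : ‖X - X‖ ≤ ε := by rw [sub_self, norm_zero]; exact hε.le
    exact lt_sSup_iff.2 ⟨_, ⟨τ, ⟨hτ, _, (hw X hXε).2⟩, rfl⟩, EReal.coe_pos.2 hτ⟩
  · obtain ⟨_, ⟨T', ⟨-, v, hv⟩, rfl⟩, hlt⟩ := lt_sSup_iff.1 hTt
    have hvT := hv.mono (EReal.coe_lt_coe_iff.1 hlt).le
    exact hvT.congr hT (hu T v hvT).symm
  · obtain ⟨T', hT', w, hw⟩ := hN.exists_gt hT hv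
    exact lt_sSup_iff.2 ⟨_, ⟨T', ⟨hT.trans hT', w, hw⟩, rfl⟩, EReal.coe_lt_coe_iff.2 hT'⟩

end Admissible

theorem orbit_of_pos (hμ : μ ∈ Ioo (0 : ℝ) 1) (X : Interp ι μ) (u : ℝ → E₁) (ht : 0 < t) :
    orbit ι hμ X u t = Interp.of ι hμ (u t) :=
  if_pos ht

theorem orbit_zero (hμ : μ ∈ Ioo (0 : ℝ) 1) (X : Interp ι μ) (u : ℝ → E₁) :
    orbit ι hμ X u 0 = X :=
  if_neg (lt_irrefl 0)

theorem Sol.continuousOn_orbit (h : Sol hμ V N X T u) (hT : 0 < T) :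
    ContinuousOn (orbit ι hμ X u) (Icc 0 T) := by
  have hpos : EqOn (orbit ι hμ X u) (fun t => Interp.of ι hμ (u t)) (Ioc 0 T) :=
    fun t ht => orbit_of_pos hμ X u ht.1
  intro t ht
  rcases eq_or_lt_of_le ht.1 with rfl | h0
  · rw [← Ioc_insert_left hT.le, continuousWithinAt_insert_self, ContinuousWithinAt,
      nhdsWithin_Ioc_eq_nhdsGT hT, orbit_zero]
    refine (h.intEq.tendsto_of hμ hT).congr' ?_
    filter_upwards [Ioc_mem_nhdsGT hT] with s hs using (hpos hs).symm
  · have hu : ContinuousWithinAt (orbit ι hμ X u) (Ioc 0 T) t :=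
      (((Interp.ofL ι hμ).continuous.comp_continuousOn h.intEq.memBC.1).congr hpos) t ⟨h0, ht.2⟩
    exact hu.mono_of_mem_nhdsWithin
      (mem_of_superset (inter_mem_nhdsWithin _ (Ioi_mem_nhds h0)) fun s hs => ⟨hs.2, hs.1.2⟩)

namespace IsMaxSol

theorem continuousOn (h : IsMaxSol hμ V N X tp u) :
    ContinuousOn u {t : ℝ | 0 < t ∧ (t : EReal) < tp} := by
  intro t ht
  obtain ⟨T, htT, hT⟩ := EReal.lt_iff_exists_real_btwn.1 ht.2
  have htT' : t < T := EReal.coe_lt_coe_iff.1 htT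
  exact ((h.sol T (ht.1.trans htT') hT).intEq.memBC.1.continuousAt
    (Ioc_mem_nhds ht.1 htT')).continuousWithinAt

theorem continuousOn_orbit (h : IsMaxSol hμ V N X tp u) :
    ContinuousOn (orbit ι hμ X u) {t : ℝ | 0 ≤ t ∧ (t : EReal) < tp} := by
  intro t ht
  obtain ⟨T, htT, hT⟩ := EReal.lt_iff_exists_real_btwn.1 ht.2
  have htT' : t < T := EReal.coe_lt_coe_iff.1 htT
  refine ((h.sol T (ht.1.trans_lt htT') hT).continuousOn_orbit (ht.1.trans_lt htT') t
    ⟨ht.1, htT'.le⟩).mono_of_mem_nhdsWithin ?_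
  exact mem_of_superset (inter_mem_nhdsWithin _ (Iio_mem_nhds htT')) fun s hs =>
    ⟨hs.1.1, (mem_Iio.1 hs.2).le⟩

theorem mem (h : IsMaxSol hμ V N X tp u) (ht : 0 < t) (htp : (t : EReal) < tp) :
    Interp.of ι hμ (u t) ∈ V :=
  (h.sol t ht htp).mem t ⟨ht, le_rfl⟩

theorem not_mapClusterPt [CompleteSpace E₀] [CompleteSpace E₁] (h : IsMaxSol hμ V N X b u)
    (hN : Admissible hμ V N) (hY : Y ∈ V) :
    ¬ MapClusterPt Y (𝓝[<] b) (fun t => Interp.of ι hμ (u t)) := by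
  intro hcl
  have hb : 0 < b := EReal.coe_pos.1 h.pos
  obtain ⟨τ, hτ, ε, hε, hext⟩ := hN.exists_uniform_extend hY
  obtain ⟨t, htY, htb⟩ := ((hcl.frequently (Metric.closedBall_mem_nhds Y hε)).and_eventually
    (Ioo_mem_nhdsLT (max_lt hb (sub_lt_self b hτ)))).exists
  obtain ⟨ht0, htτ⟩ := max_lt_iff.1 htb.1
  obtain ⟨T, htT, hTb⟩ := exists_between htb.2
  obtain ⟨w, hw⟩ := hext X T u
    (h.sol T (ht0.trans htT) (EReal.coe_lt_coe_iff.2 hTb)) t ht0 htT htY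
  have hlt := EReal.coe_lt_coe_iff.1 (h.maximal (t + τ) w (by linarith) hw).1
  linarith

theorem mem_of_mapClusterPt (h : IsMaxSol hμ V N X b u) (hV : IsOpen V)
    (haway : AwayFromBoundary ι hμ V X b u)
    (hcl : MapClusterPt Y (𝓝[<] b) (fun t => Interp.of ι hμ (u t))) : Y ∈ V := by
  have hev : ∀ᶠ t in 𝓝[<] b, t ∈ Ioo 0 b := Ioo_mem_nhdsLT (EReal.coe_pos.1 h.pos)
  have hclosure : Y ∈ closure V := mem_closure_iff_clusterPt.2 <| ClusterPt.mono hcl <|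
    tendsto_principal.2 <| hev.mono fun t ht => h.mem ht.1 (EReal.coe_lt_coe_iff.2 ht.2)
  by_contra hYV
  have hfrontier : Y ∈ frontier V := by
    rw [hV.frontier_eq]
    exact ⟨hclosure, hYV⟩
  obtain ⟨η, hη, hdist⟩ := haway
  obtain ⟨t, htY, ht⟩ :=
    ((hcl.frequently (Metric.closedBall_mem_nhds Y hη)).and_eventually hev).exists
  have hlt := hdist t ht.1.le (EReal.coe_lt_coe_iff.2 ht.2)
  rw [orbit_of_pos hμ X u ht.1] at hlt
  refine hlt.not_ge ((Metric.infEDist_le_edist_of_mem hfrontier).trans ?_)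
  rw [edist_dist]
  exact ENNReal.ofReal_le_ofReal htY

theorem eq_top [CompleteSpace E₀] [CompleteSpace E₁] (h : IsMaxSol hμ V N X tp u)
    (hV : IsOpen V) (hN : Admissible hμ V N) (haway : AwayFromBoundary ι hμ V X tp u)
    (hcl : ∀ b : ℝ, tp = b → ∃ Y, MapClusterPt Y (𝓝[<] b) (fun t => Interp.of ι hμ (u t))) :
    tp = ⊤ := by
  induction tp with
  | bot => exact absurd h.pos not_lt_bot
  | top => rfl
  | coe b =>
    obtain ⟨Y, hY⟩ := hcl b rfl
    exact absurd hY (h.not_mapClusterPt hN (h.mem_of_mapClusterPt hV haway hY))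

end IsMaxSol

end Maximal

section Compactness

variable {E₀ E₁ : Type*} [NormedAddCommGroup E₀] [NormedSpace ℝ E₀]
  [NormedAddCommGroup E₁] [NormedSpace ℝ E₁] {ι : E₁ →L[ℝ] E₀} {μ δ C t : ℝ}

theorem kFun_le_of_scaleNorm_le (hδ : δ ∈ Ioc (0 : ℝ) 1) {y : E₁} (hy : scaleNorm ι δ y ≤ C)
    (ht : 0 < t) : kFun ι t (ι y) ≤ t ^ δ * C := by
  rw [scaleNorm] at hy
  split_ifs at hy with h
  · rw [h, Real.rpow_one]
    exact (kFun_map_le ι ht y).trans (mul_le_mul_of_nonneg_left hy ht.le)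
  · exact ((Interp.of ι ⟨hδ.1, lt_of_le_of_ne hδ.2 h⟩ y).kFun_val_le ht).trans
      (mul_le_mul_of_nonneg_left hy (Real.rpow_nonneg ht.le _))

/- Up to `ε / 2` the points of `ι '' S` lie in the image of a ball of `E₁`. -/
theorem totallyBounded_image_of_kFun_le (hι : IsCompactOperator ι) (hδ : 0 < δ) {S : Set E₁}
    (hS : ∀ y ∈ S, ∀ t > 0, kFun ι t (ι y) ≤ t ^ δ * C) : TotallyBounded (ι '' S) := by
  refine Metric.totallyBounded_iff.2 fun ε hε => ?_
  have hlim : Tendsto (fun t : ℝ => t ^ δ * C) (𝓝[>] 0) (𝓝 0) := by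
    simpa only [zero_mul] using (tendsto_rpow_nhdsGT_zero hδ).mul_const C
  obtain ⟨t, htC, ht : 0 < t⟩ :=
    ((hlim.eventually_lt_const (half_pos hε)).and self_mem_nhdsWithin).exists
  obtain ⟨s, hs, hcover⟩ := Metric.totallyBounded_iff.1
    ((hι.isCompact_closure_image_closedBall (ε / 2 / t)).totallyBounded.subset subset_closure)
    (ε / 2) (half_pos hε)
  refine ⟨s, hs, ?_⟩
  rintro _ ⟨y, hy, rfl⟩
  obtain ⟨b, hb⟩ := exists_lt_of_ciInf_lt ((hS y hy t ht).trans_lt htC)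
  have hbt : ‖b‖ ≤ ε / 2 / t := by
    rw [le_div_iff₀' ht]
    linarith [norm_nonneg (ι y - ι b)]
  have hdist : dist (ι y) (ι b) < ε / 2 := by
    rw [dist_eq_norm]
    linarith [mul_nonneg ht.le (norm_nonneg b)]
  obtain ⟨z, hz, hzb⟩ := mem_iUnion₂.1 (hcover ⟨b, mem_closedBall_zero_iff.2 hbt, rfl⟩)
  exact mem_iUnion₂.2 ⟨z, hz, (dist_triangle _ (ι b) z).trans_lt
    ((add_lt_add hdist hzb).trans_eq (add_halves ε))⟩

theorem norm_of_sub_of_le_rpow_mul_rpow (hμ : μ ∈ Ioo (0 : ℝ) 1) (hδ : μ ≤ δ) {y z : E₁}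
    (hy : ∀ t > 0, kFun ι t (ι y) ≤ t ^ δ * C) (hz : ∀ t > 0, kFun ι t (ι z) ≤ t ^ δ * C) :
    ‖Interp.of ι hμ y - Interp.of ι hμ z‖ ≤
      ‖ι y - ι z‖ ^ (1 - μ / δ) * (2 * C) ^ (μ / δ) := by
  have hδ0 : 0 < δ := hμ.1.trans_le hδ
  have hC : 0 ≤ C := by
    simpa using (kFun_nonneg ι one_pos (ι y)).trans (hy 1 one_pos)
  refine Interp.norm_le_of_kFun_le fun t ht => ?_
  have h₀ : kFun ι t (ι y - ι z) ≤ t ^ (0 : ℝ) * ‖ι y - ι z‖ := by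
    rw [Real.rpow_zero, one_mul]
    exact kFun_le_norm ι ht _
  have h₁ : kFun ι t (ι y - ι z) ≤ t ^ δ * (2 * C) := by
    have hadd := kFun_add ι ht (ι y) (0 - ι z)
    have hneg := kFun_sub_le_kFun_sub ι ht 0 (ι z)
    rw [zero_sub, ← sub_eq_add_neg] at hadd
    rw [zero_sub, sub_zero] at hneg
    linarith [hy t ht, hz t ht]
  have hinterp := kFun_le_rpow_interpolate ht (norm_nonneg _) (mul_nonneg zero_le_two hC)
    ⟨div_nonneg hμ.1.le hδ0.le, (div_le_one hδ0).2 hδ⟩ h₀ h₁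
  rwa [mul_zero, zero_add, div_mul_cancel₀ _ hδ0.ne'] at hinterp

theorem cauchySeq_of_of_kFun_le (hμ : μ ∈ Ioo (0 : ℝ) 1) (hδ : μ < δ) {y : ℕ → E₁}
    (hy : ∀ n, ∀ t > 0, kFun ι t (ι (y n)) ≤ t ^ δ * C) (hcau : CauchySeq fun n => ι (y n)) :
    CauchySeq fun n => Interp.of ι hμ (y n) := by
  have hγ : 0 < 1 - μ / δ := sub_pos.2 ((div_lt_one (hμ.1.trans hδ)).2 hδ)
  rw [cauchySeq_iff_tendsto_dist_atTop_0] at hcau ⊢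
  have hpow := (hcau.rpow_const (Or.inr hγ.le)).mul_const ((2 * C) ^ (μ / δ))
  rw [Real.zero_rpow hγ.ne', zero_mul] at hpow
  refine squeeze_zero (fun _ => dist_nonneg) (fun p => ?_) hpow
  rw [dist_eq_norm, dist_eq_norm]
  exact norm_of_sub_of_le_rpow_mul_rpow hμ hδ.le (hy p.1) (hy p.2)

theorem exists_subseq_tendsto_of_kFun_le [CompleteSpace E₀] (hι : IsCompactOperator ι)
    (hμ : μ ∈ Ioo (0 : ℝ) 1) (hδ : μ < δ) {y : ℕ → E₁}
    (hy : ∀ n, ∀ t > 0, kFun ι t (ι (y n)) ≤ t ^ δ * C) :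
    ∃ (Y : Interp ι μ) (φ : ℕ → ℕ), StrictMono φ ∧
      Tendsto (fun n => Interp.of ι hμ (y (φ n))) atTop (𝓝 Y) := by
  have hcomp : IsCompact (closure (ι '' range y)) :=
    (totallyBounded_image_of_kFun_le hι (hμ.1.trans hδ)
      (forall_mem_range.2 hy)).closure.isCompact_of_isClosed isClosed_closure
  obtain ⟨z, -, φ, hφ, hz⟩ := hcomp.tendsto_subseq (x := fun n => ι (y n)) fun n =>
    subset_closure (mem_image_of_mem ι (mem_range_self n))
  obtain ⟨Y, hY⟩ := cauchySeq_tendsto_of_complete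
    (cauchySeq_of_of_kFun_le hμ hδ (fun n => hy (φ n)) hz.cauchySeq)
  exact ⟨Y, φ, hφ, hY⟩

end Compactness

section Equation

variable {E₀ E₁ : Type*} [NormedAddCommGroup E₀] [NormedSpace ℝ E₀]
  [NormedAddCommGroup E₁] [NormedSpace ℝ E₁] {ι : E₁ →L[ℝ] E₀} {μ b T τ C : ℝ}
  {hμ : μ ∈ Ioo (0 : ℝ) 1} {V : Set (Interp ι μ)} {N : E₁ → E₀} {X X₁ X₂ : Interp ι μ}
  {tp : EReal} {u u₁ u₂ : ℝ → E₁}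

theorem isSolution_iff [CompleteSpace E₀] {A : Interp ι μ → E₁ →L[ℝ] E₀} {F₁ F₂ : Interp ι μ → E₀}
    (hT : 0 < T) :
    IsSolution ι hμ V A F₁ F₂ X T u ↔ X ∈ V ∧ Sol hμ V (rhs hμ A F₁ F₂) X T u := by
  constructor
  · rintro ⟨hu, hX, htrace, heq⟩
    exact ⟨hX, IntEq.of_memE1 hμ hT hu htrace fun t ht => eq_sub_of_add_eq (heq t ht).2,
      fun t ht => (heq t ht).1⟩
  · rintro ⟨hX, hu⟩
    refine ⟨hu.intEq.memE1 hμ hT, hX, hu.intEq.hasTrace hμ hT, fun t ht => ⟨hu.mem t ht, ?_⟩⟩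
    rw [hu.intEq.dt_eq hμ ht]
    exact sub_add_cancel _ _

theorem isMaximalSolution_iff [CompleteSpace E₀] {A : Interp ι μ → E₁ →L[ℝ] E₀}
    {F₁ F₂ : Interp ι μ → E₀} (hX : X ∈ V) :
    IsMaximalSolution ι hμ V A F₁ F₂ X tp u ↔ IsMaxSol hμ V (rhs hμ A F₁ F₂) X tp u := by
  have hiff : ∀ T v, 0 < T →
      (IsSolution ι hμ V A F₁ F₂ X T v ↔ Sol hμ V (rhs hμ A F₁ F₂) X T v) :=
    fun T v hT => (isSolution_iff hT).trans (and_iff_right hX)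
  exact ⟨fun ⟨hpos, hsol, hmax⟩ => ⟨hpos, fun T hT hTt => (hiff T u hT).1 (hsol T hT hTt),
      fun T v hT hv => hmax T v hT ((hiff T v hT).2 hv)⟩,
    fun h => ⟨h.pos, fun T hT hTt => (hiff T u hT).2 (h.sol T hT hTt),
      fun T v hT hv => h.maximal T v hT ((hiff T v hT).1 hv)⟩⟩

theorem normE1_sub_le [CompleteSpace E₀] (hT : 0 < T) (h₁ : Sol hμ V N X₁ T u₁)
    (h₂ : Sol hμ V N X₂ T u₂)
    (h : ∀ t ∈ Ioc 0 T, t ^ (1 - μ) * (‖N (u₁ t) - N (u₂ t)‖ + ‖u₁ t - u₂ t‖) ≤ C) :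
    normE1 ι μ T (u₁ - u₂) ≤ C := by
  have : Nonempty (Ioc 0 T) := ⟨⟨T, hT, le_rfl⟩⟩
  refine ciSup_le fun t => ?_
  have hdt : dt ι T (u₁ - u₂) t = N (u₁ t) - N (u₂ t) := (h₁.intEq.sub hμ h₂.intEq).dt_eq hμ t.2
  rw [hdt]
  exact h t t.2

theorem IsMaxSol.exists_mapClusterPt_of_uniformContinuousOn [CompleteSpace E₀]
    (h : IsMaxSol hμ V N X b u)
    (hu : UniformContinuousOn (orbit ι hμ X u) {t : ℝ | 0 ≤ t ∧ (t : EReal) < b}) :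
    ∃ Y, MapClusterPt Y (𝓝[<] b) (fun t => Interp.of ι hμ (u t)) := by
  have hev : ∀ᶠ t in 𝓝[<] b, t ∈ Ioo 0 b := Ioo_mem_nhdsLT (EReal.coe_pos.1 h.pos)
  have hmem : {t : ℝ | 0 ≤ t ∧ (t : EReal) < b} ∈ 𝓝[<] b :=
    hev.mono fun t ht => ⟨ht.1.le, EReal.coe_lt_coe_iff.2 ht.2⟩
  obtain ⟨Y, hY⟩ := CompleteSpace.complete
    ((cauchy_nhds.mono nhdsWithin_le_nhds : Cauchy (𝓝[<] b)).map_of_le hu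
      (le_principal_iff.2 hmem))
  have hlim : Tendsto (orbit ι hμ X u) (𝓝[<] b) (𝓝 Y) := hY
  exact ⟨Y, (hlim.congr' (hev.mono fun t ht => orbit_of_pos hμ X u ht.1)).mapClusterPt⟩

theorem exists_mapClusterPt_of_scaleNorm_le [CompleteSpace E₀] (hι : IsCompactOperator ι)
    (hμ : μ ∈ Ioo (0 : ℝ) 1) {δ : ℝ} (hδ : δ ∈ Ioc μ 1) (hτ : τ < b)
    (hu : ∀ t ∈ Ico τ b, scaleNorm ι δ (u t) ≤ C) :
    ∃ Y, MapClusterPt Y (𝓝[<] b) (fun t => Interp.of ι hμ (u t)) := by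
  obtain ⟨s, -, hs, hsb⟩ := exists_seq_strictMono_tendsto' hτ
  obtain ⟨Y, φ, hφ, hY⟩ := exists_subseq_tendsto_of_kFun_le hι hμ hδ.1
    (y := fun n => u (s n)) fun n t ht => kFun_le_of_scaleNorm_le
      ⟨hμ.1.trans hδ.1, hδ.2⟩ (hu (s n) ⟨(hs n).1.le, (hs n).2⟩) ht
  have hsφ : Tendsto (s ∘ φ) atTop (𝓝[<] b) := tendsto_nhdsWithin_iff.2
    ⟨hsb.comp hφ.tendsto_atTop, Eventually.of_forall fun n => (hs (φ n)).2⟩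
  exact ⟨Y, hY.mapClusterPt.of_comp hsφ⟩

variable [CompleteSpace E₀] [CompleteSpace E₁] (hN : Admissible hμ V N)
include hN

theorem IsMaxSol.eq_top_of_uniformContinuousOn (h : IsMaxSol hμ V N X tp u) (hV : IsOpen V)
    (haway : AwayFromBoundary ι hμ V X tp u)
    (hu : UniformContinuousOn (orbit ι hμ X u) {t : ℝ | 0 ≤ t ∧ (t : EReal) < tp}) : tp = ⊤ := by
  refine h.eq_top hV hN haway ?_
  rintro b rfl
  exact h.exists_mapClusterPt_of_uniformContinuousOn hu

theorem IsMaxSol.eq_top_of_isCompactOperator (h : IsMaxSol hμ V N X tp u) (hV : IsOpen V)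
    (haway : AwayFromBoundary ι hμ V X tp u) (hι : IsCompactOperator ι) {δ : ℝ} (hδ : δ ∈ Ioc μ 1)
    (hτ : (τ : EReal) < tp)
    (hu : ∀ t : ℝ, τ ≤ t → (t : EReal) < tp → scaleNorm ι δ (u t) ≤ C) : tp = ⊤ := by
  refine h.eq_top hV hN haway ?_
  rintro b rfl
  exact exists_mapClusterPt_of_scaleNorm_le hι hμ hδ (EReal.coe_lt_coe_iff.1 hτ)
    fun t ht => hu t ht.1 (EReal.coe_lt_coe_iff.2 ht.2)

end Equation

end QuasiPar

end

theorem theorem2p2_general {E₀ E₁ : Type*}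
    [NormedAddCommGroup E₀] [NormedSpace ℝ E₀] [CompleteSpace E₀]
    [NormedAddCommGroup E₁] [NormedSpace ℝ E₁] [CompleteSpace E₁]
    (ι : E₁ →L[ℝ] E₀)
    (μ : ℝ) (hμ : μ ∈ Set.Ioo (0 : ℝ) 1)
    (V : Set (QuasiPar.Interp ι μ)) (hV : IsOpen V)
    (A : QuasiPar.Interp ι μ → E₁ →L[ℝ] E₀) (F₁ F₂ : QuasiPar.Interp ι μ → E₀)
    (h1 : QuasiPar.H1 ι V A F₁) (h2 : QuasiPar.H2 ι V F₂) :
    (∀ x₀ ∈ V, ∃ τ > 0, ∃ ε > 0, ∃ σ > 0, ∃ u : QuasiPar.Interp ι μ → ℝ → E₁,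
      (∀ x ∈ Metric.closedBall x₀ ε,
        QuasiPar.IsSolution ι hμ V A F₁ F₂ x τ (u x) ∧
        ∀ v : ℝ → E₁, QuasiPar.IsSolution ι hμ V A F₁ F₂ x τ v →
          Set.EqOn v (u x) (Set.Ioc 0 τ)) ∧
      ∀ x₁ ∈ Metric.closedBall x₀ ε, ∀ x₂ ∈ Metric.closedBall x₀ ε,
        QuasiPar.normE1 ι μ τ (u x₁ - u x₂) ≤ σ * ‖x₁ - x₂‖) ∧
    (∀ x₀ ∈ V, ∃ (tp : EReal) (u : ℝ → E₁),
      QuasiPar.IsMaximalSolution ι hμ V A F₁ F₂ x₀ tp u ∧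
      ContinuousOn (QuasiPar.orbit ι hμ x₀ u) {t : ℝ | 0 ≤ t ∧ (t : EReal) < tp} ∧
      ContinuousOn u {t : ℝ | 0 < t ∧ (t : EReal) < tp}) ∧
    (∀ x₀ ∈ V, ∀ (tp : EReal) (u : ℝ → E₁),
      QuasiPar.IsMaximalSolution ι hμ V A F₁ F₂ x₀ tp u →
      QuasiPar.AwayFromBoundary ι hμ V x₀ tp u →
      (UniformContinuousOn (QuasiPar.orbit ι hμ x₀ u) {t : ℝ | 0 ≤ t ∧ (t : EReal) < tp} →
        tp = ⊤) ∧
      (IsCompactOperator ι →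
        (∃ δ ∈ Set.Ioc μ 1, ∃ τ : ℝ, 0 < τ ∧ (τ : EReal) < tp ∧
          ∃ C : ℝ, ∀ t : ℝ, τ ≤ t → (t : EReal) < tp → QuasiPar.scaleNorm ι δ (u t) ≤ C) →
        tp = ⊤)) := by
  have hN : QuasiPar.Admissible hμ V (QuasiPar.rhs hμ A F₁ F₂) :=
    QuasiPar.admissible_rhs hμ hV h1 h2
  refine ⟨fun X hX => ?_, fun X hX => ?_, fun X hX tp u hmax haway => ⟨fun hu => ?_, ?_⟩⟩
  · obtain ⟨τ, hτ, ε, hε, σ, hσ, u, hu, hlip⟩ := hN.exists_sol hX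
    simp only [mem_closedBall_iff_norm]
    refine ⟨τ, hτ, ε, hε, σ, hσ, u, fun x hx => ⟨(QuasiPar.isSolution_iff hτ).2 (hu x hx), ?_⟩,
      fun x₁ h₁ x₂ h₂ => QuasiPar.normE1_sub_le hτ (hu x₁ h₁).2 (hu x₂ h₂).2 (hlip x₁ h₁ x₂ h₂)⟩
    exact fun v hv =>
      hN.eqOn (hu x hx).1 ((QuasiPar.isSolution_iff hτ).1 hv).2 (hu x hx).2
  · obtain ⟨tp, u, h⟩ := hN.exists_isMaxSol hX
    exact ⟨tp, u, (QuasiPar.isMaximalSolution_iff hX).2 h, h.continuousOn_orbit, h.continuousOn⟩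
  · exact ((QuasiPar.isMaximalSolution_iff hX).1 hmax).eq_top_of_uniformContinuousOn hN hV haway hu
  · rintro hι ⟨δ, hδ, τ, -, hτ, C, hu⟩
    exact ((QuasiPar.isMaximalSolution_iff hX).1 hmax).eq_top_of_isCompactOperator hN hV haway hι
      hδ hτ hu

theorem theorem2p2 {E₀ E₁ : Type*}
    [NormedAddCommGroup E₀] [NormedSpace ℝ E₀] [CompleteSpace E₀]
    [NormedAddCommGroup E₁] [NormedSpace ℝ E₁] [CompleteSpace E₁]
    (ι : E₁ →L[ℝ] E₀) (hinj : Function.Injective ι) (hdense : DenseRange ι)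
    (μ : ℝ) (hμ : μ ∈ Set.Ioo (0 : ℝ) 1)
    (V : Set (QuasiPar.Interp ι μ)) (hV : IsOpen V)
    (A : QuasiPar.Interp ι μ → E₁ →L[ℝ] E₀) (F₁ F₂ : QuasiPar.Interp ι μ → E₀)
    (h1 : QuasiPar.H1 ι V A F₁) (h2 : QuasiPar.H2 ι V F₂) :
    -- (a) local solutions
    (∀ x₀ ∈ V, ∃ τ > 0, ∃ ε > 0, ∃ σ > 0, ∃ u : QuasiPar.Interp ι μ → ℝ → E₁,
      (∀ x ∈ Metric.closedBall x₀ ε,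
        QuasiPar.IsSolution ι hμ V A F₁ F₂ x τ (u x) ∧
        ∀ v : ℝ → E₁, QuasiPar.IsSolution ι hμ V A F₁ F₂ x τ v →
          Set.EqOn v (u x) (Set.Ioc 0 τ)) ∧
      ∀ x₁ ∈ Metric.closedBall x₀ ε, ∀ x₂ ∈ Metric.closedBall x₀ ε,
        QuasiPar.normE1 ι μ τ (u x₁ - u x₂) ≤ σ * ‖x₁ - x₂‖) ∧
    -- (b) maximal solutions
    (∀ x₀ ∈ V, ∃ (tp : EReal) (u : ℝ → E₁),
      QuasiPar.IsMaximalSolution ι hμ V A F₁ F₂ x₀ tp u ∧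
      ContinuousOn (QuasiPar.orbit ι hμ x₀ u) {t : ℝ | 0 ≤ t ∧ (t : EReal) < tp} ∧
      ContinuousOn u {t : ℝ | 0 < t ∧ (t : EReal) < tp}) ∧
    -- (c) global solutions
    (∀ x₀ ∈ V, ∀ (tp : EReal) (u : ℝ → E₁),
      QuasiPar.IsMaximalSolution ι hμ V A F₁ F₂ x₀ tp u →
      QuasiPar.AwayFromBoundary ι hμ V x₀ tp u →
      (UniformContinuousOn (QuasiPar.orbit ι hμ x₀ u) {t : ℝ | 0 ≤ t ∧ (t : EReal) < tp} →
        tp = ⊤) ∧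
      (IsCompactOperator ι →
        (∃ δ ∈ Set.Ioc μ 1, ∃ τ : ℝ, 0 < τ ∧ (τ : EReal) < tp ∧
          ∃ C : ℝ, ∀ t : ℝ, τ ≤ t → (t : EReal) < tp → QuasiPar.scaleNorm ι δ (u t) ≤ C) →
        tp = ⊤)) := by
  exact theorem2p2_general ι μ hμ V hV A F₁ F₂ h1 h2
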